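/- Let $\gamma$ be the Gaussian measure $d\gamma(x)=\pi^{-n/2}e^{-|x|^2}\,dx$ on $\mathbb{R}^n$, let $L=-\frac12\Delta+x\cdot\nabla$ be the Ornstein--Uhlenbeck operator, and let $e^{-sL}f(x)=\int_{\mathbb{R}^n}M_s(x,y)f(y)\,d\gamma(y)$, $s>0$, be its semigroup, where $$M_s(x,y)=(1-e^{-2s})^{-n/2}\exp\Big(-\frac{e^{-s}}{1-e^{-2s}}|x-y|^2\Big)\exp\Big(\frac{e^{-s}}{1+e^{-s}}(|x|^2+|y|^2)\Big).$$ Let $\widetilde m(x)=1$ if $|x|<1$ and $\widetilde m(x)=2^{-k}$ if $2^{k-1}\le|x|<2^k$, $k\ge1$, and put $D=\{(y,t)\in\mathbb{R}^n\times(0,\infty):0<t<\widetilde m(y)\}$ and $\Gamma(x)=\{(y,t)\in D:|y-x|<t\}$. The Gaussian tent space $\mathfrak{t}^2(\gamma)$ consists of the measurable functions $u:D\to\mathbb{C}$ with $$\|u\|_{\mathfrak{t}^2(\gamma)}=\Big(\int_{\mathbb{R}^n}\iint_{\Gamma(x)}|u(y,t)|^2\,\frac{d\gamma(y)\,dt}{t\,\gamma(B(y,t))}\,d\gamma(x)\Big)^{1/2}<\infty;$$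 such a $u$ is extended by zero outside $D$. Let $\Phi:(0,\infty)\to\mathbb{C}$ be twice continuously differentiable with $\sup_{t>0}(|\Phi(t)|+t|\Phi'(t)|)+\sup_{0<t\le1}|t^2\Phi''(t)|<\infty$. For $\delta,\delta'>0$ and a measurable $\rho:\mathbb{R}^n\to(0,1]$ let $$\pi_1^{\rho}u(x)=\int_0^{\rho(x)}\Phi((\delta'+\delta)t^2)\,t^2Le^{-\delta't^2L}u(\cdot,t)(x)\,\frac{dt}{t},$$ where the integral is understood as the limit in $L^2(\gamma)$, as $\varepsilon\to0^+$, of the integrals over $\varepsilon<t<\rho(x)$ (equal to $0$ if $\rho(x)\le\varepsilon$). Let $0<\delta'\le1$. There is a constant $C$, depending only on $n$ and $\delta'$, such that for all such $\Phi$, all $\delta>0$, all $u\in\mathfrak{t}^2(\gamma)$ and all $\kappa\ge1$, the function $\pi_1u=\pi_1^{\widetilde m/\kappa}u$ is well defined and $$\|\pi_1u\|_{L^2(\gamma)}\le C\,\sup_{t>0}|\Phi(t)|\;\|u\|_{\mathfrak{t}^2(\gamma)}.$$ More generally, with the same constant, for every measurable $\rho:\mathbb{R}^n\to(0,1]$ the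 function $\pi_1^{\rho}u$ is well defined and $\|\pi_1^{\rho}u\|_{L^2(\gamma)}\le C\,\sup_{t>0}|\Phi(t)|\,\|u\|_{\mathfrak{t}^2(\gamma)}$. Here "well defined" means: for almost every $t>0$ one has $u(\cdot,t)\in L^2(\gamma)$ and $e^{-\delta't^2L}u(\cdot,t)\in C^2(\mathbb{R}^n)$; for almost every $x$ the integrals over $\varepsilon<t<\rho(x)$ converge absolutely for all $\varepsilon>0$; they define functions of $x$ in $L^2(\gamma)$, which converge in $L^2(\gamma)$ as $\varepsilon\to0^+$; and for almost every $x$ for which the integral over $0<t<\rho(x)$ converges absolutely, it is equal to the value of the limit at $x$. -/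

import Mathlib

open MeasureTheory Filter Topology Set
open scoped NNReal ENNReal

namespace GaussianTent

/-- The Euclidean space `ℝⁿ`. -/
abbrev E (n : ℕ) : Type := EuclideanSpace ℝ (Fin n)

/-- The Gaussian measure `dγ(x) = π^{-n/2} e^{-|x|²} dx` on `ℝⁿ`. -/
noncomputable def gauss (n : ℕ) : Measure (E n) :=
  (volume : Measure (E n)).withDensity
    (fun x => ENNReal.ofReal (Real.pi ^ (-(n : ℝ) / 2) * Real.exp (-‖x‖ ^ 2)))

instance (n : ℕ) : SFinite (gauss n) := by
  unfold gauss; infer_instance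

/-- The Ornstein--Uhlenbeck differential operator `L = -½ Δ + x · ∇`. -/
noncomputable def ouL {n : ℕ} (f : E n → ℂ) (x : E n) : ℂ :=
  -(1 / 2 : ℂ) * Laplacian.laplacian f x + fderiv ℝ f x x

/-- The Mehler kernel `M_s(x, y)`, `s > 0`, with respect to the Gaussian measure. -/
noncomputable def mehler {n : ℕ} (s : ℝ) (x y : E n) : ℝ :=
  1 / (1 - Real.exp (-2 * s)) ^ ((n : ℝ) / 2)
    * Real.exp (-(Real.exp (-s) / (1 - Real.exp (-2 * s))) * ‖x - y‖ ^ 2)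
    * Real.exp (Real.exp (-s) / (1 + Real.exp (-s)) * (‖x‖ ^ 2 + ‖y‖ ^ 2))

/-- The Ornstein--Uhlenbeck semigroup
`e^{-sL} f (x) = ∫ M_s(x, y) f(y) dγ(y)`, `s > 0`. -/
noncomputable def ouSemigroup {n : ℕ} (s : ℝ) (f : E n → ℂ) (x : E n) : ℂ :=
  ∫ y, (mehler s x y : ℂ) * f y ∂(gauss n)

/-- The discretized admissibility function: `1` if `|x| < 1`, and `2^{-k}` if
`2^{k-1} ≤ |x| < 2^k` with `k ≥ 1`. -/
noncomputable def adm {n : ℕ} (x : E n) : ℝ :=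
  if ‖x‖ < 1 then 1 else (2 : ℝ) ^ (-(Int.log 2 ‖x‖ + 1))

theorem adm_of_lt_one {n : ℕ} {x : E n} (hx : ‖x‖ < 1) : adm x = 1 := by
  simp [adm, hx]

theorem adm_of_dyadic {n : ℕ} {x : E n} {k : ℕ} (hk : 1 ≤ k)
    (h₁ : (2 : ℝ) ^ (k - 1) ≤ ‖x‖) (h₂ : ‖x‖ < (2 : ℝ) ^ k) :
    adm x = 1 / (2 : ℝ) ^ k := by
  obtain ⟨j, rfl⟩ : ∃ j, k = j + 1 := ⟨k - 1, by omega⟩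
  simp only [Nat.add_sub_cancel] at h₁
  have h1 : (1 : ℝ) ≤ ‖x‖ := le_trans (one_le_pow₀ (by norm_num)) h₁
  have hpos : 0 < ‖x‖ := by linarith
  have hlog : Int.log 2 ‖x‖ = (j : ℤ) := by
    apply le_antisymm
    · have := (Int.lt_zpow_iff_log_lt (b := 2) (by norm_num) (x := (j : ℤ) + 1) hpos).1
        (by exact_mod_cast h₂)
      omega
    · exact (Int.zpow_le_iff_le_log (b := 2) (by norm_num) hpos).1 (by exact_mod_cast h₁)
  rw [adm, if_neg (not_lt.2 h1), hlog, zpow_neg, one_div]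
  norm_cast

/-- The admissible region `D = {(y, t) : 0 < t < adm y}`. -/
def region (n : ℕ) : Set (E n × ℝ) := {z | 0 < z.2 ∧ z.2 < adm z.1}

/-- The admissible cone `Γ(x) = {(y, t) ∈ D : |y - x| < t}`. -/
def cone {n : ℕ} (x : E n) : Set (E n × ℝ) := {z | z ∈ region n ∧ ‖z.1 - x‖ < z.2}

/-- The norm of the Gaussian tent space `𝔱^p(γ)`, with values in `[0, ∞]`. It depends only on
the values of `u` on the admissible region. -/
noncomputable def tentNorm {n : ℕ} (p : ℝ) (u : E n × ℝ → ℂ) : ℝ≥0∞ :=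
  (∫⁻ x, (∫⁻ z in cone x,
      ‖u z‖ₑ ^ 2 / (ENNReal.ofReal z.2 * gauss n (Metric.ball z.1 z.2))
        ∂((gauss n).prod volume)) ^ (p / 2) ∂(gauss n)) ^ (1 / p)

/-- `u`, regarded as a function on the admissible region, belongs to the Gaussian tent space
`𝔱^p(γ)`. -/
def MemTent {n : ℕ} (p : ℝ) (u : E n × ℝ → ℂ) : Prop :=
  AEStronglyMeasurable u (((gauss n).prod volume).restrict (region n)) ∧ tentNorm p u < ∞

/-- The function `u(·, t)`, where `u` is extended by zero outside the admissible region. -/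
noncomputable def slice {n : ℕ} (u : E n × ℝ → ℂ) (t : ℝ) (x : E n) : ℂ :=
  (region n).indicator u (x, t)

/-- The functions `Φ : (0, ∞) → ℂ` that define the spectral multipliers: twice continuously
differentiable with `sup_{t > 0} (|Φ(t)| + t|Φ'(t)|) + sup_{0 < t ≤ 1} |t²Φ''(t)| < ∞`. -/
structure IsMultiplierFunction (Φ : ℝ → ℂ) : Prop where
  contDiffOn : ContDiffOn ℝ 2 Φ (Ioi 0)
  bound : ∃ B : ℝ, ∀ t : ℝ, 0 < t → ‖Φ t‖ + t * ‖deriv Φ t‖ ≤ B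
  bound_two : ∃ B : ℝ, ∀ t : ℝ, 0 < t → t ≤ 1 → t ^ 2 * ‖deriv (deriv Φ) t‖ ≤ B

/-- The integrand `Φ((δ' + δ)t²) t² L e^{-δ't²L} u(·, t)(x) / t` of the admissible part. -/
noncomputable def integrand {n : ℕ} (Φ : ℝ → ℂ) (δ δ' : ℝ) (u : E n × ℝ → ℂ)
    (x : E n) (t : ℝ) : ℂ :=
  Φ ((δ' + δ) * t ^ 2) * ((t : ℂ) ^ 2 * ouL (ouSemigroup (δ' * t ^ 2) (slice u t)) x) / (t : ℂ)

/-- The integral `∫_ε^{ρ(x)} Φ((δ' + δ)t²) t² L e^{-δ't²L} u(·, t)(x) dt/t`, which is `0` if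
`ρ(x) ≤ ε`. For `ε = 0` this is the pointwise integral for `π₁u(x)` with cutoff `ρ`. -/
noncomputable def truncPi {n : ℕ} (Φ : ℝ → ℂ) (δ δ' : ℝ) (ρ : E n → ℝ) (u : E n × ℝ → ℂ)
    (ε : ℝ) (x : E n) : ℂ :=
  ∫ t in Ioo ε (ρ x), integrand Φ δ δ' u x t

/-- `F = π₁u = ∫_0^{ρ(·)} Φ((δ' + δ)t²) t² L e^{-δ't²L} u(·, t) dt/t` in `L²(γ)`. For a general `u`
in `𝔱²(γ)` the integral need not converge absolutely at `t = 0`; it is the limit in `L²(γ)` of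
the integrals over `(ε, ρ(·))`. All the objects involved are required to be well defined, and
`F` has to agree with the pointwise integral over `(0, ρ(x))` where that converges absolutely. -/
structure IsPiOne {n : ℕ} (Φ : ℝ → ℂ) (δ δ' : ℝ) (ρ : E n → ℝ) (u : E n × ℝ → ℂ)
    (F : E n → ℂ) : Prop where
  slice_memLp : ∀ᵐ t : ℝ ∂(volume.restrict (Ioi 0)), MemLp (slice u t) 2 (gauss n)
  contDiff : ∀ᵐ t : ℝ ∂(volume.restrict (Ioi 0)),
    ContDiff ℝ 2 (ouSemigroup (δ' * t ^ 2) (slice u t))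
  integrableOn : ∀ᵐ x ∂(gauss n), ∀ ε : ℝ, 0 < ε →
    IntegrableOn (integrand Φ δ δ' u x) (Ioo ε (ρ x))
  trunc_memLp : ∀ ε : ℝ, 0 < ε → MemLp (truncPi Φ δ δ' ρ u ε) 2 (gauss n)
  memLp : MemLp F 2 (gauss n)
  tendsto : Tendsto (fun ε : ℝ => eLpNorm (truncPi Φ δ δ' ρ u ε - F) 2 (gauss n))
    (𝓝[>] 0) (𝓝 0)
  eq_integral : ∀ᵐ x ∂(gauss n), IntegrableOn (integrand Φ δ δ' u x) (Ioo 0 (ρ x)) →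
    F x = truncPi Φ δ δ' ρ u 0 x

end GaussianTent

open GaussianTent

/-! The proof is a duality argument. For a window `(a, b)` of times with `a > 0`, let `G` be the
integral of `ψ(t) t L e^{-ct²L} U(·, t) 1_{t < ρ}` over the window, with `c = δ'`, `ψ(t) = Φ((δ' +
δ)t²)` and `U` a representative of `u`. Pairing `G` with itself and moving the self-adjoint `L
e^{-ct²L}` across gives `∫ ψ(t) t ⟨U(·, t), L e^{-ct²L}(1_{t < ρ} G)⟩ dt`. Cauchy–Schwarz bounds
this by `sup |Φ|` times the root of the energy `∫ ‖U(·, t)‖² dt/t` (at most the squared tent norm,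
by Fubini) times the root of the square function `∫ t³ ‖L e^{-ct²L}(1_{t < ρ} G)‖² dt`.

So everything rests on bounding this square function by a multiple of `‖G‖²` for an arbitrary
measurable `ρ` (`lintegral_square_function_le`). For a fixed function this is classical; here the
function is truncated to sets that shrink with `t` and do not commute with the semigroup. Put
`h_f(s) = ⟨e^{-sL} f, f⟩`, which is decreasing and convex. Complete monotonicity gives `‖L e^{-sL}
f‖² ≤ (4/r²)(h_f(r) - h_f(2r))` for `s ≥ r`, with no spectral theorem. On dyadic blocks the right
side is at most twice the decrement of the averages of `h_f(kr)` over `1 ≤ k ≤ 2^j`. The sum over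
blocks telescopes, except for the errors made when the truncation changes from `S j` to `S (j + 1)`.
By positivity of the kernel these errors are at most `3 ∫ A_{j+1}|G| · 1_{S j \ S (j+1)} |G|`, with
`A_j` the average of `e^{-krL}`. As the difference sets are disjoint, their sum is a linearized
maximal function, bounded on `L²` by a `TT*` argument (`linearized_maximal_le`,
`sum_heatForm_indicator_le`).

The estimate on windows is uniform and proportional to the energy of the window, so the truncated
integrals are Cauchy in `L²(γ)` as `ε → 0`; this gives existence of the limit and the final bound at
once (`exists_isPiOne`). -/

namespace GaussianTent

/-! ### Gaussian integrals and the Mehler kernel: total mass one and the semigroup law. -/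

section Kernel

variable {n : ℕ}

theorem integrable_exp_quadratic {b : ℝ} (hb : 0 < b) (c : E n) :
    Integrable (fun v : E n => Real.exp (-b * ‖v‖ ^ 2 + inner ℝ c v)) := by
  have h := (GaussianFourier.integrable_cexp_neg_mul_sq_norm_add (V := E n) (b := (b : ℂ))
    (by simpa using hb) 1 c).norm
  refine h.congr (Eventually.of_forall fun v => ?_)
  simp only [Complex.norm_exp]
  congr 1
  norm_cast
  simp

theorem integral_exp_quadratic {b : ℝ} (hb : 0 < b) (c : E n) :
    ∫ v : E n, Real.exp (-b * ‖v‖ ^ 2 + inner ℝ c v)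
      = (Real.pi / b) ^ ((n : ℝ) / 2) * Real.exp (‖c‖ ^ 2 / (4 * b)) := by
  have h := GaussianFourier.integral_cexp_neg_mul_sq_norm_add (V := E n) (b := (b : ℂ))
    (by simpa using hb) 1 c
  rw [← Complex.ofReal_inj, ← integral_complex_ofReal]
  have e1 : (fun v : E n => ((Real.exp (-b * ‖v‖ ^ 2 + inner ℝ c v) : ℝ) : ℂ))
      = fun v => Complex.exp (-(b : ℂ) * ‖v‖ ^ 2 + 1 * ((inner ℝ c v : ℝ) : ℂ)) := by
    funext v; push_cast; simp
  rw [e1]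
  refine h.trans ?_
  rw [Complex.ofReal_mul, Complex.ofReal_cpow (by positivity)]
  push_cast
  simp

theorem integral_gauss_real (f : E n → ℝ) :
    ∫ x, f x ∂(gauss n)
      = ∫ x, (Real.pi ^ (-(n : ℝ) / 2) * Real.exp (-‖x‖ ^ 2)) * f x := by
  unfold gauss
  rw [integral_withDensity_eq_integral_toReal_smul (by fun_prop)
    (Eventually.of_forall fun _ => ENNReal.ofReal_lt_top)]
  refine integral_congr_ae (Eventually.of_forall fun x => ?_)
  simp only
  rw [ENNReal.toReal_ofReal (by positivity), smul_eq_mul]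

theorem integrable_gauss_iff (f : E n → ℝ) :
    Integrable f (gauss n) ↔
      Integrable (fun x => (Real.pi ^ (-(n : ℝ) / 2) * Real.exp (-‖x‖ ^ 2)) * f x) := by
  unfold gauss
  rw [integrable_withDensity_iff_integrable_smul' (by fun_prop)
    (Eventually.of_forall fun _ => ENNReal.ofReal_lt_top)]
  refine integrable_congr (Eventually.of_forall fun x => ?_)
  simp only
  rw [ENNReal.toReal_ofReal (by positivity), smul_eq_mul]

theorem gauss_density_mul (b : ℝ) (c v : E n) :
    (Real.pi ^ (-(n : ℝ) / 2) * Real.exp (-‖v‖ ^ 2)) * Real.exp (-b * ‖v‖ ^ 2 + inner ℝ c v)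
      = Real.pi ^ (-(n : ℝ) / 2) * Real.exp (-(1 + b) * ‖v‖ ^ 2 + inner ℝ c v) := by
  rw [mul_assoc, ← Real.exp_add]
  ring_nf

theorem integrable_gauss_exp {b : ℝ} (hb : -1 < b) (c : E n) :
    Integrable (fun v : E n => Real.exp (-b * ‖v‖ ^ 2 + inner ℝ c v)) (gauss n) := by
  rw [integrable_gauss_iff]
  simp_rw [gauss_density_mul]
  exact (integrable_exp_quadratic (by linarith) c).const_mul _

theorem integral_gauss_exp {b : ℝ} (hb : -1 < b) (c : E n) :
    ∫ v : E n, Real.exp (-b * ‖v‖ ^ 2 + inner ℝ c v) ∂(gauss n)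
      = 1 / (1 + b) ^ ((n : ℝ) / 2) * Real.exp (‖c‖ ^ 2 / (4 * (1 + b))) := by
  rw [integral_gauss_real]
  simp_rw [gauss_density_mul]
  rw [integral_const_mul, integral_exp_quadratic (by linarith),
    Real.div_rpow Real.pi_pos.le (by linarith), neg_div, Real.rpow_neg Real.pi_pos.le]
  have : 0 < Real.pi ^ ((n : ℝ) / 2) := by positivity
  field_simp

instance : IsProbabilityMeasure (gauss n) := by
  constructor
  have h := integral_gauss_exp (n := n) (b := 0) (by norm_num) 0
  have h1 := integrable_gauss_exp (n := n) (b := 0) (by norm_num) 0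
  simp only [neg_zero, zero_mul, inner_zero_left, add_zero, Real.exp_zero, Real.one_rpow,
    norm_zero, ne_eq, OfNat.ofNat_ne_zero, not_false_eq_true, zero_pow, zero_div, mul_one,
    div_one] at h h1
  have : IsFiniteMeasure (gauss n) := by
    rw [integrable_const_iff] at h1
    simpa using h1
  rw [integral_const, smul_eq_mul, mul_one] at h
  rw [← ENNReal.toReal_eq_one_iff]
  exact h

/-- The coefficient of `-|x|²` and `-|y|²` in the exponent of the Mehler kernel. -/
noncomputable def mehlerSq (s : ℝ) : ℝ := Real.exp (-s) ^ 2 / (1 - Real.exp (-s) ^ 2)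

/-- The coefficient of `⟨x, y⟩` in the exponent of the Mehler kernel. -/
noncomputable def mehlerCross (s : ℝ) : ℝ := 2 * Real.exp (-s) / (1 - Real.exp (-s) ^ 2)

theorem one_sub_exp_sq_pos {s : ℝ} (hs : 0 < s) : 0 < 1 - Real.exp (-s) ^ 2 := by
  have : Real.exp (-s) < 1 := by
    simpa using hs
  nlinarith [Real.exp_pos (-s)]

theorem mehlerSq_pos {s : ℝ} (hs : 0 < s) : 0 < mehlerSq s := by
  have := one_sub_exp_sq_pos hs
  unfold mehlerSq; positivity

/-- In `y` the exponent is a multiple of `|y|²` plus a linear form, so integrals of the kernel and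
of products of kernels reduce to `integral_gauss_exp`. -/
theorem mehler_eq {s : ℝ} (hs : 0 < s) (x y : E n) :
    mehler s x y = 1 / (1 - Real.exp (-s) ^ 2) ^ ((n : ℝ) / 2)
      * Real.exp (-mehlerSq s * ‖x‖ ^ 2)
      * Real.exp (-mehlerSq s * ‖y‖ ^ 2 + inner ℝ (mehlerCross s • x) y) := by
  have h1 := one_sub_exp_sq_pos hs
  have e : Real.exp (-2 * s) = Real.exp (-s) ^ 2 := by
    rw [← Real.exp_nat_mul]; congr 1; push_cast; ring
  unfold mehler mehlerSq mehlerCross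
  rw [e, mul_assoc, mul_assoc, ← Real.exp_add, ← Real.exp_add, inner_smul_left]
  congr 2
  rw [@norm_sub_sq_real]
  have h2 : 0 < Real.exp (-s) := Real.exp_pos _
  set q := Real.exp (-s)
  have h3 : 1 - q ^ 2 = (1 - q) * (1 + q) := by ring
  have h4 : 1 - q ≠ 0 := by
    intro h; rw [h3, h] at h1; simp at h1
  have h5 : 1 + q ≠ 0 := by positivity
  simp only [conj_trivial]
  rw [h3]
  field_simp
  ring

theorem mehler_nonneg {s : ℝ} (hs : 0 < s) (x y : E n) : 0 ≤ mehler s x y := by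
  have := one_sub_exp_sq_pos hs
  rw [mehler_eq hs]; positivity

theorem mehler_comm (s : ℝ) (x y : E n) : mehler s x y = mehler s y x := by
  unfold mehler; rw [norm_sub_rev, add_comm (‖x‖ ^ 2)]

theorem measurable_mehler :
    Measurable (fun p : ℝ × E n × E n => mehler p.1 p.2.1 p.2.2) := by
  unfold mehler; fun_prop

theorem integrable_mehler {s : ℝ} (hs : 0 < s) (x : E n) :
    Integrable (fun y => mehler s x y) (gauss n) := by
  simp_rw [mehler_eq hs]
  exact (integrable_gauss_exp (by linarith [mehlerSq_pos hs]) _).const_mul _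

theorem integral_mehler {s : ℝ} (hs : 0 < s) (x : E n) :
    ∫ y, mehler s x y ∂(gauss n) = 1 := by
  simp_rw [mehler_eq hs]
  rw [integral_const_mul, integral_gauss_exp (by linarith [mehlerSq_pos hs])]
  have h1 := one_sub_exp_sq_pos hs
  have e1 : 1 + mehlerSq s = 1 / (1 - Real.exp (-s) ^ 2) := by
    unfold mehlerSq; field_simp; ring
  -- With `a = mehlerSq s` and `b = mehlerCross s` one has `b² = 4a(1 + a)`, so completing the
  -- square in `y` exactly cancels the prefactor in `x`.
  have e2 : -mehlerSq s * ‖x‖ ^ 2 + ‖mehlerCross s • x‖ ^ 2 / (4 * (1 + mehlerSq s)) = 0 := by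
    rw [e1, norm_smul, mul_pow, Real.norm_eq_abs, sq_abs]
    unfold mehlerSq mehlerCross
    field_simp
    ring
  have e3 : ∀ a b c d : ℝ, a * Real.exp b * (c * Real.exp d) = a * c * Real.exp (b + d) := by
    intro a b c d; rw [Real.exp_add]; ring
  rw [e3, e2, e1, Real.exp_zero, Real.div_rpow zero_le_one h1.le, Real.one_rpow]
  have : 0 < (1 - Real.exp (-s) ^ 2) ^ ((n : ℝ) / 2) := by positivity
  field_simp

theorem mehler_mul_mehler {s t : ℝ} (hs : 0 < s) (ht : 0 < t) (x y z : E n) :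
    mehler s x z * mehler t z y = (1 / (1 - Real.exp (-s) ^ 2) ^ ((n : ℝ) / 2)
      * (1 / (1 - Real.exp (-t) ^ 2) ^ ((n : ℝ) / 2))
      * Real.exp (-mehlerSq s * ‖x‖ ^ 2 - mehlerSq t * ‖y‖ ^ 2))
      * Real.exp (-(mehlerSq s + mehlerSq t) * ‖z‖ ^ 2
        + inner ℝ (mehlerCross s • x + mehlerCross t • y) z) := by
  rw [mehler_comm t, mehler_eq hs, mehler_eq ht, inner_add_left]
  have e3 : ∀ a b c d e f : ℝ, a * Real.exp b * Real.exp c * (d * Real.exp e * Real.exp f)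
    = a * d * Real.exp (b + e) * Real.exp (c + f) := by
    intro a b c d e f; simp only [Real.exp_add]; ring
  rw [e3]
  congr 2
  · ring_nf
  · ring

theorem integrable_mehler_mul_mehler {s t : ℝ} (hs : 0 < s) (ht : 0 < t) (x y : E n) :
    Integrable (fun z => mehler s x z * mehler t z y) (gauss n) := by
  simp_rw [mehler_mul_mehler hs ht]
  exact (integrable_gauss_exp (by linarith [mehlerSq_pos hs, mehlerSq_pos ht]) _).const_mul _

theorem integral_mehler_mul_mehler {s t : ℝ} (hs : 0 < s) (ht : 0 < t) (x y : E n) :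
    ∫ z, mehler s x z * mehler t z y ∂(gauss n) = mehler (s + t) x y := by
  simp_rw [mehler_mul_mehler hs ht]
  rw [integral_const_mul, integral_gauss_exp (by linarith [mehlerSq_pos hs, mehlerSq_pos ht]),
    mehler_eq (by linarith)]
  have h1 := one_sub_exp_sq_pos hs
  have h2 := one_sub_exp_sq_pos ht
  have h3 := one_sub_exp_sq_pos (add_pos hs ht)
  have e0 : Real.exp (-(s + t)) = Real.exp (-s) * Real.exp (-t) := by
    rw [← Real.exp_add]; ring_nf
  rw [e0] at h3
  unfold mehlerSq mehlerCross
  rw [e0]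
  clear e0
  generalize Real.exp (-s) = p at *
  generalize Real.exp (-t) = q at *
  -- The factor `1 - (pq)²`, where `pq = e^{-(s+t)}`, supplies the normalisation of the kernel at
  -- time `s + t`; the other two factors cancel those at `s` and `t`.
  have e1 : 1 + (p ^ 2 / (1 - p ^ 2) + q ^ 2 / (1 - q ^ 2))
      = (1 - (p * q) ^ 2) / ((1 - p ^ 2) * (1 - q ^ 2)) := by
    field_simp; ring
  have e3 : ∀ a b c d : ℝ, a * Real.exp b * (c * Real.exp d) = a * c * Real.exp (b + d) := by
    intro a b c d; rw [Real.exp_add]; ring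
  have e4 : ∀ a b c : ℝ, a * Real.exp b * Real.exp c = a * Real.exp (b + c) := by
    intro a b c; rw [Real.exp_add]; ring
  rw [e1, e3, Real.div_rpow h3.le (by positivity), Real.mul_rpow h1.le h2.le, e4, @norm_add_sq_real]
  simp only [norm_smul, mul_pow, Real.norm_eq_abs, sq_abs, inner_smul_left, inner_smul_right,
    conj_trivial]
  have h4 : 0 < (1 - p ^ 2) ^ ((n : ℝ) / 2) := by positivity
  have h5 : 0 < (1 - q ^ 2) ^ ((n : ℝ) / 2) := by positivity
  have h6 : 0 < (1 - p ^ 2 * q ^ 2) ^ ((n : ℝ) / 2) := by rw [← mul_pow]; positivity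
  have h7 : 0 < 1 - p ^ 2 * q ^ 2 := by rw [← mul_pow]; exact h3
  congr 1
  · field_simp
  · congr 1
    field_simp
    ring

end Kernel

end GaussianTent

/-! ### The semigroup on nonnegative functions: symmetry, invariance of the measure, contractivity.
-/

namespace GaussianTent

theorem lintegral_mul_sq_le {α : Type*} [MeasurableSpace α] {μ : Measure α} {f g : α → ℝ≥0∞}
    (hf : AEMeasurable f μ) (hg : AEMeasurable g μ) :
    (∫⁻ a, f a * g a ∂μ) ^ 2 ≤ (∫⁻ a, f a ^ 2 ∂μ) * ∫⁻ a, g a ^ 2 ∂μ := by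
  have h := ENNReal.lintegral_mul_le_Lp_mul_Lq μ (Real.HolderConjugate.two_two) hf hg
  have h2 := pow_le_pow_left₀ zero_le h 2
  refine h2.trans (le_of_eq ?_)
  rw [mul_pow, ← ENNReal.rpow_natCast, ← ENNReal.rpow_natCast, ← ENNReal.rpow_mul,
    ← ENNReal.rpow_mul]
  norm_num

section Positive

variable {n : ℕ}

/-- The Ornstein--Uhlenbeck semigroup acting on functions with values in `[0, ∞]`. -/
noncomputable def posSemigroup (s : ℝ) (f : E n → ℝ≥0∞) (x : E n) : ℝ≥0∞ :=
  ∫⁻ y, ENNReal.ofReal (mehler s x y) * f y ∂(gauss n)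

theorem measurable_mehler_uncurry (s : ℝ) :
    Measurable (fun p : E n × E n => mehler s p.1 p.2) :=
  measurable_mehler.comp (f := fun p : E n × E n => (s, p)) (by fun_prop)

theorem measurable_mehler_right (s : ℝ) (x : E n) : Measurable (fun y => mehler s x y) :=
  (measurable_mehler_uncurry s).comp (f := fun y => (x, y)) (by fun_prop)

theorem measurable_posSemigroup (s : ℝ) {f : E n → ℝ≥0∞} (hf : Measurable f) :
    Measurable (posSemigroup s f) := by
  unfold posSemigroup
  refine Measurable.lintegral_prod_right' (f := fun p : E n × E n =>
    ENNReal.ofReal (mehler s p.1 p.2) * f p.2) ?_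
  exact (measurable_mehler_uncurry s).ennreal_ofReal.mul (hf.comp measurable_snd)

theorem lintegral_mehler {s : ℝ} (hs : 0 < s) (x : E n) :
    ∫⁻ y, ENNReal.ofReal (mehler s x y) ∂(gauss n) = 1 := by
  rw [← ofReal_integral_eq_lintegral_ofReal (integrable_mehler hs x)
    (Eventually.of_forall fun y => mehler_nonneg hs x y), integral_mehler hs]
  simp

theorem lintegral_mehler_mul_mehler {s t : ℝ} (hs : 0 < s) (ht : 0 < t) (x y : E n) :
    ∫⁻ z, ENNReal.ofReal (mehler s x z) * ENNReal.ofReal (mehler t z y) ∂(gauss n)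
      = ENNReal.ofReal (mehler (s + t) x y) := by
  simp_rw [← ENNReal.ofReal_mul (mehler_nonneg hs x _)]
  rw [← ofReal_integral_eq_lintegral_ofReal (integrable_mehler_mul_mehler hs ht x y)
    (Eventually.of_forall fun z => mul_nonneg (mehler_nonneg hs _ _) (mehler_nonneg ht _ _)),
    integral_mehler_mul_mehler hs ht]

theorem posSemigroup_add {s t : ℝ} (hs : 0 < s) (ht : 0 < t) {f : E n → ℝ≥0∞}
    (hf : Measurable f) (x : E n) :
    posSemigroup s (posSemigroup t f) x = posSemigroup (s + t) f x := by
  unfold posSemigroup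
  simp_rw [← lintegral_mehler_mul_mehler hs ht]
  have m1 := measurable_mehler_right s x
  have m2 := measurable_mehler_uncurry (n := n) t
  have mf : ∀ z, Measurable fun y => ENNReal.ofReal (mehler t z y) * f y := fun z =>
    (measurable_mehler_right t z).ennreal_ofReal.mul hf
  simp_rw [← lintegral_const_mul _ (mf _)]
  rw [lintegral_lintegral_swap]
  · refine lintegral_congr fun y => ?_
    rw [← lintegral_mul_const]
    · simp_rw [mul_assoc]
    · exact m1.ennreal_ofReal.mul (m2.comp measurable_prodMk_right).ennreal_ofReal
  · exact ((m1.comp measurable_fst).ennreal_ofReal.mul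
      (m2.ennreal_ofReal.mul (hf.comp measurable_snd))).aemeasurable

theorem lintegral_posSemigroup_mul (s : ℝ) {f g : E n → ℝ≥0∞} (hf : Measurable f)
    (hg : Measurable g) :
    ∫⁻ x, posSemigroup s f x * g x ∂(gauss n) = ∫⁻ x, f x * posSemigroup s g x ∂(gauss n) := by
  unfold posSemigroup
  have m2 := measurable_mehler_uncurry (n := n) s
  have mf : ∀ z, Measurable fun y => ENNReal.ofReal (mehler s z y) * f y := fun z =>
    (measurable_mehler_right s z).ennreal_ofReal.mul hf
  have mg : ∀ z, Measurable fun y => ENNReal.ofReal (mehler s z y) * g y := fun z =>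
    (measurable_mehler_right s z).ennreal_ofReal.mul hg
  simp_rw [← lintegral_mul_const _ (mf _), ← lintegral_const_mul _ (mg _)]
  rw [lintegral_lintegral_swap]
  · refine lintegral_congr fun x => lintegral_congr fun y => ?_
    rw [mehler_comm s y x]
    ring
  · exact ((m2.ennreal_ofReal.mul (hf.comp measurable_snd)).mul
      (hg.comp measurable_fst)).aemeasurable

/-- Jensen's inequality for the probability measure `M_s(x, ·) dγ`, obtained from Cauchy–Schwarz
against the constant one. -/
theorem posSemigroup_sq_le {s : ℝ} (hs : 0 < s) {f : E n → ℝ≥0∞} (hf : Measurable f) (x : E n) :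
    posSemigroup s f x ^ 2 ≤ posSemigroup s (fun y => f y ^ 2) x := by
  have m1 := (measurable_mehler_right s x).ennreal_ofReal
  have h := lintegral_mul_sq_le
    (μ := (gauss n).withDensity fun y => ENNReal.ofReal (mehler s x y))
    (f := fun _ => 1) (g := f) aemeasurable_const hf.aemeasurable
  simp only [one_mul, one_pow] at h
  rw [lintegral_withDensity_eq_lintegral_mul _ m1 hf,
    lintegral_withDensity_eq_lintegral_mul _ m1 (hf.pow_const 2),
    lintegral_withDensity_eq_lintegral_mul _ m1 measurable_const] at h
  simp only [Pi.mul_apply, mul_one, lintegral_mehler hs, one_mul] at h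
  exact h

theorem lintegral_posSemigroup {s : ℝ} (hs : 0 < s) {f : E n → ℝ≥0∞} (hf : Measurable f) :
    ∫⁻ x, posSemigroup s f x ∂(gauss n) = ∫⁻ x, f x ∂(gauss n) := by
  have h := lintegral_posSemigroup_mul s hf (measurable_const (a := (1 : ℝ≥0∞)))
  simp only [mul_one] at h
  rw [h]
  refine lintegral_congr fun x => ?_
  simp [posSemigroup, lintegral_mehler hs]

theorem lintegral_posSemigroup_sq_le {s : ℝ} (hs : 0 < s) {f : E n → ℝ≥0∞} (hf : Measurable f) :
    ∫⁻ x, posSemigroup s f x ^ 2 ∂(gauss n) ≤ ∫⁻ x, f x ^ 2 ∂(gauss n) :=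
  (lintegral_mono fun x => posSemigroup_sq_le hs hf x).trans
    (lintegral_posSemigroup hs (hf.pow_const 2)).le

end Positive

/-! ### The semigroup on complex functions and as self-adjoint contractions of `L²(γ)`. -/

section Complex

variable {n : ℕ}

theorem ouSemigroup_congr_ae (s : ℝ) {f g : E n → ℂ} (h : f =ᵐ[gauss n] g) :
    ouSemigroup s f = ouSemigroup s g := by
  funext x
  refine integral_congr_ae (h.mono fun y hy => ?_)
  simp only [hy]

theorem enorm_ouSemigroup_le {s : ℝ} (hs : 0 < s) (f : E n → ℂ) (x : E n) :
    ‖ouSemigroup s f x‖ₑ ≤ posSemigroup s (fun y => ‖f y‖ₑ) x := by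
  refine (enorm_integral_le_lintegral_enorm _).trans (le_of_eq (lintegral_congr fun y => ?_))
  rw [enorm_mul]
  congr 1
  rw [← ofReal_norm, Complex.norm_real, Real.norm_of_nonneg (mehler_nonneg hs x y)]

/-- By symmetry the square of the kernel is `M_s(x, y) M_s(y, x)`, which is integrable. Hence
`e^{-sL} f` is defined at every point for `f` in `L²(γ)`, not merely almost everywhere. -/
theorem memLp_mehler {s : ℝ} (hs : 0 < s) (x : E n) :
    MemLp (fun y => (mehler s x y : ℂ)) 2 (gauss n) := by
  refine MemLp.ofReal ((memLp_two_iff_integrable_sq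
    (measurable_mehler_right s x).aestronglyMeasurable).2 ?_)
  refine (integrable_mehler_mul_mehler hs hs x x).congr (Eventually.of_forall fun y => ?_)
  simp only
  rw [mehler_comm s y x, sq]

theorem integrable_mehler_mul {s : ℝ} (hs : 0 < s) {f : E n → ℂ} (hf : MemLp f 2 (gauss n))
    (x : E n) : Integrable (fun y => (mehler s x y : ℂ) * f y) (gauss n) :=
  (memLp_mehler hs x).integrable_mul hf

theorem stronglyMeasurable_ouSemigroup (s : ℝ) {f : E n → ℂ} (hf : StronglyMeasurable f) :
    StronglyMeasurable (ouSemigroup s f) := by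
  refine StronglyMeasurable.integral_prod_right' (f := fun p : E n × E n =>
    (mehler s p.1 p.2 : ℂ) * f p.2) ?_
  exact (measurable_mehler_uncurry s).complex_ofReal.stronglyMeasurable.mul
    (hf.comp_measurable measurable_snd)

theorem eLpNorm_two_sq {α F : Type*} [MeasurableSpace α] [NormedAddCommGroup F] {μ : Measure α}
    (f : α → F) : eLpNorm f 2 μ ^ 2 = ∫⁻ a, ‖f a‖ₑ ^ 2 ∂μ := by
  rw [eLpNorm_eq_lintegral_rpow_enorm_toReal (by norm_num) (by norm_num)]
  simp only [ENNReal.toReal_ofNat, ENNReal.rpow_ofNat, one_div]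
  rw [← ENNReal.rpow_natCast, ← ENNReal.rpow_mul]
  norm_num

theorem eLpNorm_ouSemigroup_le {s : ℝ} (hs : 0 < s) {f : E n → ℂ} (hf : MemLp f 2 (gauss n)) :
    eLpNorm (ouSemigroup s f) 2 (gauss n) ≤ eLpNorm f 2 (gauss n) := by
  obtain ⟨g, hg, hfg⟩ := hf.1
  rw [ouSemigroup_congr_ae s hfg, eLpNorm_congr_ae hfg]
  rw [← ENNReal.pow_le_pow_left_iff two_ne_zero, eLpNorm_two_sq, eLpNorm_two_sq]
  exact (lintegral_mono fun x => pow_le_pow_left₀ zero_le (enorm_ouSemigroup_le hs g x) 2).trans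
    (lintegral_posSemigroup_sq_le hs hg.enorm)

theorem memLp_ouSemigroup {s : ℝ} (hs : 0 < s) {f : E n → ℂ} (hf : MemLp f 2 (gauss n)) :
    MemLp (ouSemigroup s f) 2 (gauss n) := by
  refine ⟨?_, (eLpNorm_ouSemigroup_le hs hf).trans_lt hf.2⟩
  obtain ⟨g, hg, hfg⟩ := hf.1
  rw [ouSemigroup_congr_ae s hfg]
  exact (stronglyMeasurable_ouSemigroup s hg).aestronglyMeasurable

theorem lintegral_posSemigroup_mul_lt_top {s : ℝ} (hs : 0 < s) {f g : E n → ℝ≥0∞}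
    (hf : Measurable f) (hg : Measurable g) (hf2 : ∫⁻ x, f x ^ 2 ∂(gauss n) < ∞)
    (hg2 : ∫⁻ x, g x ^ 2 ∂(gauss n) < ∞) :
    ∫⁻ x, posSemigroup s f x * g x ∂(gauss n) < ∞ := by
  have h := lintegral_mul_sq_le (μ := gauss n) (measurable_posSemigroup s hf).aemeasurable
    hg.aemeasurable
  have h3 := h.trans_lt (ENNReal.mul_lt_top ((lintegral_posSemigroup_sq_le hs hf).trans_lt hf2) hg2)
  by_contra hc
  rw [not_lt, top_le_iff] at hc
  simp [hc] at h3

theorem lintegral_enorm_sq_lt_top {α F : Type*} [MeasurableSpace α] [NormedAddCommGroup F]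
    {μ : Measure α} {f : α → F} (hf : MemLp f 2 μ) : ∫⁻ a, ‖f a‖ₑ ^ 2 ∂μ < ∞ := by
  rw [← eLpNorm_two_sq]
  exact ENNReal.pow_lt_top hf.2

theorem integrable_mehler_mul_mul {s : ℝ} (hs : 0 < s) {f g : E n → ℂ}
    (hfm : StronglyMeasurable f) (hgm : StronglyMeasurable g)
    (hf : MemLp f 2 (gauss n)) (hg : MemLp g 2 (gauss n)) :
    Integrable (fun p : E n × E n => (mehler s p.1 p.2 : ℂ) * f p.2 * g p.1)
      ((gauss n).prod (gauss n)) := by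
  have hm : StronglyMeasurable fun p : E n × E n => (mehler s p.1 p.2 : ℂ) * f p.2 * g p.1 :=
    ((measurable_mehler_uncurry s).complex_ofReal.stronglyMeasurable.mul
      (hfm.comp_measurable measurable_snd)).mul (hgm.comp_measurable measurable_fst)
  refine ⟨hm.aestronglyMeasurable, ?_⟩
  rw [hasFiniteIntegral_iff_enorm, lintegral_prod _ hm.enorm.aemeasurable]
  refine lt_of_le_of_lt (le_of_eq ?_) (lintegral_posSemigroup_mul_lt_top hs hfm.enorm hgm.enorm
    (lintegral_enorm_sq_lt_top hf) (lintegral_enorm_sq_lt_top hg))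
  refine lintegral_congr fun x => ?_
  unfold posSemigroup
  have mf : Measurable fun y => ENNReal.ofReal (mehler s x y) * ‖f y‖ₑ :=
    (measurable_mehler_right s x).ennreal_ofReal.mul hfm.enorm
  rw [← lintegral_mul_const _ mf]
  refine lintegral_congr fun y => ?_
  rw [enorm_mul, enorm_mul]
  congr 2
  rw [← ofReal_norm, Complex.norm_real, Real.norm_of_nonneg (mehler_nonneg hs x y)]

theorem integral_ouSemigroup_mul {s : ℝ} (hs : 0 < s) {f g : E n → ℂ}
    (hf : MemLp f 2 (gauss n)) (hg : MemLp g 2 (gauss n)) :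
    ∫ x, ouSemigroup s f x * g x ∂(gauss n) = ∫ x, f x * ouSemigroup s g x ∂(gauss n) := by
  obtain ⟨f', hfm, hff⟩ := hf.1
  obtain ⟨g', hgm, hgg⟩ := hg.1
  have hf' := hf.ae_eq hff
  have hg' := hg.ae_eq hgg
  rw [ouSemigroup_congr_ae s hff, ouSemigroup_congr_ae s hgg]
  have e1 : ∫ x, ouSemigroup s f' x * g x ∂(gauss n) = ∫ x, ouSemigroup s f' x * g' x ∂(gauss n) :=
    integral_congr_ae (hgg.mono fun x hx => by simp only [hx])
  have e2 : ∫ x, f x * ouSemigroup s g' x ∂(gauss n) = ∫ x, f' x * ouSemigroup s g' x ∂(gauss n) :=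
    integral_congr_ae (hff.mono fun x hx => by simp only [hx])
  rw [e1, e2]
  unfold ouSemigroup
  simp_rw [← integral_mul_const, ← integral_const_mul]
  rw [integral_integral_swap (integrable_mehler_mul_mul hs hfm hgm hf' hg')]
  refine integral_congr_ae (Eventually.of_forall fun x => integral_congr_ae
    (Eventually.of_forall fun y => ?_))
  simp only
  rw [mehler_comm s y x]
  ring

/-- Since `M_s(x, ·)` is itself in `L²(γ)`, the pointwise law is the symmetry of `e^{-tL}` tested on
this kernel, followed by the composition formula for kernels. -/
theorem ouSemigroup_add_time {s t : ℝ} (hs : 0 < s) (ht : 0 < t) {f : E n → ℂ}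
    (hf : MemLp f 2 (gauss n)) (x : E n) :
    ouSemigroup s (ouSemigroup t f) x = ouSemigroup (s + t) f x := by
  have h := integral_ouSemigroup_mul ht hf (memLp_mehler hs x)
  have e1 : ouSemigroup s (ouSemigroup t f) x
      = ∫ y, ouSemigroup t f y * (mehler s x y : ℂ) ∂(gauss n) :=
    integral_congr_ae (Eventually.of_forall fun y => mul_comm _ _)
  rw [e1, h]
  refine integral_congr_ae (Eventually.of_forall fun y => ?_)
  simp only
  rw [mul_comm]
  congr 1
  rw [← integral_mehler_mul_mehler hs ht, ← integral_complex_ofReal]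
  refine integral_congr_ae (Eventually.of_forall fun z => ?_)
  simp only
  rw [mehler_comm t y z]
  push_cast
  ring

theorem ouSemigroup_add {s : ℝ} (hs : 0 < s) {f g : E n → ℂ}
    (hf : MemLp f 2 (gauss n)) (hg : MemLp g 2 (gauss n)) :
    ouSemigroup s (f + g) = ouSemigroup s f + ouSemigroup s g := by
  funext x
  simp only [ouSemigroup, Pi.add_apply, mul_add]
  exact integral_add (integrable_mehler_mul hs hf x) (integrable_mehler_mul hs hg x)

theorem ouSemigroup_smul (s : ℝ) (c : ℂ) (f : E n → ℂ) :
    ouSemigroup s (c • f) = c • ouSemigroup s f := by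
  funext x
  simp only [ouSemigroup, Pi.smul_apply, smul_eq_mul]
  rw [← integral_const_mul]
  refine integral_congr_ae (Eventually.of_forall fun y => ?_)
  simp only
  ring

/-- The complex Hilbert space `L²(γ)`. -/
abbrev L2 (n : ℕ) : Type := Lp ℂ 2 (gauss n)

open scoped Classical in
/-- The operator `e^{-sL}` on `L²(γ)` for `s > 0`, and `0` for `s ≤ 0`. -/
noncomputable def heatOp (n : ℕ) (s : ℝ) : L2 n →L[ℂ] L2 n :=
  if hs : 0 < s then
    LinearMap.mkContinuous
      { toFun := fun f => (memLp_ouSemigroup hs (Lp.memLp f)).toLp _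
        map_add' := fun f g => by
          rw [← MemLp.toLp_add, MemLp.toLp_eq_toLp_iff,
            ouSemigroup_congr_ae s (Lp.coeFn_add f g),
            ouSemigroup_add hs (Lp.memLp f) (Lp.memLp g)]
        map_smul' := fun c f => by
          rw [RingHom.id_apply, ← MemLp.toLp_const_smul, MemLp.toLp_eq_toLp_iff,
            ouSemigroup_congr_ae s (Lp.coeFn_smul c f), ouSemigroup_smul] }
      1 (fun f => by
        rw [one_mul]
        simp only [LinearMap.coe_mk, AddHom.coe_mk]
        rw [Lp.norm_toLp, Lp.norm_def]
        exact ENNReal.toReal_mono (Lp.memLp f).2.ne (eLpNorm_ouSemigroup_le hs (Lp.memLp f)))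
  else 0

theorem heatOp_apply {s : ℝ} (hs : 0 < s) (f : L2 n) :
    heatOp n s f = (memLp_ouSemigroup hs (Lp.memLp f)).toLp _ := by
  rw [heatOp, dif_pos hs]; rfl

theorem coeFn_heatOp {s : ℝ} (hs : 0 < s) (f : L2 n) :
    heatOp n s f =ᵐ[gauss n] ouSemigroup s f := by
  rw [heatOp_apply hs]; exact MemLp.coeFn_toLp _

theorem norm_heatOp_le {s : ℝ} (hs : 0 < s) (f : L2 n) : ‖heatOp n s f‖ ≤ ‖f‖ := by
  rw [heatOp_apply hs, Lp.norm_toLp, Lp.norm_def]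
  exact ENNReal.toReal_mono (Lp.memLp f).2.ne (eLpNorm_ouSemigroup_le hs (Lp.memLp f))

theorem heatOp_heatOp {s t : ℝ} (hs : 0 < s) (ht : 0 < t) (f : L2 n) :
    heatOp n s (heatOp n t f) = heatOp n (s + t) f := by
  refine Lp.ext ?_
  refine (coeFn_heatOp hs _).trans (EventuallyEq.trans ?_ (coeFn_heatOp (add_pos hs ht) f).symm)
  rw [ouSemigroup_congr_ae s (coeFn_heatOp ht f)]
  exact Eventually.of_forall fun x => ouSemigroup_add_time hs ht (Lp.memLp f) x

theorem conj_ouSemigroup (s : ℝ) (f : E n → ℂ) (x : E n) :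
    (starRingEnd ℂ) (ouSemigroup s f x) = ouSemigroup s (fun y => (starRingEnd ℂ) (f y)) x := by
  unfold ouSemigroup
  rw [← integral_conj]
  simp

theorem inner_heatOp_left {s : ℝ} (hs : 0 < s) (f g : L2 n) :
    inner ℂ (heatOp n s f) g = inner ℂ f (heatOp n s g) := by
  rw [L2.inner_def, L2.inner_def]
  have h := integral_ouSemigroup_mul hs (Lp.memLp f).star (Lp.memLp g)
  refine Eq.trans ?_ (h.trans ?_)
  · refine integral_congr_ae ((coeFn_heatOp hs f).mono fun x hx => ?_)
    simp only [RCLike.inner_apply]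
    rw [hx, conj_ouSemigroup, mul_comm]
    rfl
  · refine integral_congr_ae ((coeFn_heatOp hs g).mono fun x hx => ?_)
    simp only [RCLike.inner_apply]
    rw [hx, mul_comm]
    rfl

end Complex

end GaussianTent

namespace GaussianTent

/-! ### An `L²` maximal inequality for dyadic averages of the semigroup, by a `TT*` argument. -/

section Maximal

variable {n : ℕ}

/-- The average of `e^{-krL}` over `1 ≤ k ≤ 2 ^ j`, acting on functions with values in `[0, ∞]`. -/
noncomputable def posAvg (r : ℝ) (j : ℕ) (f : E n → ℝ≥0∞) (x : E n) : ℝ≥0∞ :=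
  ((2 : ℝ≥0∞) ^ j)⁻¹ * ∑ k ∈ Finset.Icc (1 : ℕ) (2 ^ j), posSemigroup (k * r) f x

theorem measurable_posAvg (r : ℝ) (j : ℕ) {f : E n → ℝ≥0∞} (hf : Measurable f) :
    Measurable (posAvg r j f) :=
  (Finset.measurable_fun_sum _ fun _ _ => measurable_posSemigroup _ hf).const_mul _

theorem posSemigroup_const_mul (s : ℝ) (c : ℝ≥0∞) {f : E n → ℝ≥0∞} (hf : Measurable f) (x : E n) :
    posSemigroup s (fun y => c * f y) x = c * posSemigroup s f x := by
  have mf : Measurable fun y => ENNReal.ofReal (mehler s x y) * f y :=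
    (measurable_mehler_right s x).ennreal_ofReal.mul hf
  unfold posSemigroup
  rw [← lintegral_const_mul _ mf]
  exact lintegral_congr fun y => by ring

theorem posSemigroup_finset_sum {ι : Type*} (s : ℝ) (I : Finset ι) {f : ι → E n → ℝ≥0∞}
    (hf : ∀ i, Measurable (f i)) (x : E n) :
    posSemigroup s (fun y => ∑ i ∈ I, f i y) x = ∑ i ∈ I, posSemigroup s (f i) x := by
  unfold posSemigroup
  rw [← lintegral_finsetSum _
    fun i _ => (measurable_mehler_right s x).ennreal_ofReal.fun_mul (hf i)]
  exact lintegral_congr fun y => by simp [Finset.mul_sum]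

theorem lintegral_posAvg_mul (r : ℝ) (j : ℕ) {f g : E n → ℝ≥0∞} (hf : Measurable f)
    (hg : Measurable g) :
    ∫⁻ x, posAvg r j f x * g x ∂(gauss n) = ∫⁻ x, f x * posAvg r j g x ∂(gauss n) := by
  have e1 : ∀ x, posAvg r j f x * g x
      = ∑ k ∈ Finset.Icc (1 : ℕ) (2 ^ j), ((2 : ℝ≥0∞) ^ j)⁻¹ * (posSemigroup (k * r) f x * g x) := by
    intro x; rw [posAvg, mul_assoc, Finset.sum_mul, Finset.mul_sum]
  have e2 : ∀ x, f x * posAvg r j g x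
      = ∑ k ∈ Finset.Icc (1 : ℕ) (2 ^ j), ((2 : ℝ≥0∞) ^ j)⁻¹ * (f x * posSemigroup (k * r) g x) := by
    intro x
    rw [posAvg, mul_left_comm, Finset.mul_sum, Finset.mul_sum]
  simp_rw [e1, e2]
  rw [lintegral_finsetSum _ fun k _ => ((measurable_posSemigroup _ hf).fun_mul hg).const_mul _,
    lintegral_finsetSum _ fun k _ => (hf.fun_mul (measurable_posSemigroup _ hg)).const_mul _]
  refine Finset.sum_congr rfl fun k _ => ?_
  rw [lintegral_const_mul _ ((measurable_posSemigroup _ hf).fun_mul hg),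
    lintegral_const_mul _ (hf.fun_mul (measurable_posSemigroup _ hg)),
    lintegral_posSemigroup_mul _ hf hg]

/-- For `k ≤ 2^i ≤ 2^j` and `l ≤ 2^j` the sum `k + l` is at most `2^(j+1)`. Thus each shift by `k`
of the average over `l` is dominated by the average twice as long, the factor two coming from the
normalisation. -/
theorem posAvg_posAvg_le {r : ℝ} (hr : 0 < r) {i j : ℕ} (hij : i ≤ j) {f : E n → ℝ≥0∞}
    (hf : Measurable f) (x : E n) :
    posAvg r i (posAvg r j f) x ≤ 2 * posAvg r (j + 1) f x := by
  have hp : (2 : ℝ≥0∞) ^ i ≠ 0 := by positivity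
  have key : ∀ k ∈ Finset.Icc (1 : ℕ) (2 ^ i),
      posSemigroup (k * r) (posAvg r j f) x ≤ 2 * posAvg r (j + 1) f x := by
    intro k hk
    rw [Finset.mem_Icc] at hk
    have hk0 : 0 < (k : ℝ) * r := by
      have : (1 : ℝ) ≤ k := by exact_mod_cast hk.1
      positivity
    have hki : k ≤ 2 ^ j := hk.2.trans (Nat.pow_le_pow_right (by norm_num) hij)
    have e1 : posAvg r j f = fun y => ((2 : ℝ≥0∞) ^ j)⁻¹ *
        ∑ l ∈ Finset.Icc (1 : ℕ) (2 ^ j), posSemigroup (l * r) f y := rfl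
    rw [e1, posSemigroup_const_mul _ _
      (Finset.measurable_fun_sum _ fun _ _ => measurable_posSemigroup _ hf),
      posSemigroup_finset_sum _ _ fun l => measurable_posSemigroup _ hf]
    have e2 : 2 * posAvg r (j + 1) f x = ((2 : ℝ≥0∞) ^ j)⁻¹ *
        ∑ m ∈ Finset.Icc (1 : ℕ) (2 ^ (j + 1)), posSemigroup (m * r) f x := by
      rw [posAvg, ← mul_assoc, pow_succ,
        ENNReal.mul_inv (Or.inr (by norm_num)) (Or.inr (by norm_num)),
        mul_comm _ (2 : ℝ≥0∞)⁻¹, ← mul_assoc,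
        ENNReal.mul_inv_cancel (by norm_num) (by norm_num), one_mul]
    rw [e2]
    refine mul_le_mul_right ?_ _
    have e3 : ∑ l ∈ Finset.Icc (1 : ℕ) (2 ^ j), posSemigroup (k * r) (posSemigroup (l * r) f) x
        = ∑ m ∈ (Finset.Icc (1 : ℕ) (2 ^ j)).map (addLeftEmbedding k), posSemigroup (m * r) f x := by
      rw [Finset.sum_map]
      refine Finset.sum_congr rfl fun l hl => ?_
      rw [Finset.mem_Icc] at hl
      have hl0 : 0 < (l : ℝ) * r := by
        have : (1 : ℝ) ≤ l := by exact_mod_cast hl.1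
        positivity
      rw [posSemigroup_add hk0 hl0 hf]
      congr 1
      simp only [addLeftEmbedding_apply]
      push_cast; ring
    rw [e3]
    refine Finset.sum_le_sum_of_subset fun m hm => ?_
    simp only [Finset.mem_map, addLeftEmbedding_apply, Finset.mem_Icc] at hm ⊢
    obtain ⟨l, hl, rfl⟩ := hm
    rw [pow_succ]
    omega
  calc posAvg r i (posAvg r j f) x
      ≤ ((2 : ℝ≥0∞) ^ i)⁻¹ * ∑ k ∈ Finset.Icc (1 : ℕ) (2 ^ i), 2 * posAvg r (j + 1) f x :=
        mul_le_mul_right (Finset.sum_le_sum key) _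
    _ = 2 * posAvg r (j + 1) f x := by
        rw [Finset.sum_const, Nat.card_Icc, Nat.add_sub_cancel, nsmul_eq_mul, ← mul_assoc]
        push_cast
        rw [ENNReal.inv_mul_cancel hp (by finiteness), one_mul]

theorem lintegral_posSemigroup_mul_self_le {s : ℝ} (hs : 0 < s) {f g : E n → ℝ≥0∞}
    (hf : Measurable f) (hgf : g ≤ f) :
    ∫⁻ x, posSemigroup s f x * g x ∂(gauss n) ≤ ∫⁻ x, f x ^ 2 ∂(gauss n) := by
  have h := lintegral_mul_sq_le (μ := gauss n) (measurable_posSemigroup s hf).aemeasurable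
    hf.aemeasurable
  have h2 := h.trans (mul_le_mul_left (lintegral_posSemigroup_sq_le hs hf) _)
  rw [← sq, ENNReal.pow_le_pow_left_iff two_ne_zero] at h2
  exact (lintegral_mono fun x => mul_le_mul_right (hgf x) _).trans h2

theorem lintegral_posAvg_mul_self_le {r : ℝ} (hr : 0 < r) (j : ℕ) {f g : E n → ℝ≥0∞}
    (hf : Measurable f) (hg : Measurable g) (hgf : g ≤ f) :
    ∫⁻ x, posAvg r j f x * g x ∂(gauss n) ≤ ∫⁻ x, f x ^ 2 ∂(gauss n) := by
  have hp : (2 : ℝ≥0∞) ^ j ≠ 0 := by positivity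
  have e1 : ∀ x, posAvg r j f x * g x
      = ((2 : ℝ≥0∞) ^ j)⁻¹ * ∑ k ∈ Finset.Icc (1 : ℕ) (2 ^ j), posSemigroup (k * r) f x * g x := by
    intro x; rw [posAvg, mul_assoc, Finset.sum_mul]
  simp_rw [e1]
  rw [lintegral_const_mul _ (Finset.measurable_fun_sum _ fun k _ =>
      (measurable_posSemigroup _ hf).fun_mul hg),
    lintegral_finsetSum _ fun k _ => (measurable_posSemigroup _ hf).fun_mul hg]
  calc _ ≤ ((2 : ℝ≥0∞) ^ j)⁻¹ * ∑ k ∈ Finset.Icc (1 : ℕ) (2 ^ j), ∫⁻ x, f x ^ 2 ∂(gauss n) := by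
        refine mul_le_mul_right (Finset.sum_le_sum fun k hk => ?_) _
        rw [Finset.mem_Icc] at hk
        have : (1 : ℝ) ≤ k := by exact_mod_cast hk.1
        exact lintegral_posSemigroup_mul_self_le (by positivity) hf hgf
    _ = _ := by
        rw [Finset.sum_const, Nat.card_Icc, Nat.add_sub_cancel, nsmul_eq_mul, ← mul_assoc]
        push_cast
        rw [ENNReal.inv_mul_cancel hp (by finiteness), one_mul]

/-- The almost-orthogonality step of the `TT*` method: the shorter average is moved to the other
side and absorbed into the longer one. Keeping both terms makes the bound symmetric in `i` and `j`.
-/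
theorem posAvg_posAvg_le_add {r : ℝ} (hr : 0 < r) (i j : ℕ) {f g : E n → ℝ≥0∞}
    (hf : Measurable f) (hg : Measurable g) :
    ∫⁻ x, posAvg r i f x * posAvg r j g x ∂(gauss n) ≤
      2 * ∫⁻ x, posAvg r (i + 1) f x * g x ∂(gauss n)
        + 2 * ∫⁻ x, posAvg r (j + 1) g x * f x ∂(gauss n) := by
  rcases le_total i j with h | h
  · refine le_trans ?_ le_add_self
    rw [lintegral_posAvg_mul _ _ hf (measurable_posAvg _ _ hg),
      ← lintegral_const_mul _ ((measurable_posAvg _ _ hg).fun_mul hf)]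
    refine lintegral_mono fun x => ?_
    refine (mul_le_mul_right (posAvg_posAvg_le hr h hg x) _).trans (le_of_eq (by ring))
  · refine le_trans ?_ le_self_add
    rw [← lintegral_posAvg_mul _ _ (measurable_posAvg _ _ hf) hg,
      ← lintegral_const_mul _ ((measurable_posAvg _ _ hf).fun_mul hg)]
    refine lintegral_mono fun x => ?_
    refine (mul_le_mul_left (posAvg_posAvg_le hr h hf x) _).trans (le_of_eq (by ring))

theorem sum_indicator_le {ι : Type*} {α : Type*} (I : Finset ι) {S : ι → Set α}
    (hS : Pairwise (Function.onFun Disjoint S)) (f : α → ℝ≥0∞) (x : α) :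
    ∑ i ∈ I, (S i).indicator f x ≤ f x := by
  classical
  by_cases h : ∃ i ∈ I, x ∈ S i
  · obtain ⟨i, hi, hx⟩ := h
    rw [Finset.sum_eq_single_of_mem i hi]
    · exact indicator_le_self _ _ _
    · intro k _ hk
      refine indicator_of_notMem (fun hxk => ?_) _
      exact Set.disjoint_left.1 (hS hk) hxk hx
  · push Not at h
    rw [Finset.sum_eq_zero fun i hi => indicator_of_notMem (h i hi) _]
    exact zero_le

/-- The square of the linearized maximal function is controlled by the shifted one. -/
theorem linearized_maximal_sq_le {r : ℝ} (hr : 0 < r) (J : ℕ) {S : ℕ → Set (E n)}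
    (hSm : ∀ j, MeasurableSet (S j)) (hS : Pairwise (Function.onFun Disjoint S))
    {f : E n → ℝ≥0∞} (hf : Measurable f) :
    (∑ j ∈ Finset.range (J + 1), ∫⁻ x, posAvg r j f x * (S j).indicator f x ∂(gauss n)) ^ 2 ≤
      (∫⁻ x, f x ^ 2 ∂(gauss n)) * (4 * ∑ j ∈ Finset.range (J + 1),
        ∫⁻ x, posAvg r (j + 1) f x * (S j).indicator f x ∂(gauss n)) := by
  have hm : ∀ j, Measurable ((S j).indicator f) := fun j => hf.indicator (hSm j)
  set g : E n → ℝ≥0∞ := fun x => ∑ j ∈ Finset.range (J + 1), posAvg r j ((S j).indicator f) x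
  have hg : Measurable g := Finset.measurable_fun_sum _ fun j _ => measurable_posAvg _ _ (hm j)
  have e1 : ∑ j ∈ Finset.range (J + 1), ∫⁻ x, posAvg r j f x * (S j).indicator f x ∂(gauss n)
      = ∫⁻ x, f x * g x ∂(gauss n) := by
    simp_rw [lintegral_posAvg_mul r _ hf (hm _)]
    rw [← lintegral_finsetSum _ fun j _ => hf.fun_mul (measurable_posAvg _ _ (hm j))]
    exact lintegral_congr fun x => by simp only [g, Finset.mul_sum]
  rw [e1]
  refine (lintegral_mul_sq_le hf.aemeasurable hg.aemeasurable).trans (mul_le_mul_right ?_ _)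
  have e2 : ∫⁻ x, g x ^ 2 ∂(gauss n) = ∑ i ∈ Finset.range (J + 1), ∑ j ∈ Finset.range (J + 1),
      ∫⁻ x, posAvg r i ((S i).indicator f) x * posAvg r j ((S j).indicator f) x ∂(gauss n) := by
    simp_rw [sq, g, Finset.sum_mul_sum]
    rw [lintegral_finsetSum _ fun i _ => Finset.measurable_fun_sum _ fun j _ =>
      (measurable_posAvg _ _ (hm i)).fun_mul (measurable_posAvg _ _ (hm j))]
    refine Finset.sum_congr rfl fun i _ => ?_
    rw [lintegral_finsetSum _ fun j _ =>
      (measurable_posAvg _ _ (hm i)).fun_mul (measurable_posAvg _ _ (hm j))]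
  -- Disjointness of the sets `S i` lets the sum of the truncated functions over `i` be replaced by
  -- `f`.
  have e3 : ∀ j, ∑ i ∈ Finset.range (J + 1),
      ∫⁻ x, posAvg r (j + 1) ((S j).indicator f) x * (S i).indicator f x ∂(gauss n)
      ≤ ∫⁻ x, posAvg r (j + 1) f x * (S j).indicator f x ∂(gauss n) := by
    intro j
    rw [← lintegral_finsetSum _ fun i _ => (measurable_posAvg _ _ (hm j)).fun_mul (hm i)]
    rw [lintegral_posAvg_mul _ _ hf (hm j)]
    refine lintegral_mono fun x => ?_
    simp only
    rw [← Finset.mul_sum, mul_comm (f x)]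
    exact mul_le_mul_right (sum_indicator_le _ hS f x) _
  rw [e2]
  calc _ ≤ ∑ i ∈ Finset.range (J + 1), ∑ j ∈ Finset.range (J + 1),
        (2 * ∫⁻ x, posAvg r (i + 1) ((S i).indicator f) x * (S j).indicator f x ∂(gauss n)
        + 2 * ∫⁻ x, posAvg r (j + 1) ((S j).indicator f) x * (S i).indicator f x ∂(gauss n)) :=
        Finset.sum_le_sum fun i _ => Finset.sum_le_sum fun j _ =>
          posAvg_posAvg_le_add hr i j (hm i) (hm j)
    _ = 4 * ∑ j ∈ Finset.range (J + 1), ∑ i ∈ Finset.range (J + 1),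
        ∫⁻ x, posAvg r (j + 1) ((S j).indicator f) x * (S i).indicator f x ∂(gauss n) := by
        simp_rw [Finset.sum_add_distrib]
        rw [Finset.sum_comm (f := fun i j => 2 * ∫⁻ x, posAvg r (j + 1) ((S j).indicator f) x *
          (S i).indicator f x ∂(gauss n))]
        simp_rw [← Finset.mul_sum]
        rw [← add_mul]
        norm_num
    _ ≤ _ := mul_le_mul_right (Finset.sum_le_sum fun j _ => e3 j) _

/-- The `L²` maximal inequality for the dyadic averages of the semigroup, in linearized form. -/
theorem linearized_maximal_le {r : ℝ} (hr : 0 < r) (J : ℕ) {f : E n → ℝ≥0∞} (hf : Measurable f)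
    (hf2 : ∫⁻ x, f x ^ 2 ∂(gauss n) < ∞) {S : ℕ → Set (E n)}
    (hSm : ∀ j, MeasurableSet (S j)) (hS : Pairwise (Function.onFun Disjoint S)) :
    ∑ j ∈ Finset.range (J + 1), ∫⁻ x, posAvg r j f x * (S j).indicator f x ∂(gauss n) ≤
      5 * ∫⁻ x, f x ^ 2 ∂(gauss n) := by
  set N := ∫⁻ x, f x ^ 2 ∂(gauss n) with hN
  set X : (ℕ → Set (E n)) → ℝ≥0∞ := fun S =>
    ∑ j ∈ Finset.range (J + 1), ∫⁻ x, posAvg r j f x * (S j).indicator f x ∂(gauss n) with hX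
  set P : Set (ℕ → Set (E n)) :=
    {S | (∀ j, MeasurableSet (S j)) ∧ Pairwise (Function.onFun Disjoint S)} with hP
  -- The supremum over all disjoint families is taken because the quadratic estimate returns a
  -- shifted family; finiteness of `Y` is needed to solve the resulting inequality, and holds since
  -- there are only `J + 1` terms.
  set Y : ℝ≥0∞ := ⨆ S ∈ P, X S with hY
  have bound : ∀ j, ∀ S : Set (E n), MeasurableSet S →
      ∫⁻ x, posAvg r j f x * S.indicator f x ∂(gauss n) ≤ N := fun j S hS =>
    lintegral_posAvg_mul_self_le hr j hf (hf.indicator hS) (indicator_le_self _ _)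
  have hYtop : Y < ∞ := by
    refine lt_of_le_of_lt (b := ∑ j ∈ Finset.range (J + 1), N) ?_ ?_
    · exact iSup₂_le fun S hS => Finset.sum_le_sum fun j _ => bound j _ (hS.1 j)
    · exact ENNReal.sum_lt_top.2 fun _ _ => hf2
  have step : ∀ S ∈ P, X S ^ 2 ≤ N * (4 * (Y + N)) := by
    intro S hS
    refine (linearized_maximal_sq_le hr J hS.1 hS.2 hf).trans ?_
    refine mul_le_mul_right (mul_le_mul_right ?_ _) _
    rw [Finset.sum_range_succ]
    refine add_le_add ?_ (bound _ _ (hS.1 J))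
    -- Prepending the empty set pairs the average `j + 1` with the set `S j`, so the shifted sum is
    -- again a value of `X`. The term with average `J + 1` falls outside the range and was bounded
    -- by `N` separately.
    have hS' : (fun j => Nat.casesOn (motive := fun _ => Set (E n)) j ∅ S) ∈ P := by
      refine ⟨fun j => ?_, fun i j hij => ?_⟩
      · cases j with
        | zero => exact MeasurableSet.empty
        | succ j => exact hS.1 j
      · cases i with
        | zero => simp [Function.onFun]
        | succ i =>
          cases j with
          | zero => simp [Function.onFun]
          | succ j => exact hS.2 (by omega)
    refine le_trans (le_of_eq ?_) (le_iSup₂ (f := fun S (_ : S ∈ P) => X S) _ hS')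
    rw [hX]
    simp only
    rw [Finset.sum_range_succ']
    simp
  have hsq : Y ^ 2 ≤ N * (4 * (Y + N)) := by
    have h1 : Y ≤ (N * (4 * (Y + N))) ^ (1 / 2 : ℝ) := by
      refine iSup₂_le fun S hS => ?_
      rw [← ENNReal.rpow_le_rpow_iff (z := 2) (by norm_num), ← ENNReal.rpow_mul]
      norm_num
      exact step S hS
    rw [← ENNReal.rpow_le_rpow_iff (z := 2) (by norm_num), ← ENNReal.rpow_mul] at h1
    norm_num at h1
    exact h1
  -- `Y² ≤ 4N(Y + N)` gives `Y ≤ (2 + 2√2) N`, which is below `5N`.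
  have hYN : Y ≤ 5 * N := by
    have hN' : N = ENNReal.ofReal N.toReal := (ENNReal.ofReal_toReal hf2.ne).symm
    have hY' : Y = ENNReal.ofReal Y.toReal := (ENNReal.ofReal_toReal hYtop.ne).symm
    have h2 := ENNReal.toReal_mono (by finiteness [hf2.ne, hYtop.ne]) hsq
    rw [ENNReal.toReal_pow, ENNReal.toReal_mul, ENNReal.toReal_mul,
      ENNReal.toReal_add hYtop.ne hf2.ne] at h2
    norm_num at h2
    rw [← ENNReal.toReal_le_toReal hYtop.ne (by finiteness [hf2.ne]), ENNReal.toReal_mul]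
    norm_num
    have hn : 0 ≤ N.toReal := ENNReal.toReal_nonneg
    nlinarith
  exact (le_iSup₂ (f := fun S (_ : S ∈ P) => X S) S ⟨hSm, hS⟩).trans hYN

end Maximal

end GaussianTent

namespace GaussianTent

/-! ### Finite-difference inequalities for decreasing convex sequences. -/

section Sequences

theorem mul_sub_le_of_antitoneOn {c : ℕ → ℝ}
    (hd : ∀ k l, 1 ≤ k → k ≤ l → c l - c (l + 1) ≤ c k - c (k + 1)) (a N : ℕ) (ha : 1 ≤ a) :
    N * (c (a + N) - c (a + N + 1)) ≤ c a - c (a + N) := by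
  have h : ∀ M ≤ N, (M : ℝ) * (c (a + N) - c (a + N + 1)) ≤ c a - c (a + M) := by
    intro M
    induction M with
    | zero => intro _; simp
    | succ M ih =>
      intro hM
      have h1 := ih (by omega)
      have h2 := hd (a + M) (a + N) (by omega) (by omega)
      rw [show a + (M + 1) = a + M + 1 by ring]
      push_cast
      linarith
  exact h N le_rfl

theorem sub_shift_antitone {c : ℕ → ℝ}
    (hd : ∀ k l, 1 ≤ k → k ≤ l → c l - c (l + 1) ≤ c k - c (k + 1)) (M : ℕ) {k l : ℕ}
    (hk : 1 ≤ k) (hkl : k ≤ l) : c l - c (l + M) ≤ c k - c (k + M) := by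
  induction M with
  | zero => simp
  | succ M ih =>
    have := hd (k + M) (l + M) (by omega) (by omega)
    rw [← add_assoc, ← add_assoc]
    linarith

/-- Discrete form of `s² c''(s) ≲ c(s/2) - c(s)` for completely monotone `c`. Monotonicity of the
second differences bounds `N` of them by a first difference at `3N`, and monotonicity of first
differences bounds `N` of those by a decrement of `c`. -/
theorem sq_mul_second_diff_le {c : ℕ → ℝ} (h0 : ∀ k, 1 ≤ k → c (k + 1) ≤ c k)
    (hd : ∀ k l, 1 ≤ k → k ≤ l → c l - c (l + 1) ≤ c k - c (k + 1))
    (he : ∀ k l, 1 ≤ k → k ≤ l →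
      c l - 2 * c (l + 1) + c (l + 2) ≤ c k - 2 * c (k + 1) + c (k + 2)) (N : ℕ) (hN : 1 ≤ N) :
    (N : ℝ) ^ 2 * (c (4 * N) - 2 * c (4 * N + 1) + c (4 * N + 2)) ≤ c (2 * N) - c (4 * N) := by
  have h1 := mul_sub_le_of_antitoneOn hd (2 * N) N (by omega)
  have h2 := mul_sub_le_of_antitoneOn (c := fun k => c k - c (k + 1)) (fun k l hk hkl => by
    have := he k l hk hkl
    simp only [add_assoc, Nat.reduceAdd]; linarith) (3 * N) N (by omega)
  have e1 : 2 * N + N = 3 * N := by ring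
  have e2 : 3 * N + N = 4 * N := by ring
  rw [e1] at h1
  simp only [e2, add_assoc, Nat.reduceAdd] at h2
  have h3 := h0 (4 * N) (by omega)
  have h4 : ∀ M, c (3 * N + M) ≤ c (3 * N) := by
    intro M
    induction M with
    | zero => simp
    | succ M ih => exact (h0 (3 * N + M) (by omega)).trans ih
  have h5 := h4 N
  rw [e2] at h5
  have hNp : (0 : ℝ) ≤ N := by positivity
  have h6 : (N : ℝ) * (N * (c (4 * N) - 2 * c (4 * N + 1) + c (4 * N + 2)))
      ≤ N * (c (3 * N) - c (3 * N + 1)) := by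
    refine mul_le_mul_of_nonneg_left ?_ hNp
    linarith
  rw [sq, mul_assoc]
  linarith

end Sequences

/-! ### The form `⟨e^{-sL} f, f⟩`: analyticity estimates and the telescoping bound for changing
truncations. -/

section Form

variable {n : ℕ}

/-- The quadratic form `⟨e^{-sL} f, f⟩`. -/
noncomputable def heatForm (f : L2 n) (s : ℝ) : ℝ := (inner ℂ (heatOp n s f) f).re

theorem re_inner_heatOp_heatOp {s t : ℝ} (hs : 0 < s) (ht : 0 < t) (f : L2 n) :
    (inner ℂ (heatOp n s f) (heatOp n t f)).re = heatForm f (s + t) := by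
  rw [← inner_heatOp_left ht, heatOp_heatOp ht hs, add_comm, heatForm]

theorem norm_heatOp_sq {s : ℝ} (hs : 0 < s) (f : L2 n) :
    ‖heatOp n s f‖ ^ 2 = heatForm f (s + s) := by
  rw [← re_inner_heatOp_heatOp hs hs, ← inner_self_eq_norm_sq (𝕜 := ℂ)]
  rfl

theorem norm_heatOp_sub_sq {s t : ℝ} (hs : 0 < s) (ht : 0 < t) (f : L2 n) :
    ‖heatOp n s f - heatOp n t f‖ ^ 2
      = heatForm f (s + s) - 2 * heatForm f (s + t) + heatForm f (t + t) := by
  rw [@norm_sub_sq ℂ, norm_heatOp_sq hs, norm_heatOp_sq ht, ← re_inner_heatOp_heatOp hs ht]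
  rfl

theorem heatForm_nonneg {s : ℝ} (hs : 0 < s) (f : L2 n) : 0 ≤ heatForm f s := by
  rw [← add_halves s, ← norm_heatOp_sq (by positivity)]; positivity

theorem heatForm_le {s : ℝ} (hs : 0 < s) (f : L2 n) : heatForm f s ≤ ‖f‖ ^ 2 := by
  rw [← add_halves s, ← norm_heatOp_sq (by positivity)]
  exact pow_le_pow_left₀ (norm_nonneg _) (norm_heatOp_le (by positivity) f) 2

theorem heatForm_add_le {s t : ℝ} (hs : 0 < s) (ht : 0 < t) (f : L2 n) :
    heatForm f (s + t) ≤ heatForm f s := by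
  have h2 := norm_heatOp_sq (half_pos hs) f
  have h3 := norm_heatOp_sq (half_pos (add_pos hs ht)) f
  rw [add_halves] at h2 h3
  rw [← h2, ← h3, show (s + t) / 2 = t / 2 + s / 2 by ring,
    ← heatOp_heatOp (half_pos ht) (half_pos hs)]
  exact pow_le_pow_left₀ (norm_nonneg _) (norm_heatOp_le (half_pos ht) _) 2

theorem norm_heatOp_sub_antitone {s t h : ℝ} (hs : 0 < s) (hst : s ≤ t) (hh : 0 < h) (f : L2 n) :
    ‖heatOp n t f - heatOp n (t + h) f‖ ≤ ‖heatOp n s f - heatOp n (s + h) f‖ := by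
  rcases hst.eq_or_lt with rfl | hlt
  · exact le_rfl
  have hp : 0 < t - s := by linarith
  have e1 : heatOp n t f = heatOp n (t - s) (heatOp n s f) := by
    rw [heatOp_heatOp hp hs]; congr 2; ring
  have e2 : heatOp n (t + h) f = heatOp n (t - s) (heatOp n (s + h) f) := by
    rw [heatOp_heatOp hp (by linarith)]; congr 2; ring
  rw [e1, e2, ← map_sub]
  exact norm_heatOp_le hp _

/-- Second differences of the form are squared norms: nonnegative, which is convexity, and
decreasing in `s` by contractivity. These are the hypotheses of `sq_mul_second_diff_le`. -/
theorem heatForm_second_diff {s h : ℝ} (hs : 0 < s) (hh : 0 < h) (f : L2 n) :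
    heatForm f s - 2 * heatForm f (s + h) + heatForm f (s + h + h)
      = ‖heatOp n (s / 2) f - heatOp n (s / 2 + h) f‖ ^ 2 := by
  rw [norm_heatOp_sub_sq (by positivity) (by positivity)]
  ring_nf

theorem heatForm_grid_second_diff {r : ℝ} (hr : 0 < r) (f : L2 n) {k : ℕ} (hk : 1 ≤ k) :
    heatForm f (k * r) - 2 * heatForm f ((k + 1 : ℕ) * r) + heatForm f ((k + 2 : ℕ) * r)
      = ‖heatOp n (k * r / 2) f - heatOp n (k * r / 2 + r) f‖ ^ 2 := by
  have hk' : (1 : ℝ) ≤ k := by exact_mod_cast hk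
  rw [← heatForm_second_diff (by positivity) hr]
  push_cast
  ring_nf

theorem heatForm_grid_diff_antitone {r : ℝ} (hr : 0 < r) (f : L2 n) (k l : ℕ) (hk : 1 ≤ k)
    (hkl : k ≤ l) :
    heatForm f (l * r) - heatForm f ((l + 1 : ℕ) * r)
      ≤ heatForm f (k * r) - heatForm f ((k + 1 : ℕ) * r) := by
  induction l, hkl using Nat.le_induction with
  | base => exact le_rfl
  | succ l hkl ih =>
    refine le_trans ?_ ih
    have h := heatForm_grid_second_diff hr f (hk.trans hkl)
    have h2 := sq_nonneg ‖heatOp n (l * r / 2) f - heatOp n (l * r / 2 + r) f‖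
    rw [← h] at h2
    rw [add_assoc]
    norm_num at h2 ⊢
    linarith

/-- Analyticity of the semigroup in terms of difference quotients. -/
theorem sq_mul_norm_heatOp_sub_le {r s : ℝ} (hr : 0 < r) (hrs : r ≤ s) (f : L2 n) {N : ℕ}
    (hN : 1 ≤ N) :
    (N : ℝ) ^ 2 * ‖heatOp n s f - heatOp n (s + r / (2 * N)) f‖ ^ 2
      ≤ heatForm f r - heatForm f (2 * r) := by
  have hN' : (1 : ℝ) ≤ N := by exact_mod_cast hN
  -- With this step the grid points `2N` and `4N` are `r` and `2r`, and the second difference at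
  -- `4N` is the squared norm of a difference at time `2r/2 = r`.
  set h := r / (2 * N) with hh
  have hp : 0 < h := by positivity
  have e1 : r = ((2 * N : ℕ) : ℝ) * h := by rw [hh]; push_cast; field_simp
  have e2 : 2 * r = ((4 * N : ℕ) : ℝ) * h := by rw [hh]; push_cast; field_simp; norm_num
  have e3 : ((4 * N : ℕ) : ℝ) * h / 2 = r := by rw [← e2]; ring
  have key := sq_mul_second_diff_le (c := fun k => heatForm f (k * h)) (N := N)
    (fun k hk => by
      have hk' : (1 : ℝ) ≤ k := by exact_mod_cast hk
      have := heatForm_add_le (s := k * h) (by positivity) hp f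
      push_cast
      rwa [add_mul, one_mul])
    (heatForm_grid_diff_antitone hp f)
    (fun k l hk hkl => by
      have hk' : (1 : ℝ) ≤ k := by exact_mod_cast hk
      have hkl' : (k : ℝ) ≤ l := by exact_mod_cast hkl
      rw [heatForm_grid_second_diff hp f hk, heatForm_grid_second_diff hp f (hk.trans hkl)]
      refine pow_le_pow_left₀ (norm_nonneg _) (norm_heatOp_sub_antitone (by positivity) ?_ hp f) 2
      gcongr) hN
  rw [heatForm_grid_second_diff hp f (by omega : 1 ≤ 4 * N), e3, ← e1, ← e2] at key
  refine le_trans ?_ key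
  gcongr
  exact norm_heatOp_sub_antitone hr hrs hp f

/-- By convexity the decrement from `2^j r` to `2^(j+1) r` is at most the one from `kr` to `(k +
2^j)r` for each `k ≤ 2^j`. Averaging over `k` gives the mean of the first half of the grid minus
that of the second half, that is, twice the difference of consecutive dyadic averages. Decrements of
averages telescope, and they tolerate a change of `f`. -/
theorem heatForm_sub_le_avg {r : ℝ} (hr : 0 < r) (f : L2 n) (j : ℕ) :
    heatForm f (2 ^ j * r) - heatForm f (2 ^ (j + 1) * r) ≤
      2 * (((2 : ℝ) ^ j)⁻¹ * ∑ k ∈ Finset.Icc (1 : ℕ) (2 ^ j), heatForm f (k * r)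
        - ((2 : ℝ) ^ (j + 1))⁻¹ * ∑ k ∈ Finset.Icc (1 : ℕ) (2 ^ (j + 1)), heatForm f (k * r)) := by
  have h1 : ∀ k ∈ Finset.Icc (1 : ℕ) (2 ^ j),
      heatForm f (2 ^ j * r) - heatForm f (2 ^ (j + 1) * r) ≤
      heatForm f (k * r) - heatForm f ((k + 2 ^ j : ℕ) * r) := by
    intro k hk
    rw [Finset.mem_Icc] at hk
    have := sub_shift_antitone (c := fun k => heatForm f (k * r))
      (heatForm_grid_diff_antitone hr f) (2 ^ j) hk.1 hk.2
    refine le_trans (le_of_eq ?_) this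
    push_cast
    rw [pow_succ]
    ring_nf
  have h2 := Finset.sum_le_sum h1
  rw [Finset.sum_const, Nat.card_Icc, Nat.add_sub_cancel, nsmul_eq_mul,
    Finset.sum_sub_distrib] at h2
  have h3 : ∑ k ∈ Finset.Icc (1 : ℕ) (2 ^ (j + 1)), heatForm f (k * r)
      = ∑ k ∈ Finset.Icc (1 : ℕ) (2 ^ j), heatForm f (k * r)
        + ∑ k ∈ Finset.Icc (1 : ℕ) (2 ^ j), heatForm f ((k + 2 ^ j : ℕ) * r) := by
    have hI : ∀ m : ℕ, Finset.Icc 1 m = Finset.Ico 1 (m + 1) := fun m => by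
      ext x; simp
    have hp2 : 1 ≤ 2 ^ j := Nat.one_le_two_pow
    rw [hI, hI, ← Finset.sum_Ico_consecutive _ (show 1 ≤ 2 ^ j + 1 by omega)
      (show 2 ^ j + 1 ≤ 2 ^ (j + 1) + 1 by rw [pow_succ]; omega)]
    congr 1
    rw [Finset.sum_Ico_add' (fun k : ℕ => heatForm f (k * r))]
    congr 2
    · ring
    · rw [pow_succ]; ring
  rw [h3, pow_succ]
  have hp : (0 : ℝ) < 2 ^ j := by positivity
  push_cast at h2 ⊢
  rw [mul_inv]
  have h4 := mul_le_mul_of_nonneg_left h2 (inv_nonneg.2 hp.le)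
  rw [← mul_assoc, inv_mul_cancel₀ hp.ne', one_mul] at h4
  rw [mul_sub] at h4
  ring_nf at h4 ⊢
  linarith

/-- When the step is halved, difference quotients change by a second difference over `2h`. This
second difference is the square of the operator `e^{-(s/2)L} - e^{-(s/2+h)L}`, whose norm is `O(h)`,
so the increments are `O(h)` and summable. -/
theorem cauchySeq_diff_quotient {r s : ℝ} (hr : 0 < r) (hrs : r ≤ s) (f : L2 n) :
    CauchySeq fun k : ℕ => (r / 2 ^ (k + 2))⁻¹ •
      (heatOp n s f - heatOp n (s + r / 2 ^ (k + 2)) f) := by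
  have hs : 0 < s := hr.trans_le hrs
  have bd : ∀ (k : ℕ) (g : L2 n), ‖heatOp n (s / 2) g - heatOp n (s / 2 + r / 2 ^ (k + 3)) g‖
      ≤ (2 ^ (k + 1))⁻¹ * ‖g‖ := by
    intro k g
    have h := sq_mul_norm_heatOp_sub_le (half_pos hr) (by linarith : r / 2 ≤ s / 2) g
      (N := 2 ^ (k + 1)) Nat.one_le_two_pow
    have e : r / 2 / (2 * ((2 ^ (k + 1) : ℕ) : ℝ)) = r / 2 ^ (k + 3) := by
      push_cast; field_simp; ring
    rw [e] at h
    have h2 := heatForm_nonneg (by positivity : 0 < 2 * (r / 2)) g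
    have h3 := heatForm_le (by positivity : 0 < r / 2) g
    have h4 : (((2 ^ (k + 1) : ℕ) : ℝ) *
        ‖heatOp n (s / 2) g - heatOp n (s / 2 + r / 2 ^ (k + 3)) g‖) ^ 2 ≤ ‖g‖ ^ 2 := by
      rw [mul_pow]; linarith
    have h5 := (pow_le_pow_iff_left₀ (by positivity) (norm_nonneg g) two_ne_zero).1 h4
    rw [inv_mul_eq_div, le_div_iff₀ (by positivity), mul_comm]
    simpa using h5
  refine cauchySeq_of_le_geometric (1 / 2) (r⁻¹ * ‖f‖) (by norm_num) fun k => ?_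
  rw [dist_eq_norm]
  set h := r / 2 ^ (k + 3) with hh
  have hp : 0 < h := by positivity
  have e1 : r / 2 ^ (k + 2) = 2 * h := by rw [hh]; field_simp; ring
  rw [e1]
  have hD : ∀ g : L2 n, ∀ t, 0 < t → heatOp n (s / 2) (heatOp n t g) = heatOp n (s / 2 + t) g :=
    fun g t ht => heatOp_heatOp (half_pos hs) ht g
  have hD' : ∀ g : L2 n, ∀ t, 0 < t →
      heatOp n (s / 2 + h) (heatOp n t g) = heatOp n (s / 2 + h + t) g :=
    fun g t ht => heatOp_heatOp (add_pos (half_pos hs) hp) ht g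
  have b1 := bd k (heatOp n (s / 2) f - heatOp n (s / 2 + h) f)
  have b2 := b1.trans (mul_le_mul_of_nonneg_left (bd k f) (by positivity))
  rw [map_sub, map_sub, hD _ _ (half_pos hs), hD _ _ (by positivity), hD' _ _ (half_pos hs),
    hD' _ _ (by positivity), show s / 2 + s / 2 = s by ring,
    show s / 2 + (s / 2 + h) = s + h by ring, show s / 2 + h + s / 2 = s + h by ring,
    show s / 2 + h + (s / 2 + h) = s + 2 * h by ring] at b2
  have e3 : (2 * h)⁻¹ • (heatOp n s f - heatOp n (s + 2 * h) f)
      - h⁻¹ • (heatOp n s f - heatOp n (s + h) f)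
      = -(2 * h)⁻¹ • (heatOp n s f - heatOp n (s + h) f
        - (heatOp n (s + h) f - heatOp n (s + 2 * h) f)) := by
    have e4 : h⁻¹ = 2 * (2 * h)⁻¹ := by field_simp
    rw [e4]
    module
  rw [e3, norm_smul, norm_neg, Real.norm_of_nonneg (by positivity)]
  refine (mul_le_mul_of_nonneg_left b2 (by positivity)).trans (le_of_eq ?_)
  rw [hh, one_div, inv_pow]
  field_simp
  ring

/-- The limit `w` is `L e^{-sL} f`; the identification with the differential operator is made in
`coeFn_eq_ouL_of_tendsto`. -/
theorem exists_tendsto_diff_quotient {r s : ℝ} (hr : 0 < r) (hrs : r ≤ s) (f : L2 n) :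
    ∃ w : L2 n, Tendsto (fun k : ℕ => (r / 2 ^ (k + 2))⁻¹ •
      (heatOp n s f - heatOp n (s + r / 2 ^ (k + 2)) f)) atTop (𝓝 w) ∧
      ‖w‖ ^ 2 ≤ 4 / r ^ 2 * (heatForm f r - heatForm f (2 * r)) := by
  obtain ⟨w, hw⟩ := cauchySeq_tendsto_of_complete (cauchySeq_diff_quotient hr hrs f)
  refine ⟨w, hw, le_of_tendsto (hw.norm.pow 2) (Eventually.of_forall fun k => ?_)⟩
  have h := sq_mul_norm_heatOp_sub_le hr hrs f (N := 2 ^ (k + 1)) Nat.one_le_two_pow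
  have e : r / (2 * ((2 ^ (k + 1) : ℕ) : ℝ)) = r / 2 ^ (k + 2) := by
    push_cast; field_simp; ring
  rw [e] at h
  have h2 := mul_le_mul_of_nonneg_left h (by positivity : 0 ≤ 4 / r ^ 2)
  refine le_trans (le_of_eq ?_) h2
  rw [norm_smul, Real.norm_of_nonneg (by positivity)]
  push_cast
  field_simp
  ring

theorem enorm_inner_heatOp_le {s : ℝ} (hs : 0 < s) {u v : L2 n} {F G : E n → ℝ≥0∞}
    (hu : ∀ᵐ x ∂(gauss n), ‖u x‖ₑ ≤ F x) (hv : ∀ᵐ x ∂(gauss n), ‖v x‖ₑ ≤ G x) :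
    ‖inner ℂ (heatOp n s u) v‖ₑ ≤ ∫⁻ x, posSemigroup s F x * G x ∂(gauss n) := by
  rw [L2.inner_def]
  refine (enorm_integral_le_lintegral_enorm _).trans (lintegral_mono_ae ?_)
  filter_upwards [coeFn_heatOp hs u, hv] with x hx hvx
  rw [RCLike.inner_apply, enorm_mul, RCLike.enorm_conj, hx, mul_comm]
  refine mul_le_mul' ((enorm_ouSemigroup_le hs u x).trans ?_) hvx
  refine lintegral_mono_ae (hu.mono fun y hy => ?_)
  exact mul_le_mul_right hy _

theorem heatForm_sub_vector {s : ℝ} (hs : 0 < s) (u d : L2 n) :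
    heatForm (u - d) s - heatForm u s
      = -2 * (inner ℂ (heatOp n s u) d).re + (inner ℂ (heatOp n s d) d).re := by
  have h : (inner ℂ (heatOp n s d) u).re = (inner ℂ (heatOp n s u) d).re := by
    rw [inner_heatOp_left hs, ← inner_conj_symm]; rfl
  simp only [heatForm, map_sub, inner_sub_left, inner_sub_right, Complex.sub_re]
  rw [h]
  ring

/-- Expanding the form leaves two cross terms and one term quadratic in `d`. Positivity of the
kernel and `G ≤ F` bound each of the three by the same integral. This is the price of replacing one
truncation by a smaller one. -/
theorem heatForm_sub_vector_le {s : ℝ} (hs : 0 < s) {u d : L2 n} {F G : E n → ℝ≥0∞}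
    (hF : Measurable F) (hGF : G ≤ F)
    (hF2 : ∫⁻ x, F x ^ 2 ∂(gauss n) < ∞)
    (hu : ∀ᵐ x ∂(gauss n), ‖u x‖ₑ ≤ F x) (hd : ∀ᵐ x ∂(gauss n), ‖d x‖ₑ ≤ G x) :
    heatForm (u - d) s - heatForm u s
      ≤ 3 * (∫⁻ x, posSemigroup s F x * G x ∂(gauss n)).toReal := by
  have hfin : ∫⁻ x, posSemigroup s F x * G x ∂(gauss n) < ∞ :=
    (lintegral_posSemigroup_mul_self_le hs hF hGF).trans_lt hF2
  have h1 := ENNReal.toReal_mono hfin.ne (enorm_inner_heatOp_le hs hu hd)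
  have h2 := ENNReal.toReal_mono hfin.ne
    (enorm_inner_heatOp_le hs (hd.mono fun x hx => hx.trans (hGF x)) hd)
  rw [toReal_enorm] at h1 h2
  have h3 := (Complex.abs_re_le_norm _).trans h1
  have h4 := (Complex.abs_re_le_norm _).trans h2
  rw [heatForm_sub_vector hs]
  have h5 := neg_abs_le (inner ℂ (heatOp n s u) d).re
  have h6 := le_abs_self (inner ℂ (heatOp n s d) d).re
  linarith

theorem norm_toLp_sq {g : E n → ℂ} (hg : MemLp g 2 (gauss n)) :
    ‖hg.toLp g‖ ^ 2 = (∫⁻ x, ‖g x‖ₑ ^ 2 ∂(gauss n)).toReal := by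
  rw [Lp.norm_toLp, ← eLpNorm_two_sq, ENNReal.toReal_pow]

theorem toReal_lintegral_posAvg_mul {r : ℝ} (hr : 0 < r) (j : ℕ) {F G : E n → ℝ≥0∞}
    (hF : Measurable F) (hG : Measurable G) (hGF : G ≤ F)
    (hF2 : ∫⁻ x, F x ^ 2 ∂(gauss n) < ∞) :
    (∫⁻ x, posAvg r j F x * G x ∂(gauss n)).toReal
      = ((2 : ℝ) ^ j)⁻¹ * ∑ k ∈ Finset.Icc (1 : ℕ) (2 ^ j),
        (∫⁻ x, posSemigroup (k * r) F x * G x ∂(gauss n)).toReal := by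
  have hk : ∀ k ∈ Finset.Icc (1 : ℕ) (2 ^ j),
      ∫⁻ x, posSemigroup (k * r) F x * G x ∂(gauss n) ≠ ∞ := by
    intro k hk
    rw [Finset.mem_Icc] at hk
    have : (1 : ℝ) ≤ k := by exact_mod_cast hk.1
    exact ((lintegral_posSemigroup_mul_self_le (by positivity) hF hGF).trans_lt hF2).ne
  have mk : ∀ k : ℕ, Measurable fun x => posSemigroup (k * r) F x * G x :=
    fun k => (measurable_posSemigroup _ hF).mul hG
  have e3 : ∀ x, posAvg r j F x * G x = ((2 : ℝ≥0∞) ^ j)⁻¹ *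
      ∑ k ∈ Finset.Icc (1 : ℕ) (2 ^ j), posSemigroup (k * r) F x * G x := by
    intro x; rw [posAvg, mul_assoc, Finset.sum_mul]
  simp_rw [e3]
  rw [lintegral_const_mul _ (Finset.measurable_fun_sum _ fun k _ => mk k),
    lintegral_finsetSum _ fun k _ => mk k, ENNReal.toReal_mul, ENNReal.toReal_sum hk]
  simp

/-- The average of the forms `⟨e^{-krL} f, f⟩` over `1 ≤ k ≤ 2 ^ j`. -/
noncomputable def avgForm (r : ℝ) (j : ℕ) (f : L2 n) : ℝ :=
  ((2 : ℝ) ^ j)⁻¹ * ∑ k ∈ Finset.Icc (1 : ℕ) (2 ^ j), heatForm f (k * r)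

theorem avgForm_nonneg {r : ℝ} (hr : 0 < r) (j : ℕ) (f : L2 n) : 0 ≤ avgForm r j f := by
  refine mul_nonneg (by positivity) (Finset.sum_nonneg fun k hk => ?_)
  rw [Finset.mem_Icc] at hk
  have hk1 : (1 : ℝ) ≤ k := by exact_mod_cast hk.1
  exact heatForm_nonneg (by positivity) _

theorem avgForm_sub_vector_le {r : ℝ} (hr : 0 < r) (j : ℕ) {u d : L2 n} {F G : E n → ℝ≥0∞}
    (hF : Measurable F) (hG : Measurable G) (hGF : G ≤ F)
    (hF2 : ∫⁻ x, F x ^ 2 ∂(gauss n) < ∞)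
    (hu : ∀ᵐ x ∂(gauss n), ‖u x‖ₑ ≤ F x) (hd : ∀ᵐ x ∂(gauss n), ‖d x‖ₑ ≤ G x) :
    avgForm r j (u - d) - avgForm r j u
      ≤ 3 * (∫⁻ x, posAvg r j F x * G x ∂(gauss n)).toReal := by
  rw [toReal_lintegral_posAvg_mul hr j hF hG hGF hF2, avgForm, avgForm, ← mul_sub,
    ← Finset.sum_sub_distrib, mul_left_comm, Finset.mul_sum _ _ (3 : ℝ)]
  have hc : (0 : ℝ) ≤ (2 ^ j)⁻¹ := by positivity
  refine mul_le_mul_of_nonneg_left (Finset.sum_le_sum fun k hk => ?_) hc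
  rw [Finset.mem_Icc] at hk
  have hk1 : (1 : ℝ) ≤ k := by exact_mod_cast hk.1
  exact heatForm_sub_vector_le (by positivity) hF hGF hF2 hu hd

/-- The element of `L²(γ)` given by the restriction of a function to a set. -/
noncomputable def restrictLp {g : E n → ℂ} (hg : MemLp g 2 (gauss n)) {S : Set (E n)}
    (hS : MeasurableSet S) : L2 n := (hg.indicator hS).toLp (S.indicator g)

theorem coeFn_restrictLp {g : E n → ℂ} (hg : MemLp g 2 (gauss n)) {S : Set (E n)}
    (hS : MeasurableSet S) : (restrictLp hg hS : E n → ℂ) =ᵐ[gauss n] S.indicator g := by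
  rw [restrictLp]
  exact MemLp.coeFn_toLp _

theorem enorm_restrictLp_le {g : E n → ℂ} (hg : MemLp g 2 (gauss n)) {S : Set (E n)}
    (hS : MeasurableSet S) :
    ∀ᵐ x ∂(gauss n), ‖restrictLp hg hS x‖ₑ ≤ S.indicator (fun x => ‖g x‖ₑ) x := by
  filter_upwards [coeFn_restrictLp hg hS] with x hx
  rw [hx, enorm_indicator_eq_indicator_enorm]

theorem restrictLp_eq_sub {g : E n → ℂ} (hg : MemLp g 2 (gauss n)) {S T : Set (E n)}
    (hS : MeasurableSet S) (hT : MeasurableSet T) (hST : S ⊆ T) :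
    restrictLp hg hS
      = restrictLp hg hT
        - restrictLp hg (hT.diff hS) := by
  rw [restrictLp, restrictLp, restrictLp, ← MemLp.toLp_sub, MemLp.toLp_eq_toLp_iff]
  refine Eventually.of_forall fun x => ?_
  rw [Pi.sub_apply]
  by_cases h1 : x ∈ S
  · simp [h1, hST h1]
  · by_cases h2 : x ∈ T <;> simp [h1, h2]

theorem norm_restrictLp_sq_le {g : E n → ℂ} (hg : MemLp g 2 (gauss n)) {S : Set (E n)}
    (hS : MeasurableSet S) :
    ‖restrictLp hg hS‖ ^ 2 ≤ (∫⁻ x, ‖g x‖ₑ ^ 2 ∂(gauss n)).toReal := by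
  rw [restrictLp, norm_toLp_sq]
  refine ENNReal.toReal_mono (lintegral_enorm_sq_lt_top hg).ne (lintegral_mono fun x => ?_)
  exact pow_le_pow_left₀ zero_le (enorm_indicator_le_enorm_self _ _) 2

/-- The key estimate for decreasing truncations `1_{S j} g` of a function. -/
theorem sum_heatForm_indicator_le {r : ℝ} (hr : 0 < r) (J : ℕ) {g : E n → ℂ}
    (hgm : StronglyMeasurable g) (hg : MemLp g 2 (gauss n)) {S : ℕ → Set (E n)}
    (hSm : ∀ j, MeasurableSet (S j)) (hS : Antitone S) :
    ∑ j ∈ Finset.range J,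
      (heatForm (restrictLp hg (hSm j)) (2 ^ j * r)
        - heatForm (restrictLp hg (hSm j)) (2 ^ (j + 1) * r))
      ≤ 32 * (∫⁻ x, ‖g x‖ₑ ^ 2 ∂(gauss n)).toReal := by
  have hfin : ∫⁻ x, ‖g x‖ₑ ^ 2 ∂(gauss n) < ∞ := lintegral_enorm_sq_lt_top hg
  have hFm : Measurable fun x => ‖g x‖ₑ := hgm.enorm
  -- Truncated subtraction makes `D 0` empty, and `D (j + 1)` is `S j \ S (j + 1)`; it is thus
  -- paired with the average of index `j + 1`, as the maximal inequality requires.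
  set D : ℕ → Set (E n) := fun j => S (j - 1) \ S j with hD
  have hDm : ∀ j, MeasurableSet (D j) := fun j => (hSm _).diff (hSm _)
  have hDd : Pairwise (Function.onFun Disjoint D) := by
    have key : ∀ i j, i < j → Disjoint (D i) (D j) := fun i j hij => by
      rw [Set.disjoint_left]
      rintro x ⟨_, hx⟩ ⟨hx2, _⟩
      exact hx (hS (by omega : i ≤ j - 1) hx2)
    intro i j hij
    rcases lt_or_gt_of_ne hij with h | h
    · exact key i j h
    · exact (key j i h).symm
  obtain ⟨m, hm⟩ : ∃ m : ℕ → ℝ≥0∞, ∀ j, m j = ∫⁻ x, posAvg r j (fun x => ‖g x‖ₑ) x *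
    (D j).indicator (fun x => ‖g x‖ₑ) x ∂(gauss n) := ⟨_, fun _ => rfl⟩
  obtain ⟨G, hG⟩ : ∃ G : ℕ → L2 n, ∀ j, G j = restrictLp hg (hSm j) := ⟨_, fun _ => rfl⟩
  have hmfin : ∀ j, m j < ∞ := fun j => by
    rw [hm]
    exact (lintegral_posAvg_mul_self_le hr j hFm
      (hFm.indicator (hDm j)) (indicator_le_self _ _)).trans_lt hfin
  have step : ∀ j, avgForm r (j + 1) (G (j + 1)) - avgForm r (j + 1) (G j)
      ≤ 3 * (m (j + 1)).toReal := by
    intro j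
    rw [hG (j + 1), restrictLp_eq_sub hg (hSm (j + 1)) (hSm j) (hS (Nat.le_succ j)), ← hG j, hm]
    refine avgForm_sub_vector_le hr (j + 1) hFm (hFm.indicator (hDm _))
      (indicator_le_self _ _) hfin ?_ (enorm_restrictLp_le hg ((hSm j).diff (hSm (j + 1))))
    rw [hG]
    exact (enorm_restrictLp_le hg (hSm j)).mono fun x hx => hx.trans (indicator_le_self _ _ _)
  have hsum : ∑ j ∈ Finset.range J, (m (j + 1)).toReal
      ≤ 5 * (∫⁻ x, ‖g x‖ₑ ^ 2 ∂(gauss n)).toReal := by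
    have h := linearized_maximal_le hr J hFm hfin hDm hDd
    simp_rw [← hm] at h
    rw [Finset.sum_range_succ'] at h
    have h2 := ENNReal.toReal_mono (by finiteness [hfin.ne]) (le_self_add.trans h)
    rw [ENNReal.toReal_mul, ENNReal.toReal_sum (fun j _ => (hmfin (j + 1)).ne)] at h2
    simpa using h2
  have h0 : avgForm r 0 (G 0) ≤ (∫⁻ x, ‖g x‖ₑ ^ 2 ∂(gauss n)).toReal := by
    simp only [avgForm, pow_zero, inv_one, one_mul, Finset.Icc_self, Finset.sum_singleton,
      Nat.cast_one]
    refine (heatForm_le hr _).trans ?_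
    rw [hG]
    exact norm_restrictLp_sq_le hg (hSm 0)
  have hJ : 0 ≤ avgForm r J (G J) := avgForm_nonneg hr _ _
  simp_rw [← hG]
  calc _ ≤ ∑ j ∈ Finset.range J, 2 * (avgForm r j (G j) - avgForm r (j + 1) (G j)) :=
        Finset.sum_le_sum fun j _ => heatForm_sub_le_avg hr (G j) j
    -- The first sum telescopes; the second collects the errors from passing from `G j` to `G (j +
    -- 1)` in the same average.
    _ = 2 * (∑ j ∈ Finset.range J, (avgForm r j (G j) - avgForm r (j + 1) (G (j + 1)))
        + ∑ j ∈ Finset.range J, (avgForm r (j + 1) (G (j + 1)) - avgForm r (j + 1) (G j))) := by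
        rw [← Finset.mul_sum, ← Finset.sum_add_distrib]
        congr 1
        exact Finset.sum_congr rfl fun j _ => by ring
    -- The constant is `2 (1 + 3 · 5)`: the initial average contributes one, each error has the
    -- factor three, and the maximal inequality the factor five.
    _ ≤ 32 * (∫⁻ x, ‖g x‖ₑ ^ 2 ∂(gauss n)).toReal := by
        rw [Finset.sum_range_sub' (fun j => avgForm r j (G j))]
        have h1 := Finset.sum_le_sum fun j (_ : j ∈ Finset.range J) => step j
        rw [← Finset.mul_sum] at h1
        linarith

end Form

end GaussianTent

namespace GaussianTent

/-! ### Smoothness of Laplace type integrals against the Gaussian measure. -/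

section Laplace

variable {n : ℕ} {W : Type} [NormedAddCommGroup W] [NormedSpace ℝ W]

/-- The functional `(z, θ) ↦ ⟨y, z⟩ - θ|y|²`. -/
noncomputable def expPhase (y : E n) : E n × ℝ →L[ℝ] ℝ :=
  (innerSL ℝ y).comp (ContinuousLinearMap.fst ℝ (E n) ℝ)
    - ‖y‖ ^ 2 • ContinuousLinearMap.snd ℝ (E n) ℝ

theorem expPhase_apply (y : E n) (w : E n × ℝ) :
    expPhase y w = inner ℝ y w.1 - ‖y‖ ^ 2 * w.2 := by
  simp [expPhase]

theorem continuous_expPhase : Continuous (expPhase (n := n)) := by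
  unfold expPhase; fun_prop

theorem norm_expPhase_le (y : E n) : ‖expPhase y‖ ≤ (1 + ‖y‖) ^ 2 := by
  refine ContinuousLinearMap.opNorm_le_bound _ (by positivity) fun w => ?_
  rw [expPhase_apply]
  have h1 := norm_inner_le_norm (𝕜 := ℝ) y w.1
  have h2 := norm_fst_le w
  have h3 := norm_snd_le w
  have h4 := norm_nonneg w
  have h5 := norm_nonneg y
  calc ‖inner ℝ y w.1 - ‖y‖ ^ 2 * w.2‖ ≤ ‖inner ℝ y w.1‖ + ‖‖y‖ ^ 2 * w.2‖ := norm_sub_le _ _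
    _ ≤ ‖y‖ * ‖w‖ + ‖y‖ ^ 2 * ‖w‖ := by
        rw [norm_mul (‖y‖ ^ 2), norm_pow, norm_norm]
        gcongr
        exact h1.trans (by gcongr)
    _ ≤ (1 + ‖y‖) ^ 2 * ‖w‖ := by nlinarith [mul_nonneg h5 h4]

/-- `g` is bounded by a polynomial times a function in `L²(γ)`. -/
def PolyL2 (g : E n → W) : Prop :=
  AEStronglyMeasurable g (gauss n) ∧ ∃ (N : ℕ) (F : E n → ℝ), MemLp F 2 (gauss n) ∧
    ∀ y, ‖g y‖ ≤ (1 + ‖y‖) ^ N * F y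

/-- The Laplace type integral `∫ exp(⟨y, z⟩ - θ|y|²) g(y) dγ(y)`, as a function of `(z, θ)`. -/
noncomputable def laplaceInt (g : E n → W) (w : E n × ℝ) : W :=
  ∫ y, Real.exp (expPhase y w) • g y ∂(gauss n)

theorem PolyL2.smul {g : E n → W} (hg : PolyL2 g) {p : E n → ℝ} (hp : Continuous p) {N : ℕ} {c : ℝ}
    (hpN : ∀ y, ‖p y‖ ≤ c * (1 + ‖y‖) ^ N) : PolyL2 (fun y => p y • g y) := by
  obtain ⟨hm, M, F, hF, hFM⟩ := hg
  refine ⟨hp.aestronglyMeasurable.smul hm, N + M, fun y => c * F y, hF.const_mul c, fun y => ?_⟩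
  rw [norm_smul]
  calc ‖p y‖ * ‖g y‖ ≤ (c * (1 + ‖y‖) ^ N) * ((1 + ‖y‖) ^ M * F y) :=
        mul_le_mul (hpN y) (hFM y) (norm_nonneg _) ((norm_nonneg _).trans (hpN y))
    _ = _ := by ring

theorem PolyL2.smulRight {g : E n → W} (hg : PolyL2 g) :
    PolyL2 (fun y => (expPhase y).smulRight (g y)) := by
  obtain ⟨hm, M, F, hF, hFM⟩ := hg
  refine ⟨?_, 2 + M, F, hF, fun y => ?_⟩
  · have h : Continuous fun p : (E n × ℝ →L[ℝ] ℝ) × W => p.1.smulRight p.2 :=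
      isBoundedBilinearMap_smulRight.continuous
    exact h.comp_aestronglyMeasurable (continuous_expPhase.aestronglyMeasurable.prodMk hm)
  · rw [ContinuousLinearMap.norm_smulRight_apply, pow_add, mul_assoc]
    exact mul_le_mul (norm_expPhase_le y) (hFM y) (norm_nonneg _) (by positivity)

/-- A function of growth `exp((1/2 - r/2)|y|²)` is in `L²(γ)`. Half of the margin `r` absorbs the
polynomial and the linear exponent, by `p^N ≤ N! e^p` and completing the square. -/
theorem exists_memLp_bound (N : ℕ) (R : ℝ) {r : ℝ} (hr : 0 < r) :
    ∃ B : E n → ℝ, MemLp B 2 (gauss n) ∧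
      ∀ y, (1 + ‖y‖) ^ N * Real.exp (R * ‖y‖ + (1 / 2 - r) * ‖y‖ ^ 2) ≤ B y := by
  set K := N.factorial * Real.exp 1 * Real.exp ((R + 1) ^ 2 / (2 * r)) with hK
  refine ⟨fun y => K * Real.exp ((1 / 2 - r / 2) * ‖y‖ ^ 2), MemLp.const_mul ?_ K, fun y => ?_⟩
  · refine (memLp_two_iff_integrable_sq (by fun_prop)).2 ?_
    refine (integrable_gauss_exp (b := -(1 - r)) (by linarith) (0 : E n)).congr
      (Eventually.of_forall fun y => ?_)
    simp only [inner_zero_left, add_zero, neg_neg]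
    rw [← Real.exp_nat_mul]
    congr 1
    push_cast; ring
  · have h1 : (1 + ‖y‖) ^ N ≤ N.factorial * Real.exp (1 + ‖y‖) := by
      have := Real.pow_div_factorial_le_exp (1 + ‖y‖) (by positivity) N
      rw [div_le_iff₀ (by positivity)] at this
      linarith
    have h2 : (R + 1) * ‖y‖ ≤ (R + 1) ^ 2 / (2 * r) + r / 2 * ‖y‖ ^ 2 := by
      have := sq_nonneg ((R + 1) - r * ‖y‖)
      rw [← sub_nonneg]
      have e : (R + 1) ^ 2 / (2 * r) + r / 2 * ‖y‖ ^ 2 - (R + 1) * ‖y‖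
          = ((R + 1) - r * ‖y‖) ^ 2 / (2 * r) := by field_simp; ring
      rw [e]; positivity
    calc (1 + ‖y‖) ^ N * Real.exp (R * ‖y‖ + (1 / 2 - r) * ‖y‖ ^ 2)
        ≤ N.factorial * Real.exp (1 + ‖y‖) * Real.exp (R * ‖y‖ + (1 / 2 - r) * ‖y‖ ^ 2) := by
          gcongr
      _ = N.factorial * Real.exp (1 + (R + 1) * ‖y‖ + (1 / 2 - r) * ‖y‖ ^ 2) := by
          rw [mul_assoc, ← Real.exp_add]; ring_nf
      _ ≤ N.factorial * Real.exp (1 + ((R + 1) ^ 2 / (2 * r) + r / 2 * ‖y‖ ^ 2)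
            + (1 / 2 - r) * ‖y‖ ^ 2) := by gcongr
      _ = K * Real.exp ((1 / 2 - r / 2) * ‖y‖ ^ 2) := by
          rw [hK, mul_assoc, mul_assoc, ← Real.exp_add, ← Real.exp_add]; ring_nf

/-- A locally uniform dominating function. The threshold is `-1/2` because `exp(-θ|y|²)` is in
`L²(γ)` exactly for `θ > -1/2`, and it is paired with another `L²(γ)` function. -/
theorem PolyL2.exists_bound {g : E n → W} (hg : PolyL2 g) {w₀ : E n × ℝ} (hw : -(1 / 2) < w₀.2) :
    ∃ s ∈ 𝓝 w₀, ∃ b : E n → ℝ, Integrable b (gauss n) ∧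
      ∀ y, ∀ w ∈ s, ‖Real.exp (expPhase y w) • g y‖ ≤ b y := by
  obtain ⟨hm, M, F, hF, hFM⟩ := hg
  -- Half of the distance to the threshold: on the ball of radius `r` the parameter stays above
  -- `-(1/2 - r)`.
  set r := (w₀.2 + 1 / 2) / 2 with hr
  have hrp : 0 < r := by rw [hr]; linarith
  obtain ⟨B, hB, hBb⟩ := exists_memLp_bound (n := n) M (‖w₀‖ + r) hrp
  refine ⟨Metric.ball w₀ r, Metric.ball_mem_nhds _ hrp, fun y => B y * F y,
    hB.integrable_mul hF, fun y w hw' => ?_⟩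
  rw [norm_smul, Real.norm_of_nonneg (Real.exp_nonneg _), expPhase_apply]
  have hd : ‖w - w₀‖ < r := by rwa [← dist_eq_norm]
  have h1 : ‖w.1‖ ≤ ‖w₀‖ + r := by
    have := norm_le_norm_add_norm_sub' w w₀
    have h2 := norm_fst_le w
    linarith
  have h2 : w₀.2 - r ≤ w.2 := by
    have := (norm_snd_le (w - w₀)).trans hd.le
    rw [Prod.snd_sub, Real.norm_eq_abs] at this
    linarith [(abs_le.1 this).1]
  have h3 : inner ℝ y w.1 - ‖y‖ ^ 2 * w.2
      ≤ (‖w₀‖ + r) * ‖y‖ + (1 / 2 - r) * ‖y‖ ^ 2 := by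
    have h4 := real_inner_le_norm y w.1
    have h5 := mul_le_mul_of_nonneg_left h1 (norm_nonneg y)
    have h6 : w₀.2 - r = -(1 / 2 - r) := by rw [hr]; ring
    rw [h6] at h2
    nlinarith [mul_le_mul_of_nonneg_left h2 (sq_nonneg ‖y‖)]
  have hF0 : 0 ≤ F y := by
    have := (norm_nonneg _).trans (hFM y)
    exact nonneg_of_mul_nonneg_right this (by positivity)
  calc _ ≤ Real.exp ((‖w₀‖ + r) * ‖y‖ + (1 / 2 - r) * ‖y‖ ^ 2) * ((1 + ‖y‖) ^ M * F y) := by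
        gcongr
        exact hFM y
    _ = ((1 + ‖y‖) ^ M * Real.exp ((‖w₀‖ + r) * ‖y‖ + (1 / 2 - r) * ‖y‖ ^ 2)) * F y := by ring
    _ ≤ B y * F y := by gcongr; exact hBb y

theorem PolyL2.aestronglyMeasurable_exp_smul {g : E n → W} (hg : PolyL2 g) (w : E n × ℝ) :
    AEStronglyMeasurable (fun y => Real.exp (expPhase y w) • g y) (gauss n) := by
  refine AEStronglyMeasurable.smul ?_ hg.1
  refine Continuous.aestronglyMeasurable ?_
  exact Real.continuous_exp.comp (continuous_expPhase.clm_apply continuous_const)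

theorem PolyL2.integrable {g : E n → W} (hg : PolyL2 g) {w : E n × ℝ} (hw : -(1 / 2) < w.2) :
    Integrable (fun y => Real.exp (expPhase y w) • g y) (gauss n) := by
  obtain ⟨s, hs, b, hb, hbb⟩ := hg.exists_bound hw
  exact hb.mono' (hg.aestronglyMeasurable_exp_smul w)
    (Eventually.of_forall fun y => hbb y w (mem_of_mem_nhds hs))

theorem PolyL2.hasFDerivAt {g : E n → W} (hg : PolyL2 g) {w : E n × ℝ} (hw : -(1 / 2) < w.2) :
    HasFDerivAt (laplaceInt g) (laplaceInt (fun y => (expPhase y).smulRight (g y)) w) w := by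
  obtain ⟨s, hs, b, hb, hbb⟩ := hg.smulRight.exists_bound hw
  have hd : ∀ y, ∀ v ∈ s, HasFDerivAt (fun v => Real.exp (expPhase y v) • g y)
      (Real.exp (expPhase y v) • (expPhase y).smulRight (g y)) v := by
    intro y v _
    refine (((expPhase y).hasFDerivAt (x := v)).exp.smul_const (g y)).congr_fderiv ?_
    refine ContinuousLinearMap.ext fun u => ?_
    simp only [ContinuousLinearMap.smulRight_apply, _root_.smul_apply, smul_eq_mul,
      mul_smul]
  exact hasFDerivAt_integral_of_dominated_of_fderiv_le (𝕜 := ℝ)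
    (F := fun v y => Real.exp (expPhase y v) • g y)
    (F' := fun v y => Real.exp (expPhase y v) • (expPhase y).smulRight (g y)) hs
    (Eventually.of_forall fun v => hg.aestronglyMeasurable_exp_smul v) (hg.integrable hw)
    (hg.smulRight.aestronglyMeasurable_exp_smul w) (Eventually.of_forall hbb) hb
    (Eventually.of_forall hd)

theorem isOpen_halfSpace : IsOpen {w : E n × ℝ | -(1 / 2) < w.2} :=
  isOpen_lt continuous_const continuous_snd

theorem PolyL2.contDiffOn {g : E n → W} (hg : PolyL2 g) (m : ℕ) :
    ContDiffOn ℝ m (laplaceInt g) {w : E n × ℝ | -(1 / 2) < w.2} := by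
  -- The target space varies because the derivative is an integral of the same type whose weight
  -- takes values in continuous linear maps to `W`.
  induction m generalizing W with
  | zero =>
    rw [Nat.cast_zero, contDiffOn_zero]
    exact fun w hw => (hg.hasFDerivAt hw).continuousAt.continuousWithinAt
  | succ m ih =>
    rw [Nat.cast_succ, contDiffOn_succ_iff_fderiv_of_isOpen isOpen_halfSpace]
    refine ⟨fun w hw => (hg.hasFDerivAt hw).differentiableAt.differentiableWithinAt,
      fun h => absurd h (by simp), ?_⟩
    exact (ih hg.smulRight).congr fun w hw => (hg.hasFDerivAt hw).fderiv

theorem PolyL2.fderiv_apply [CompleteSpace W] {g : E n → W} (hg : PolyL2 g) {w : E n × ℝ}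
    (hw : -(1 / 2) < w.2) (v : E n × ℝ) :
    laplaceInt (fun y => (expPhase y).smulRight (g y)) w v
      = laplaceInt (fun y => expPhase y v • g y) w := by
  unfold laplaceInt
  rw [ContinuousLinearMap.integral_apply (hg.smulRight.integrable hw)]
  rfl

theorem PolyL2.expPhase_smul {g : E n → W} (hg : PolyL2 g) (v : E n × ℝ) :
    PolyL2 (fun y => expPhase y v • g y) := by
  refine hg.smul (continuous_expPhase.clm_apply continuous_const) (N := 2) (c := ‖v‖) fun y => ?_
  rw [mul_comm]
  exact ((expPhase y).le_opNorm v).trans (by gcongr; exact norm_expPhase_le y)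

theorem PolyL2.inner_smul {g : E n → W} (hg : PolyL2 g) (e : E n) :
    PolyL2 (fun y => inner ℝ y e • g y) := by
  have h := hg.expPhase_smul (e, 0)
  simpa [expPhase_apply] using h

theorem PolyL2.normSq_smul {g : E n → W} (hg : PolyL2 g) :
    PolyL2 (fun y => ‖y‖ ^ 2 • g y) := by
  refine hg.smul (by fun_prop) (N := 2) (c := 1) fun y => ?_
  rw [norm_pow, norm_norm, one_mul]
  gcongr
  linarith [norm_nonneg y]

end Laplace

theorem polyL2_of_memLp {n : ℕ} {f : E n → ℂ} (hf : MemLp f 2 (gauss n)) : PolyL2 f :=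
  ⟨hf.1, 0, fun y => ‖f y‖, hf.norm, fun y => by simp⟩

end GaussianTent

namespace GaussianTent

/-! ### The semigroup solves the heat equation for the differential operator `L`, pointwise. -/

section HeatEquation

variable {n : ℕ}

/-- The function `x ↦ exp(-a|x|²) ∫ exp(b⟨x, y⟩ - a|y|²) g(y) dγ(y)`. -/
noncomputable def gaussInt (a b : ℝ) (g : E n → ℂ) (x : E n) : ℂ :=
  Real.exp (-a * ‖x‖ ^ 2) • laplaceInt g (b • x, a)

theorem gaussInt_eq_integral (a b : ℝ) (g : E n → ℂ) (x : E n) :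
    gaussInt a b g x = ∫ y, (Real.exp (-a * ‖x‖ ^ 2) * Real.exp (expPhase y (b • x, a))) • g y
      ∂(gauss n) := by
  rw [gaussInt, laplaceInt, ← integral_smul]
  simp_rw [mul_smul]

theorem contDiff_gaussInt {a : ℝ} (ha : 0 < a) (b : ℝ) {g : E n → ℂ} (hg : PolyL2 g) (m : ℕ) :
    ContDiff ℝ m (gaussInt a b g) := by
  have h1 : ContDiff ℝ m fun x : E n => Real.exp (-a * ‖x‖ ^ 2) :=
    (contDiff_const.mul (contDiff_norm_sq ℝ)).exp
  have h2 : ContDiff ℝ m fun x : E n => laplaceInt g (b • x, a) :=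
    (hg.contDiffOn m).comp_contDiff (f := fun x : E n => (b • x, a))
      ((contDiff_const_smul b).prodMk contDiff_const)
      fun x => by simp only [Set.mem_ofPred_eq]; linarith
  exact h1.smul h2

theorem fderiv_gaussInt {a : ℝ} (ha : 0 < a) (b : ℝ) {g : E n → ℂ} (hg : PolyL2 g)
    (x e : E n) :
    fderiv ℝ (gaussInt a b g) x e = (-2 * a * inner ℝ x e) • gaussInt a b g x
      + b • gaussInt a b (fun y => inner ℝ y e • g y) x := by
  have hw : -(1 / 2) < ((b • x, a) : E n × ℝ).2 := by simp only; linarith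
  have h1 : HasFDerivAt (𝕜 := ℝ) (fun x : E n => Real.exp (-a * ‖x‖ ^ 2)) _ x :=
    ((hasStrictFDerivAt_norm_sq x).hasFDerivAt.const_mul (-a)).exp
  have h0 : HasFDerivAt (𝕜 := ℝ) (fun x : E n => ((b • x, a) : E n × ℝ)) _ x :=
    ((hasFDerivAt_id (𝕜 := ℝ) x).const_smul b).prodMk (hasFDerivAt_const a x)
  have h2 := (hg.hasFDerivAt hw).comp x h0
  have h3 := (h1.smul h2).fderiv
  have e1 : (fun x : E n => Real.exp (-a * ‖x‖ ^ 2)) • (laplaceInt g ∘ fun x => (b • x, a))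
      = gaussInt a b g := rfl
  have h4 : fderiv ℝ (gaussInt a b g) x = _ := h3
  rw [h4]
  simp only [_root_.add_apply, _root_.smul_apply, ContinuousLinearMap.comp_apply,
    ContinuousLinearMap.smulRight_apply, ContinuousLinearMap.prod_apply,
    ContinuousLinearMap.id_apply, _root_.zero_apply, Function.comp]
  rw [hg.fderiv_apply hw]
  have e2 : laplaceInt (fun y => expPhase y (b • e, 0) • g y) (b • x, a)
      = b • laplaceInt (fun y => inner ℝ y e • g y) (b • x, a) := by
    rw [laplaceInt, laplaceInt, ← integral_smul]
    refine integral_congr_ae (Eventually.of_forall fun y => ?_)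
    simp only [expPhase_apply, inner_smul_right, mul_zero, sub_zero]
    module
  rw [e2]
  simp only [gaussInt, innerSL_apply_apply, smul_eq_mul]
  module

theorem gaussInt_sum {ι : Type*} {a : ℝ} (ha : 0 < a) (b : ℝ) (I : Finset ι) (c : ι → ℝ)
    {g : ι → E n → ℂ} (hg : ∀ i, PolyL2 (g i)) (x : E n) :
    ∑ i ∈ I, c i • gaussInt a b (g i) x = gaussInt a b (fun y => ∑ i ∈ I, c i • g i y) x := by
  have hw : -(1 / 2) < ((b • x, a) : E n × ℝ).2 := by simp only; linarith
  simp only [gaussInt, laplaceInt]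
  simp_rw [smul_comm (c _) (Real.exp (-a * ‖x‖ ^ 2))]
  rw [← Finset.smul_sum]
  congr 1
  simp_rw [Finset.smul_sum, smul_comm (Real.exp _) (c _)]
  rw [integral_finsetSum _ fun i _ => ((hg i).integrable hw).fun_smul (c i)]
  simp_rw [integral_smul]

/-- Each derivative in direction `e` brings down `-2a⟨x, e⟩ + b⟨y, e⟩`; Parseval over an orthonormal
basis then assembles `|x|²`, `⟨x, y⟩` and `|y|²`. -/
theorem laplacian_gaussInt {a : ℝ} (ha : 0 < a) (b : ℝ) {g : E n → ℂ} (hg : PolyL2 g) (x : E n) :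
    Laplacian.laplacian (gaussInt a b g) x =
      (4 * a ^ 2 * ‖x‖ ^ 2 - 2 * a * n) • gaussInt a b g x
      - (4 * a * b) • gaussInt a b (fun y => inner ℝ y x • g y) x
      + b ^ 2 • gaussInt a b (fun y => ‖y‖ ^ 2 • g y) x := by
  set v := stdOrthonormalBasis ℝ (E n)
  rw [InnerProductSpace.laplacian_eq_iteratedFDeriv_orthonormalBasis _ v]
  have hdiff : ∀ {g : E n → ℂ}, PolyL2 g → ∀ z, DifferentiableAt ℝ (gaussInt a b g) z :=
    fun hg z => ((contDiff_gaussInt ha b hg 1).differentiable (by norm_num)) z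
  have second : ∀ e : E n, fderiv ℝ (fderiv ℝ (gaussInt a b g)) x e e
      = (4 * a ^ 2 * inner ℝ x e ^ 2 - 2 * a * inner ℝ e e) • gaussInt a b g x
        - (4 * a * b) • inner ℝ x e • gaussInt a b (fun y => inner ℝ y e • g y) x
        + b ^ 2 • gaussInt a b (fun y => inner ℝ y e • inner ℝ y e • g y) x := by
    intro e
    have hge := hg.inner_smul e
    have hd2 : DifferentiableAt ℝ (fderiv ℝ (gaussInt a b g)) x :=
      ((contDiff_gaussInt ha b hg 2).fderiv_right (m := 1) (by norm_num)).differentiable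
        (by norm_num) x
    have e1 : fderiv ℝ (fderiv ℝ (gaussInt a b g)) x e e
        = fderiv ℝ (fun z => fderiv ℝ (gaussInt a b g) z e) x e := by
      rw [fderiv_clm_apply hd2 (differentiableAt_const e)]
      simp
    have e2 : (fun z => fderiv ℝ (gaussInt a b g) z e) = fun z =>
        (-2 * a * inner ℝ z e) • gaussInt a b g z
          + b • gaussInt a b (fun y => inner ℝ y e • g y) z :=
      funext fun z => fderiv_gaussInt ha b hg z e
    have h1 : HasFDerivAt (𝕜 := ℝ) (fun z : E n => -2 * a * inner ℝ z e) _ x :=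
      (((hasFDerivAt_id (𝕜 := ℝ) x).inner ℝ (hasFDerivAt_const e x)).const_mul (-2 * a))
    have h2 := (h1.fun_smul (hdiff hg x).hasFDerivAt).add
      ((hdiff hge x).hasFDerivAt.const_smul b)
    have h3 : fderiv ℝ (fun z => (-2 * a * inner ℝ z e) • gaussInt a b g z
          + b • gaussInt a b (fun y => inner ℝ y e • g y) z) x = _ := h2.fderiv
    rw [e1, e2, h3]
    simp only [_root_.add_apply, _root_.smul_apply, ContinuousLinearMap.comp_apply,
      ContinuousLinearMap.smulRight_apply, ContinuousLinearMap.prod_apply,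
      ContinuousLinearMap.id_apply, _root_.zero_apply, fderivInnerCLM_apply, inner_zero_right,
      zero_add, id, fderiv_gaussInt ha b hg, fderiv_gaussInt ha b hge, smul_eq_mul]
    module
  simp_rw [iteratedFDeriv_two_apply]
  simp only [Matrix.cons_val_zero, Matrix.cons_val_one, second]
  rw [Finset.sum_add_distrib, Finset.sum_sub_distrib, ← Finset.sum_smul, ← Finset.smul_sum,
    ← Finset.smul_sum]
  have s1 : ∑ i, (4 * a ^ 2 * inner ℝ x (v i) ^ 2 - 2 * a * inner ℝ (v i) (v i))
      = 4 * a ^ 2 * ‖x‖ ^ 2 - 2 * a * n := by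
    rw [Finset.sum_sub_distrib, ← Finset.mul_sum, v.sum_sq_inner_left x]
    simp
    ring
  have s2 : ∑ i, inner ℝ x (v i) • gaussInt a b (fun y => inner ℝ y (v i) • g y) x
      = gaussInt a b (fun y => inner ℝ y x • g y) x := by
    rw [gaussInt_sum ha b _ _ (fun i => hg.inner_smul (v i))]
    congr 1
    funext y
    simp_rw [smul_smul]
    rw [← Finset.sum_smul, ← v.sum_inner_mul_inner y x]
    congr 1
    exact Finset.sum_congr rfl fun i _ => by rw [real_inner_comm x, mul_comm]
  have s3 : ∑ i, gaussInt a b (fun y => inner ℝ y (v i) • inner ℝ y (v i) • g y) x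
      = gaussInt a b (fun y => ‖y‖ ^ 2 • g y) x := by
    have h := gaussInt_sum ha b Finset.univ (fun _ => (1 : ℝ))
      (fun i => (hg.inner_smul (v i)).inner_smul (v i)) x
    simp_rw [one_smul] at h
    rw [h]
    congr 1
    funext y
    simp_rw [smul_smul, ← sq]
    rw [← Finset.sum_smul, v.sum_sq_inner_left y]
  rw [s1, s2, s3]

theorem ouSemigroup_eq_gaussInt {s : ℝ} (hs : 0 < s) (f : E n → ℂ) (x : E n) :
    ouSemigroup s f x = (1 / (1 - Real.exp (-s) ^ 2) ^ ((n : ℝ) / 2)) •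
      gaussInt (mehlerSq s) (mehlerCross s) f x := by
  rw [gaussInt_eq_integral, ← integral_smul, ouSemigroup]
  refine integral_congr_ae (Eventually.of_forall fun y => ?_)
  simp only
  rw [mehler_eq hs, expPhase_apply, ← Complex.real_smul, smul_smul]
  congr 1
  rw [mul_assoc, real_inner_comm]
  ring_nf

theorem contDiff_ouSemigroup {s : ℝ} (hs : 0 < s) {f : E n → ℂ} (hf : MemLp f 2 (gauss n)) :
    ContDiff ℝ 2 (ouSemigroup s f) := by
  have h : ouSemigroup s f = fun x => (1 / (1 - Real.exp (-s) ^ 2) ^ ((n : ℝ) / 2)) •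
      gaussInt (mehlerSq s) (mehlerCross s) f x := funext fun x => ouSemigroup_eq_gaussInt hs f x
  rw [h]
  exact (contDiff_gaussInt (mehlerSq_pos hs) _ (polyL2_of_memLp hf) 2).const_smul _

theorem ouL_ouSemigroup {s : ℝ} (hs : 0 < s) {f : E n → ℂ} (hf : MemLp f 2 (gauss n)) (x : E n) :
    ouL (ouSemigroup s f) x = (1 / (1 - Real.exp (-s) ^ 2) ^ ((n : ℝ) / 2)) •
      ((mehlerSq s * n - 2 * mehlerSq s * (mehlerSq s + 1) * ‖x‖ ^ 2) •
        gaussInt (mehlerSq s) (mehlerCross s) f x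
      + (mehlerCross s * (2 * mehlerSq s + 1)) •
        gaussInt (mehlerSq s) (mehlerCross s) (fun y => inner ℝ y x • f y) x
      - (mehlerCross s ^ 2 / 2) •
        gaussInt (mehlerSq s) (mehlerCross s) (fun y => ‖y‖ ^ 2 • f y) x) := by
  have hg := polyL2_of_memLp hf
  have ha := mehlerSq_pos hs
  have h : ouSemigroup s f = (1 / (1 - Real.exp (-s) ^ 2) ^ ((n : ℝ) / 2)) •
      gaussInt (mehlerSq s) (mehlerCross s) f := funext fun x => ouSemigroup_eq_gaussInt hs f x
  rw [ouL, h, InnerProductSpace.laplacian_smul _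
    (contDiff_gaussInt ha _ hg 2).contDiffAt,
    fderiv_const_smul ((contDiff_gaussInt ha _ hg 1).differentiable (by norm_num) x),
    _root_.smul_apply, laplacian_gaussInt ha _ hg, fderiv_gaussInt ha _ hg,
    real_inner_self_eq_norm_sq]
  have e : ∀ z : ℂ, -(1 / 2 : ℂ) * z = (-(1 / 2) : ℝ) • z := fun z => by
    rw [Complex.real_smul]; push_cast; rfl
  rw [e]
  module

/-- With `a = mehlerSq`, `b = mehlerCross` and `k` the normalising factor, `a' = -2a(a + 1)`, `b' =
-b(2a + 1)` and `k' = -nak`. The chain rule along `s ↦ (b x, a)` then reproduces the expression in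
`ouL_ouSemigroup`. -/
theorem hasDerivAt_ouSemigroup {s : ℝ} (hs : 0 < s) {f : E n → ℂ} (hf : MemLp f 2 (gauss n))
    (x : E n) :
    HasDerivAt (fun t => ouSemigroup t f x) (-ouL (ouSemigroup s f) x) s := by
  have hg := polyL2_of_memLp hf
  have ha := mehlerSq_pos hs
  have hD := one_sub_exp_sq_pos hs
  have hw : -(1 / 2) < ((mehlerCross s • x, mehlerSq s) : E n × ℝ).2 := by simp only; linarith
  have hq : HasDerivAt (fun t : ℝ => Real.exp (-t)) (-Real.exp (-s)) s := by
    simpa using (hasDerivAt_neg s).exp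
  have hden : HasDerivAt (fun t : ℝ => 1 - Real.exp (-t) ^ 2) (2 * Real.exp (-s) ^ 2) s := by
    refine ((hq.fun_pow 2).const_sub 1).congr_deriv ?_
    push_cast; ring
  have hsq : HasDerivAt mehlerSq (-(2 * mehlerSq s * (mehlerSq s + 1))) s := by
    refine ((hq.fun_pow 2).fun_div hden hD.ne').congr_deriv ?_
    unfold mehlerSq
    field_simp
    ring
  have hcr : HasDerivAt mehlerCross (-(mehlerCross s * (2 * mehlerSq s + 1))) s := by
    refine ((hq.const_mul 2).fun_div hden hD.ne').congr_deriv ?_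
    unfold mehlerSq mehlerCross
    field_simp
    ring
  have hc : HasDerivAt (fun t : ℝ => 1 / (1 - Real.exp (-t) ^ 2) ^ ((n : ℝ) / 2))
      (1 / (1 - Real.exp (-s) ^ 2) ^ ((n : ℝ) / 2) * (-(mehlerSq s * n))) s := by
    have hp : 0 < (1 - Real.exp (-s) ^ 2) ^ ((n : ℝ) / 2) := by positivity
    have h := (hden.rpow_const (p := (n : ℝ) / 2) (Or.inl hD.ne')).inv hp.ne'
    simp only [one_div]
    refine h.congr_deriv ?_
    rw [Real.rpow_sub_one hD.ne']
    unfold mehlerSq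
    field_simp
  have hexp : HasDerivAt (fun t : ℝ => Real.exp (-mehlerSq t * ‖x‖ ^ 2))
      (Real.exp (-mehlerSq s * ‖x‖ ^ 2) * (2 * mehlerSq s * (mehlerSq s + 1) * ‖x‖ ^ 2)) s := by
    refine ((hsq.neg.mul_const (‖x‖ ^ 2)).exp).congr_deriv ?_
    rw [Pi.neg_apply]
    ring
  have hpath : HasDerivAt (fun t : ℝ => ((mehlerCross t • x, mehlerSq t) : E n × ℝ))
      ((-(mehlerCross s * (2 * mehlerSq s + 1))) • x, -(2 * mehlerSq s * (mehlerSq s + 1))) s :=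
    (hcr.smul_const x).prodMk hsq
  have hJ := (hg.hasFDerivAt hw).comp_hasDerivAt s hpath
  rw [hg.fderiv_apply hw] at hJ
  have hJe : laplaceInt (fun y => expPhase y ((-(mehlerCross s * (2 * mehlerSq s + 1))) • x,
      -(2 * mehlerSq s * (mehlerSq s + 1))) • f y) (mehlerCross s • x, mehlerSq s)
      = (-(mehlerCross s * (2 * mehlerSq s + 1))) •
          laplaceInt (fun y => inner ℝ y x • f y) (mehlerCross s • x, mehlerSq s)
        + (2 * mehlerSq s * (mehlerSq s + 1)) •
          laplaceInt (fun y => ‖y‖ ^ 2 • f y) (mehlerCross s • x, mehlerSq s) := by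
    unfold laplaceInt
    rw [← integral_smul, ← integral_smul, ← integral_add
      (((hg.inner_smul x).integrable hw).fun_smul _)
      ((hg.normSq_smul.integrable hw).fun_smul _)]
    refine integral_congr_ae (Eventually.of_forall fun y => ?_)
    simp only [expPhase_apply, inner_smul_right]
    module
  rw [hJe] at hJ
  have hfin := hc.smul (hexp.smul hJ)
  have e1 : (fun t => ouSemigroup t f x) =ᶠ[𝓝 s] fun t =>
      (1 / (1 - Real.exp (-t) ^ 2) ^ ((n : ℝ) / 2)) •
      (Real.exp (-mehlerSq t * ‖x‖ ^ 2) • laplaceInt f (mehlerCross t • x, mehlerSq t)) := by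
    filter_upwards [lt_mem_nhds hs] with t ht
    exact ouSemigroup_eq_gaussInt ht f x
  refine (HasDerivAt.congr_of_eventuallyEq hfin e1).congr_deriv ?_
  -- The relation `b² = 4a(a + 1)` again: it matches the coefficients of `|y|²` in the time
  -- derivative and in `L`.
  have e2 : 2 * mehlerSq s * (mehlerSq s + 1) = mehlerCross s ^ 2 / 2 := by
    unfold mehlerSq mehlerCross
    field_simp
    ring
  rw [ouL_ouSemigroup hs hf]
  simp only [gaussInt, Function.comp, Pi.smul_apply']
  rw [e2]
  module

end HeatEquation

end GaussianTent

namespace GaussianTent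

/-! ### The operators `L e^{-sL}` on `L²(γ)`: bounds, symmetry, linearity and joint measurability.
-/

section Generator

variable {n : ℕ}

theorem tendsto_diff_quotient_ouSemigroup {s : ℝ} (hs : 0 < s) {f : E n → ℂ}
    (hf : MemLp f 2 (gauss n)) (x : E n) {h : ℕ → ℝ} (hpos : ∀ k, 0 < h k)
    (hlim : Tendsto h atTop (𝓝 0)) :
    Tendsto (fun k => (h k)⁻¹ • (ouSemigroup s f x - ouSemigroup (s + h k) f x)) atTop
      (𝓝 (ouL (ouSemigroup s f) x)) := by
  have h1 := (hasDerivAt_iff_tendsto_slope_zero.1 (hasDerivAt_ouSemigroup hs hf x)).comp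
    (tendsto_nhdsWithin_iff.2 ⟨hlim, Eventually.of_forall fun k => (hpos k).ne'⟩)
  have h2 := h1.neg
  rw [neg_neg] at h2
  refine h2.congr fun k => ?_
  simp only [Function.comp]
  module

theorem tendsto_div_two_pow (r : ℝ) :
    Tendsto (fun k : ℕ => r / 2 ^ (k + 2)) atTop (𝓝 0) := by
  have h := (tendsto_pow_atTop_nhds_zero_of_lt_one (r := (1 / 2 : ℝ)) (by norm_num)
    (by norm_num)).const_mul (r / 4)
  rw [mul_zero] at h
  refine h.congr fun k => ?_
  rw [pow_add, one_div, inv_pow]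
  field_simp
  norm_num

/-- The same quotients converge in `L²(γ)` to `w` and at every point to `L e^{-sL} f`; an almost
everywhere convergent subsequence identifies the two limits. -/
theorem coeFn_eq_ouL_of_tendsto {r s : ℝ} (hr : 0 < r) (hs : 0 < s) {f : E n → ℂ}
    (hf : MemLp f 2 (gauss n)) {w : L2 n}
    (hw : Tendsto (fun k : ℕ => (r / 2 ^ (k + 2))⁻¹ •
      (heatOp n s (hf.toLp f) - heatOp n (s + r / 2 ^ (k + 2)) (hf.toLp f))) atTop (𝓝 w)) :
    w =ᵐ[gauss n] ouL (ouSemigroup s f) := by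
  have hm := tendstoInMeasure_of_tendsto_Lp hw
  obtain ⟨ns, hns, hae⟩ := hm.exists_seq_tendsto_ae
  have hT : ∀ t, 0 < t → heatOp n t (hf.toLp f) =ᵐ[gauss n] ouSemigroup t f := fun t ht => by
    rw [← ouSemigroup_congr_ae t hf.coeFn_toLp]
    exact coeFn_heatOp ht _
  have hc : ∀ k : ℕ, ((r / 2 ^ (k + 2))⁻¹ • (heatOp n s (hf.toLp f) -
      heatOp n (s + r / 2 ^ (k + 2)) (hf.toLp f)) : L2 n) =ᵐ[gauss n] fun x =>
      (r / 2 ^ (k + 2))⁻¹ • (ouSemigroup s f x - ouSemigroup (s + r / 2 ^ (k + 2)) f x) := by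
    intro k
    have hp : 0 < r / 2 ^ (k + 2) := by positivity
    filter_upwards [Lp.coeFn_smul (r / 2 ^ (k + 2))⁻¹ (heatOp n s (hf.toLp f) -
      heatOp n (s + r / 2 ^ (k + 2)) (hf.toLp f)), Lp.coeFn_sub (heatOp n s (hf.toLp f))
      (heatOp n (s + r / 2 ^ (k + 2)) (hf.toLp f)), hT s hs, hT _ (add_pos hs hp)]
      with x h1 h2 h3 h4
    rw [h1, Pi.smul_apply, h2, Pi.sub_apply, h3, h4]
  filter_upwards [hae, ae_all_iff.2 hc] with x hx hcx
  refine tendsto_nhds_unique hx ?_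
  have h := (tendsto_diff_quotient_ouSemigroup hs hf x (h := fun k => r / 2 ^ (k + 2))
    (fun k => by positivity) (tendsto_div_two_pow r)).comp hns.tendsto_atTop
  exact h.congr fun k => (hcx (ns k)).symm

theorem memLp_ouL_ouSemigroup {s : ℝ} (hs : 0 < s) {f : E n → ℂ} (hf : MemLp f 2 (gauss n)) :
    MemLp (ouL (ouSemigroup s f)) 2 (gauss n) := by
  obtain ⟨w, hw, _⟩ := exists_tendsto_diff_quotient hs le_rfl (hf.toLp f)
  exact (Lp.memLp w).ae_eq (coeFn_eq_ouL_of_tendsto hs hs hf hw)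

theorem lintegral_ouL_ouSemigroup_sq_le {r s : ℝ} (hr : 0 < r) (hrs : r ≤ s) {f : E n → ℂ}
    (hf : MemLp f 2 (gauss n)) :
    ∫⁻ x, ‖ouL (ouSemigroup s f) x‖ₑ ^ 2 ∂(gauss n) ≤
      ENNReal.ofReal (4 / r ^ 2 * (heatForm (hf.toLp f) r - heatForm (hf.toLp f) (2 * r))) := by
  obtain ⟨w, hw, hn⟩ := exists_tendsto_diff_quotient hr hrs (hf.toLp f)
  have hae := coeFn_eq_ouL_of_tendsto hr (hr.trans_le hrs) hf hw
  refine le_trans (le_of_eq ?_) (ENNReal.ofReal_le_ofReal hn)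
  rw [← eLpNorm_two_sq, ← eLpNorm_congr_ae hae, Lp.norm_def, ← ENNReal.toReal_pow,
    ENNReal.ofReal_toReal (ENNReal.pow_ne_top (Lp.memLp w).2.ne)]

theorem lintegral_ouL_ouSemigroup_sq_le_norm {r s : ℝ} (hr : 0 < r) (hrs : r ≤ s) {f : E n → ℂ}
    (hf : MemLp f 2 (gauss n)) :
    ∫⁻ x, ‖ouL (ouSemigroup s f) x‖ₑ ^ 2 ∂(gauss n) ≤
      ENNReal.ofReal (4 / r ^ 2) * ∫⁻ x, ‖f x‖ₑ ^ 2 ∂(gauss n) := by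
  refine (lintegral_ouL_ouSemigroup_sq_le hr hrs hf).trans ?_
  have h1 := heatForm_le hr (hf.toLp f)
  have h2 := heatForm_nonneg (by positivity : 0 < 2 * r) (hf.toLp f)
  have h3 : 4 / r ^ 2 * (heatForm (hf.toLp f) r - heatForm (hf.toLp f) (2 * r))
      ≤ 4 / r ^ 2 * ‖hf.toLp f‖ ^ 2 := by gcongr; linarith
  refine (ENNReal.ofReal_le_ofReal h3).trans (le_of_eq ?_)
  rw [ENNReal.ofReal_mul (by positivity), norm_toLp_sq,
    ENNReal.ofReal_toReal (lintegral_enorm_sq_lt_top hf).ne]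

/-- Symmetry passes from `e^{-sL}` to its difference quotients and hence to their limits, so no
integration by parts is required. -/
theorem integral_ouL_ouSemigroup_mul_conj {s : ℝ} (hs : 0 < s) {f g : E n → ℂ}
    (hf : MemLp f 2 (gauss n)) (hg : MemLp g 2 (gauss n)) :
    ∫ x, ouL (ouSemigroup s f) x * (starRingEnd ℂ) (g x) ∂(gauss n)
      = ∫ x, f x * (starRingEnd ℂ) (ouL (ouSemigroup s g) x) ∂(gauss n) := by
  obtain ⟨w, hw, _⟩ := exists_tendsto_diff_quotient hs le_rfl (hf.toLp f)
  obtain ⟨v, hv, _⟩ := exists_tendsto_diff_quotient hs le_rfl (hg.toLp g)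
  have hwe := coeFn_eq_ouL_of_tendsto hs hs hf hw
  have hve := coeFn_eq_ouL_of_tendsto hs hs hg hv
  have key : inner ℂ (hg.toLp g) w = inner ℂ v (hf.toLp f) := by
    refine tendsto_nhds_unique (tendsto_const_nhds.inner hw)
      ((hv.inner tendsto_const_nhds).congr fun k => ?_)
    have hp : 0 < s / 2 ^ (k + 2) := by positivity
    rw [inner_smul_left_eq_smul, inner_smul_right_eq_smul, inner_sub_left, inner_sub_right,
      inner_heatOp_left hs, inner_heatOp_left (add_pos hs hp)]
  rw [L2.inner_def, L2.inner_def] at key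
  refine Eq.trans ?_ (key.trans ?_)
  · refine integral_congr_ae ?_
    filter_upwards [hwe, hg.coeFn_toLp] with x h1 h2
    rw [RCLike.inner_apply, h1, h2]
  · refine integral_congr_ae ?_
    filter_upwards [hve, hf.coeFn_toLp] with x h1 h2
    rw [RCLike.inner_apply, h1, h2]

/-- Linearity is read off from uniqueness of the time derivative. -/
theorem ouL_ouSemigroup_sub {s : ℝ} (hs : 0 < s) {f g : E n → ℂ}
    (hf : MemLp f 2 (gauss n)) (hg : MemLp g 2 (gauss n)) (x : E n) :
    ouL (ouSemigroup s (f - g)) x = ouL (ouSemigroup s f) x - ouL (ouSemigroup s g) x := by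
  have h1 := hasDerivAt_ouSemigroup hs (hf.sub hg) x
  have h2 := (hasDerivAt_ouSemigroup hs hf x).fun_sub (hasDerivAt_ouSemigroup hs hg x)
  have h3 : (fun t => ouSemigroup t (f - g) x) =ᶠ[𝓝 s]
      fun t => ouSemigroup t f x - ouSemigroup t g x := by
    filter_upwards [lt_mem_nhds hs] with t ht
    simp only [ouSemigroup, Pi.sub_apply, mul_sub]
    exact integral_sub (integrable_mehler_mul ht hf x) (integrable_mehler_mul ht hg x)
  have h4 := h1.unique (h2.congr_of_eventuallyEq h3)
  linear_combination -h4

theorem stronglyMeasurable_ouSemigroup_family {σ : ℝ → ℝ} (hσ : Measurable σ)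
    {U : E n × ℝ → ℂ} (hU : StronglyMeasurable U) :
    StronglyMeasurable fun p : E n × ℝ => ouSemigroup (σ p.2) (fun y => U (y, p.2)) p.1 := by
  refine StronglyMeasurable.integral_prod_right' (f := fun q : (E n × ℝ) × E n =>
    (mehler (σ q.1.2) q.1.1 q.2 : ℂ) * U (q.2, q.1.2)) ?_
  refine StronglyMeasurable.mul ?_ (hU.comp_measurable (by fun_prop))
  exact (measurable_mehler.comp (f := fun q : (E n × ℝ) × E n => (σ q.1.2, q.1.1, q.2))
    (by fun_prop)).complex_ofReal.stronglyMeasurable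

/-- Joint measurability of `L e^{-ct²L} U(·, t) (x)`. -/
theorem exists_stronglyMeasurable_ouL {c : ℝ} (hc : 0 < c) {U : E n × ℝ → ℂ}
    (hU : StronglyMeasurable U) (hUm : ∀ t, MemLp (fun y => U (y, t)) 2 (gauss n)) :
    ∃ K : E n × ℝ → ℂ, StronglyMeasurable K ∧ ∀ x t, 0 < t →
      K (x, t) = ouL (ouSemigroup (c * t ^ 2) fun y => U (y, t)) x := by
  refine ⟨fun p => (Ioi (0 : ℝ)).indicator
    (fun t => ouL (ouSemigroup (c * t ^ 2) fun y => U (y, t)) p.1) p.2, ?_,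
    fun x t ht => indicator_of_mem (s := Ioi 0) ht _⟩
  -- Up to sign `L e^{-sL}` is a time derivative, hence a pointwise limit of difference quotients
  -- that are jointly measurable in `(x, t)`; times `t ≤ 0` are set to zero.
  refine stronglyMeasurable_of_tendsto atTop (f := fun (k : ℕ) (p : E n × ℝ) =>
    (Prod.snd ⁻¹' (Ioi (0 : ℝ))).indicator (fun p : E n × ℝ => (1 / ((k : ℝ) + 1))⁻¹ •
    (ouSemigroup (c * p.2 ^ 2) (fun y => U (y, p.2)) p.1
      - ouSemigroup (c * p.2 ^ 2 + 1 / ((k : ℝ) + 1)) (fun y => U (y, p.2)) p.1)) p) ?_ ?_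
  · intro k
    refine StronglyMeasurable.indicator ?_ (measurable_snd measurableSet_Ioi)
    exact ((stronglyMeasurable_ouSemigroup_family (σ := fun t => c * t ^ 2) (by fun_prop) hU).sub
      (stronglyMeasurable_ouSemigroup_family (σ := fun t => c * t ^ 2 + 1 / ((k : ℝ) + 1))
        (by fun_prop) hU)).const_smul (1 / ((k : ℝ) + 1))⁻¹
  · rw [tendsto_pi_nhds]
    rintro ⟨x, t⟩
    by_cases ht : 0 < t
    · have h := tendsto_diff_quotient_ouSemigroup (by positivity : 0 < c * t ^ 2) (hUm t) x
        (h := fun k : ℕ => 1 / ((k : ℝ) + 1)) (fun k => by positivity)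
        tendsto_one_div_add_atTop_nhds_zero_nat
      simpa [indicator, ht] using h
    · simp [indicator, ht]

end Generator

end GaussianTent

namespace GaussianTent

/-! ### The square function estimate with a time-dependent truncation. -/

section SquareFunction

variable {n : ℕ}

theorem enorm_sub_sq_le {F : Type*} [NormedAddCommGroup F] (a b : F) :
    ‖a - b‖ₑ ^ 2 ≤ 2 * ‖a‖ₑ ^ 2 + 2 * ‖b‖ₑ ^ 2 := by
  refine (pow_le_pow_left₀ zero_le (enorm_sub_le (a := a) (b := b)) 2).trans ?_
  have h := ENNReal.rpow_add_le_mul_rpow_add_rpow ‖a‖ₑ ‖b‖ₑ (p := 2) (by norm_num)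
  norm_num at h
  rwa [mul_add] at h

theorem lintegral_Ico_pow_three_le {a b : ℝ} (ha : 0 ≤ a) (hab : a ≤ b) :
    ∫⁻ t in Ico a b, ENNReal.ofReal (t ^ 3) ≤ ENNReal.ofReal (b ^ 4) := by
  calc ∫⁻ t in Ico a b, ENNReal.ofReal (t ^ 3)
      ≤ ∫⁻ _ in Ico a b, ENNReal.ofReal (b ^ 3) := by
        refine setLIntegral_mono measurable_const fun t ht => ?_
        exact ENNReal.ofReal_le_ofReal (pow_le_pow_left₀ (ha.trans ht.1) ht.2.le 3)
    _ = ENNReal.ofReal (b ^ 3 * (b - a)) := by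
        rw [setLIntegral_const, Real.volume_Ico, ENNReal.ofReal_mul (pow_nonneg (ha.trans hab) 3)]
    _ ≤ ENNReal.ofReal (b ^ 4) := by
        refine ENNReal.ofReal_le_ofReal ?_
        have : 0 ≤ b ^ 3 := pow_nonneg (ha.trans hab) 3
        nlinarith

/-- The contribution of one dyadic block of times to the square function. -/
theorem lintegral_block_le {c : ℝ} (hc : 0 < c) {τ : ℝ} (hτ : 0 < τ) {g : E n → ℂ}
    (hg : MemLp g 2 (gauss n)) {ρ : E n → ℝ} (hρ : Measurable ρ) :
    ∫⁻ t in Ico τ (√2 * τ), ENNReal.ofReal (t ^ 3) *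
        ∫⁻ x, ‖ouL (ouSemigroup (c * t ^ 2) ({x | t < ρ x}.indicator g)) x‖ₑ ^ 2 ∂(gauss n) ≤
      ENNReal.ofReal (32 / c ^ 2) *
        (ENNReal.ofReal (heatForm (restrictLp hg (measurableSet_lt measurable_const hρ :
          MeasurableSet {x | τ < ρ x})) (c * τ ^ 2)
          - heatForm (restrictLp hg (measurableSet_lt measurable_const hρ :
          MeasurableSet {x | τ < ρ x})) (2 * (c * τ ^ 2)))
        + ∫⁻ x, ({x | τ < ρ x} \ {x | √2 * τ < ρ x}).indicator (fun x => ‖g x‖ₑ ^ 2) x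
          ∂(gauss n)) := by
  set r := c * τ ^ 2 with hr
  have hrp : 0 < r := by positivity
  set S : ℝ → Set (E n) := fun t => {x | t < ρ x} with hS
  have hSm : ∀ t, MeasurableSet (S t) := fun t => measurableSet_lt measurable_const hρ
  set X := heatForm (restrictLp hg (hSm τ)) r - heatForm (restrictLp hg (hSm τ)) (2 * r) with hX
  set Y := ∫⁻ x, (S τ \ S (√2 * τ)).indicator (fun x => ‖g x‖ₑ ^ 2) x ∂(gauss n) with hY
  have main : ∀ t ∈ Ico τ (√2 * τ),
      ∫⁻ x, ‖ouL (ouSemigroup (c * t ^ 2) ((S t).indicator g)) x‖ₑ ^ 2 ∂(gauss n)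
        ≤ ENNReal.ofReal (8 / r ^ 2) * (ENNReal.ofReal X + Y) := by
    intro t ht
    have htp : 0 < t := hτ.trans_le ht.1
    have hrs : r ≤ c * t ^ 2 := by
      rw [hr]; have := ht.1; gcongr
    have hs : 0 < c * t ^ 2 := by positivity
    have m1 : MemLp ((S τ).indicator g) 2 (gauss n) := hg.indicator (hSm τ)
    have m2 : MemLp ((S τ \ S t).indicator g) 2 (gauss n) :=
      hg.indicator ((hSm τ).diff (hSm t))
    -- The truncation is frozen at the start `τ` of the block. The frozen part is controlled by the
    -- decrement of the form, and the correction by the mass of `g` on the points whose cutoff falls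
    -- within the block.
    have e1 : (S t).indicator g = (S τ).indicator g - (S τ \ S t).indicator g := by
      funext x
      rw [Pi.sub_apply]
      by_cases h1 : x ∈ S t
      · have h2 : x ∈ S τ := ht.1.trans_lt h1
        simp [h1, h2]
      · by_cases h2 : x ∈ S τ <;> simp [h1, h2]
    have hb1 := lintegral_ouL_ouSemigroup_sq_le hrp hrs m1
    have hb2 := lintegral_ouL_ouSemigroup_sq_le_norm hrp hrs m2
    have hY2 : ∫⁻ x, ‖(S τ \ S t).indicator g x‖ₑ ^ 2 ∂(gauss n) ≤ Y := by
      refine lintegral_mono fun x => ?_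
      by_cases hx : x ∈ S τ \ S t
      · have hx' : x ∈ S τ \ S (√2 * τ) := ⟨hx.1, fun h => hx.2 (ht.2.trans h)⟩
        simp [hx, hx']
      · simp [hx]
    have hX0 : 0 ≤ X := by
      have := heatForm_add_le hrp hrp (restrictLp hg (hSm τ))
      rw [hX, two_mul]; linarith
    calc _ ≤ ∫⁻ x, (2 * ‖ouL (ouSemigroup (c * t ^ 2) ((S τ).indicator g)) x‖ₑ ^ 2
          + 2 * ‖ouL (ouSemigroup (c * t ^ 2) ((S τ \ S t).indicator g)) x‖ₑ ^ 2) ∂(gauss n) := by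
          refine lintegral_mono fun x => ?_
          rw [e1, ouL_ouSemigroup_sub hs m1 m2]
          exact enorm_sub_sq_le _ _
      _ = 2 * ∫⁻ x, ‖ouL (ouSemigroup (c * t ^ 2) ((S τ).indicator g)) x‖ₑ ^ 2 ∂(gauss n)
          + 2 * ∫⁻ x, ‖ouL (ouSemigroup (c * t ^ 2) ((S τ \ S t).indicator g)) x‖ₑ ^ 2
            ∂(gauss n) := by
          have a1 := (memLp_ouL_ouSemigroup hs m1).1.enorm.pow_const 2
          have a2 := (memLp_ouL_ouSemigroup hs m2).1.enorm.pow_const 2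
          rw [lintegral_add_left' (a1.const_mul 2), lintegral_const_mul'' _ a1,
            lintegral_const_mul'' _ a2]
      _ ≤ 2 * ENNReal.ofReal (4 / r ^ 2 * X) + 2 * (ENNReal.ofReal (4 / r ^ 2) * Y) := by
          gcongr
          · exact hb1
          · exact hb2.trans (by gcongr)
      _ = ENNReal.ofReal (8 / r ^ 2) * (ENNReal.ofReal X + Y) := by
          rw [ENNReal.ofReal_mul (by positivity), show 8 / r ^ 2 = 2 * (4 / r ^ 2) by ring,
            ENNReal.ofReal_mul (p := 2) (by norm_num)]
          norm_num
          ring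
  have hsq2 : (1 : ℝ) ≤ √2 := Real.one_le_sqrt.2 (by norm_num)
  calc _ ≤ ∫⁻ t in Ico τ (√2 * τ), ENNReal.ofReal (t ^ 3) *
        (ENNReal.ofReal (8 / r ^ 2) * (ENNReal.ofReal X + Y)) := by
        refine setLIntegral_mono' measurableSet_Ico fun t ht => ?_
        exact mul_le_mul_right (main t ht) _
    _ = (∫⁻ t in Ico τ (√2 * τ), ENNReal.ofReal (t ^ 3)) *
        (ENNReal.ofReal (8 / r ^ 2) * (ENNReal.ofReal X + Y)) :=
        lintegral_mul_const _ (by fun_prop)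
    _ ≤ ENNReal.ofReal ((√2 * τ) ^ 4) * (ENNReal.ofReal (8 / r ^ 2) * (ENNReal.ofReal X + Y)) := by
        gcongr
        exact lintegral_Ico_pow_three_le hτ.le (by nlinarith)
    -- `(√2 τ)⁴ · 8/r² = 32/c²`, since `r = cτ²`.
    _ = ENNReal.ofReal (32 / c ^ 2) * (ENNReal.ofReal X + Y) := by
        rw [← mul_assoc, ← ENNReal.ofReal_mul (by positivity)]
        congr 2
        have : √2 ^ 4 = 4 := by
          rw [show 4 = 2 * 2 by norm_num, pow_mul, Real.sq_sqrt (by norm_num)]; norm_num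
        rw [mul_pow, this, hr]
        field_simp
        norm_num

/-- The square function estimate for truncations of `g` that depend on time in an arbitrary
monotone way. -/
theorem lintegral_square_function_le {c : ℝ} (hc : 0 < c) {a b : ℝ} (ha : 0 < a) {g : E n → ℂ}
    (hgm : StronglyMeasurable g)
    (hg : MemLp g 2 (gauss n)) {ρ : E n → ℝ} (hρ : Measurable ρ) :
    ∫⁻ t in Ioo a b, ENNReal.ofReal (t ^ 3) *
        ∫⁻ x, ‖ouL (ouSemigroup (c * t ^ 2) ({x | t < ρ x}.indicator g)) x‖ₑ ^ 2 ∂(gauss n) ≤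
      ENNReal.ofReal (1056 / c ^ 2) * ∫⁻ x, ‖g x‖ₑ ^ 2 ∂(gauss n) := by
  -- The ratio `√2` makes the semigroup times `c τ_j²` double from block to block, as in the dyadic
  -- telescoping estimate.
  set τ : ℕ → ℝ := fun j => √2 ^ j * a with hτ
  have hsq2 : (1 : ℝ) < √2 := by
    rw [Real.lt_sqrt] <;> norm_num
  have hτp : ∀ j, 0 < τ j := fun j => by positivity
  have hτs : ∀ j, τ (j + 1) = √2 * τ j := fun j => by simp only [hτ, pow_succ]; ring
  have hτm : Monotone τ := monotone_nat_of_le_succ fun j => by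
    rw [hτs]; nlinarith [hτp j]
  have hτr : ∀ j, c * τ j ^ 2 = 2 ^ j * (c * a ^ 2) := fun j => by
    simp only [hτ]
    rw [mul_pow, ← pow_mul, mul_comm j 2, pow_mul, Real.sq_sqrt (by norm_num)]; ring
  obtain ⟨J, hJ⟩ : ∃ J, b ≤ τ J := by
    obtain ⟨J, hJ⟩ := pow_unbounded_of_one_lt (b / a) hsq2
    exact ⟨J, by rw [div_lt_iff₀ ha] at hJ; exact hJ.le⟩
  set S : ℕ → Set (E n) := fun j => {x | τ j < ρ x} with hS
  have hSm : ∀ j, MeasurableSet (S j) := fun j => measurableSet_lt measurable_const hρ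
  have hSa : Antitone S := fun i j hij x hx => (hτm hij).trans_lt hx
  have hcover : Ioo a b ⊆ ⋃ j ∈ Finset.range J, Ico (τ j) (√2 * τ j) := by
    intro t ht
    have hex : ∃ j, t < τ j := ⟨J, ht.2.trans_le hJ⟩
    classical
    have hspec := Nat.find_spec hex
    have hmin := fun m (hm : m < Nat.find hex) => Nat.find_min hex hm
    have hle : Nat.find hex ≤ J := Nat.find_min' hex (ht.2.trans_le hJ)
    have h0 : Nat.find hex ≠ 0 := by
      intro h0
      rw [h0] at hspec
      simp only [hτ, pow_zero, one_mul] at hspec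
      exact lt_asymm hspec ht.1
    obtain ⟨i, hi⟩ := Nat.exists_eq_succ_of_ne_zero h0
    rw [mem_iUnion₂]
    refine ⟨i, Finset.mem_range.2 (by omega), not_lt.1 (hmin i (by omega)), ?_⟩
    rw [← hτs, ← Nat.succ_eq_add_one, ← hi]
    exact hspec
  set N := ∫⁻ x, ‖g x‖ₑ ^ 2 ∂(gauss n) with hN
  have hNfin : N < ∞ := lintegral_enorm_sq_lt_top hg
  set X : ℕ → ℝ := fun j => heatForm (restrictLp hg (hSm j)) (2 ^ j * (c * a ^ 2))
    - heatForm (restrictLp hg (hSm j)) (2 ^ (j + 1) * (c * a ^ 2)) with hX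
  have hX0 : ∀ j, 0 ≤ X j := fun j => by
    have hp : 0 < 2 ^ j * (c * a ^ 2) := by positivity
    have := heatForm_add_le hp hp (restrictLp hg (hSm j))
    simp only [hX]
    rw [show (2 : ℝ) ^ (j + 1) * (c * a ^ 2) = 2 ^ j * (c * a ^ 2) + 2 ^ j * (c * a ^ 2) by ring]
    linarith
  set D : ℕ → Set (E n) := fun j => S j \ S (j + 1) with hD
  have hDd : Pairwise (Function.onFun Disjoint D) := by
    have key : ∀ i j, i < j → Disjoint (D i) (D j) := fun i j hij => by
      rw [Set.disjoint_left]
      rintro x ⟨_, hx⟩ ⟨hx2, _⟩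
      exact hx (hSa (by omega : i + 1 ≤ j) hx2)
    intro i j hij
    rcases lt_or_gt_of_ne hij with h | h
    · exact key i j h
    · exact (key j i h).symm
  have hgm2 : Measurable fun x => ‖g x‖ₑ ^ 2 := hgm.enorm.pow_const 2
  calc _ ≤ ∫⁻ t in ⋃ j ∈ Finset.range J, Ico (τ j) (√2 * τ j), ENNReal.ofReal (t ^ 3) *
        ∫⁻ x, ‖ouL (ouSemigroup (c * t ^ 2) ({x | t < ρ x}.indicator g)) x‖ₑ ^ 2 ∂(gauss n) :=
        lintegral_mono_set hcover
    _ ≤ ∑ j ∈ Finset.range J, ∫⁻ t in Ico (τ j) (√2 * τ j), ENNReal.ofReal (t ^ 3) *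
        ∫⁻ x, ‖ouL (ouSemigroup (c * t ^ 2) ({x | t < ρ x}.indicator g)) x‖ₑ ^ 2 ∂(gauss n) := by
        refine le_of_eq (lintegral_biUnion_finset (fun i _ j _ hij => ?_)
          (fun _ _ => measurableSet_Ico) _)
        simp only [← hτs]
        exact hτm.pairwise_disjoint_on_Ico_succ hij
    _ ≤ ∑ j ∈ Finset.range J, ENNReal.ofReal (32 / c ^ 2) * (ENNReal.ofReal (X j)
        + ∫⁻ x, (D j).indicator (fun x => ‖g x‖ₑ ^ 2) x ∂(gauss n)) := by
        refine Finset.sum_le_sum fun j _ => ?_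
        refine (lintegral_block_le hc (hτp j) hg hρ).trans (le_of_eq ?_)
        have e : (2 : ℝ) ^ (j + 1) * (c * a ^ 2) = 2 * (c * τ j ^ 2) := by rw [hτr]; ring
        simp only [hX, hD, hS, hτs]
        rw [e, ← hτr]
    _ = ENNReal.ofReal (32 / c ^ 2) * (ENNReal.ofReal (∑ j ∈ Finset.range J, X j)
        + ∫⁻ x, ∑ j ∈ Finset.range J, (D j).indicator (fun x => ‖g x‖ₑ ^ 2) x ∂(gauss n)) := by
        rw [← Finset.mul_sum, Finset.sum_add_distrib, ENNReal.ofReal_sum_of_nonneg fun j _ => hX0 j,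
          lintegral_finsetSum _ fun j _ => hgm2.indicator ((hSm j).diff (hSm (j + 1)))]
    _ ≤ ENNReal.ofReal (32 / c ^ 2) * (ENNReal.ofReal (32 * N.toReal) + N) := by
        gcongr
        · exact sum_heatForm_indicator_le (by positivity) J hgm hg hSm hSa
        · exact lintegral_mono fun x => sum_indicator_le _ hDd _ _
    -- `1056 = 32 (32 + 1)`: the frozen parts give `32`, and the corrections give one because the
    -- sets `D j` are disjoint.
    _ = ENNReal.ofReal (1056 / c ^ 2) * N := by
        rw [ENNReal.ofReal_mul (by norm_num), ENNReal.ofReal_toReal hNfin.ne,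
          show 1056 / c ^ 2 = (32 / c ^ 2) * 33 by ring, ENNReal.ofReal_mul (by positivity)]
        norm_num
        ring

end SquareFunction

end GaussianTent

/-! ### Duality: integrals over windows of times are bounded by the energy. -/

namespace GaussianTent

theorem eLpNorm_two_lt_top {α : Type*} [MeasurableSpace α] {μ : Measure α} {f : α → ℂ}
    (h : ∫⁻ x, ‖f x‖ₑ ^ 2 ∂μ < ∞) : eLpNorm f 2 μ < ∞ := by
  rw [← eLpNorm_two_sq] at h
  by_contra h1
  rw [not_lt, top_le_iff] at h1
  simp [h1] at h

section Window

variable {n : ℕ}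

/-- The energy `∫_s ‖U(·, t)‖² dt/t`. -/
noncomputable def energy (U : E n × ℝ → ℂ) (s : Set ℝ) : ℝ≥0∞ :=
  ∫⁻ t in s, ENNReal.ofReal t⁻¹ * ∫⁻ x, ‖U (x, t)‖ₑ ^ 2 ∂(gauss n)

/-- The kernel `ψ(t) t K(x, t)` cut off at `t < ρ(x)`. -/
noncomputable def cutKernel (ψ : ℝ → ℂ) (K : E n × ℝ → ℂ) (ρ : E n → ℝ) (p : E n × ℝ) : ℂ :=
  {p : E n × ℝ | p.2 < ρ p.1}.indicator (fun p => ψ p.2 * p.2 * K p) p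

/-- The integral of the cut-off kernel over the times in `(a, b)`. -/
noncomputable def windowInt (ψ : ℝ → ℂ) (K : E n × ℝ → ℂ) (ρ : E n → ℝ) (a b : ℝ) (x : E n) : ℂ :=
  ∫ t in Ioo a b, cutKernel ψ K ρ (x, t)

theorem measurableSet_cut {ρ : E n → ℝ} (hρ : Measurable ρ) :
    MeasurableSet {p : E n × ℝ | p.2 < ρ p.1} :=
  measurableSet_lt measurable_snd (hρ.comp measurable_fst)

theorem stronglyMeasurable_cutKernel {ψ : ℝ → ℂ} {K : E n × ℝ → ℂ} {ρ : E n → ℝ}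
    (hψ : StronglyMeasurable ψ) (hK : StronglyMeasurable K) (hρ : Measurable ρ) :
    StronglyMeasurable (cutKernel ψ K ρ) := by
  refine StronglyMeasurable.indicator ?_ (measurableSet_cut hρ)
  refine ((hψ.comp_measurable measurable_snd).mul ?_).mul hK
  exact (Complex.measurable_ofReal.comp measurable_snd).stronglyMeasurable

theorem stronglyMeasurable_windowInt {ψ : ℝ → ℂ} {K : E n × ℝ → ℂ} {ρ : E n → ℝ}
    (hψ : StronglyMeasurable ψ) (hK : StronglyMeasurable K) (hρ : Measurable ρ) (a b : ℝ) :
    StronglyMeasurable (windowInt ψ K ρ a b) :=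
  (stronglyMeasurable_cutKernel hψ hK hρ).integral_prod_right'

/-- A qualitative bound that degenerates as `a → 0`. It serves to justify Fubini and to know that
the window integral has finite norm before that norm is divided out. -/
theorem memLp_cutKernel {ψ : ℝ → ℂ} {K U : E n × ℝ → ℂ} {ρ : E n → ℝ} {c a b : ℝ} {A : ℝ≥0}
    (hc : 0 < c) (ha : 0 < a) (hψ : StronglyMeasurable ψ) (hψA : ∀ t, ‖ψ t‖ ≤ A)
    (hK : StronglyMeasurable K) (hρ : Measurable ρ)
    (hUm : ∀ t, MemLp (fun y => U (y, t)) 2 (gauss n))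
    (hKU : ∀ x t, 0 < t → K (x, t) = ouL (ouSemigroup (c * t ^ 2) fun y => U (y, t)) x)
    (hfin : energy U (Ioo a b) < ∞) :
    MemLp (cutKernel ψ K ρ) 2 ((gauss n).prod (volume.restrict (Ioo a b))) := by
  have hm := stronglyMeasurable_cutKernel hψ hK hρ
  refine ⟨hm.aestronglyMeasurable, eLpNorm_two_lt_top ?_⟩
  · rw [lintegral_prod_symm _ (hm.enorm.pow_const 2).aemeasurable]
    refine lt_of_le_of_lt (b := ENNReal.ofReal (A ^ 2 * (4 / (c ^ 2 * a))) * energy U (Ioo a b))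
      ?_ (ENNReal.mul_lt_top ENNReal.ofReal_lt_top hfin)
    rw [energy, ← lintegral_const_mul' _ _ ENNReal.ofReal_ne_top]
    refine setLIntegral_mono' measurableSet_Ioo fun t ht => ?_
    have htp : 0 < t := ha.trans ht.1
    have hs : 0 < c * t ^ 2 := by positivity
    have hb := lintegral_ouL_ouSemigroup_sq_le_norm hs le_rfl (hUm t)
    have h1 : ∀ x, ‖cutKernel ψ K ρ (x, t)‖ₑ ^ 2 ≤ ENNReal.ofReal (A ^ 2 * t ^ 2) *
        ‖ouL (ouSemigroup (c * t ^ 2) fun y => U (y, t)) x‖ₑ ^ 2 := by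
      intro x
      have h3 : ‖cutKernel ψ K ρ (x, t)‖ₑ ≤ ‖ψ t * t * K (x, t)‖ₑ :=
        enorm_indicator_le_enorm_self _ _
      refine (pow_le_pow_left₀ zero_le h3 2).trans ?_
      rw [enorm_mul, mul_pow, hKU x t htp]
      refine mul_le_mul_left ?_ _
      rw [← ofReal_norm, ← ENNReal.ofReal_pow (norm_nonneg _)]
      refine ENNReal.ofReal_le_ofReal ?_
      rw [norm_mul, Complex.norm_real, Real.norm_of_nonneg htp.le, mul_pow]
      have := hψA t
      gcongr
    calc ∫⁻ x, ‖cutKernel ψ K ρ (x, t)‖ₑ ^ 2 ∂(gauss n)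
        ≤ ∫⁻ x, ENNReal.ofReal (A ^ 2 * t ^ 2) *
          ‖ouL (ouSemigroup (c * t ^ 2) fun y => U (y, t)) x‖ₑ ^ 2 ∂(gauss n) := lintegral_mono h1
      _ = ENNReal.ofReal (A ^ 2 * t ^ 2) *
          ∫⁻ x, ‖ouL (ouSemigroup (c * t ^ 2) fun y => U (y, t)) x‖ₑ ^ 2 ∂(gauss n) :=
          lintegral_const_mul' _ _ ENNReal.ofReal_ne_top
      _ ≤ ENNReal.ofReal (A ^ 2 * t ^ 2) * (ENNReal.ofReal (4 / (c * t ^ 2) ^ 2) *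
          ∫⁻ x, ‖U (x, t)‖ₑ ^ 2 ∂(gauss n)) := by gcongr
      _ ≤ _ := by
          rw [← mul_assoc, ← mul_assoc, ← ENNReal.ofReal_mul (by positivity),
            ← ENNReal.ofReal_mul (by positivity)]
          refine mul_le_mul_left (ENNReal.ofReal_le_ofReal ?_) _
          have e : (A : ℝ) ^ 2 * t ^ 2 * (4 / (c * t ^ 2) ^ 2)
              = A ^ 2 * (4 / (c ^ 2 * t)) * t⁻¹ := by field_simp
          rw [e]
          have := ht.1.le
          gcongr

theorem memLp_windowInt {ψ : ℝ → ℂ} {K : E n × ℝ → ℂ} {ρ : E n → ℝ} {a b : ℝ}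
    (hψ : StronglyMeasurable ψ) (hK : StronglyMeasurable K) (hρ : Measurable ρ)
    (hk : MemLp (cutKernel ψ K ρ) 2 ((gauss n).prod (volume.restrict (Ioo a b)))) :
    MemLp (windowInt ψ K ρ a b) 2 (gauss n) := by
  have hm := stronglyMeasurable_cutKernel hψ hK hρ
  refine ⟨(stronglyMeasurable_windowInt hψ hK hρ a b).aestronglyMeasurable,
    eLpNorm_two_lt_top ?_⟩
  · have h1 : ∀ x, ‖windowInt ψ K ρ a b x‖ₑ ^ 2 ≤ volume (Ioo a b) *
        ∫⁻ t in Ioo a b, ‖cutKernel ψ K ρ (x, t)‖ₑ ^ 2 := by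
      intro x
      refine (pow_le_pow_left₀ zero_le (enorm_integral_le_lintegral_enorm _) 2).trans ?_
      have := lintegral_mul_sq_le (μ := volume.restrict (Ioo a b)) (f := fun _ => 1)
        (g := fun t => ‖cutKernel ψ K ρ (x, t)‖ₑ) aemeasurable_const
        (hm.comp_measurable measurable_prodMk_left).enorm.aemeasurable
      simpa using this
    refine (lintegral_mono h1).trans_lt ?_
    rw [lintegral_const_mul' _ _ measure_Ioo_lt_top.ne,
      ← lintegral_prod _ (hm.enorm.pow_const 2).aemeasurable]
    exact ENNReal.mul_lt_top measure_Ioo_lt_top (lintegral_enorm_sq_lt_top hk)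

/-- The `L²` bound for the truncated integrals. -/
theorem lintegral_windowInt_sq_le {ψ : ℝ → ℂ} {K U : E n × ℝ → ℂ} {ρ : E n → ℝ} {c a b : ℝ}
    {A : ℝ≥0} (hc : 0 < c) (ha : 0 < a) (hψ : StronglyMeasurable ψ) (hψA : ∀ t, ‖ψ t‖ ≤ A)
    (hK : StronglyMeasurable K) (hρ : Measurable ρ) (hU : StronglyMeasurable U)
    (hUm : ∀ t, MemLp (fun y => U (y, t)) 2 (gauss n))
    (hKU : ∀ x t, 0 < t → K (x, t) = ouL (ouSemigroup (c * t ^ 2) fun y => U (y, t)) x)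
    (hfin : energy U (Ioo a b) < ∞) :
    ∫⁻ x, ‖windowInt ψ K ρ a b x‖ₑ ^ 2 ∂(gauss n) ≤
      ENNReal.ofReal (1056 / c ^ 2) * A ^ 2 * energy U (Ioo a b) := by
  have hk := memLp_cutKernel hc ha hψ hψA hK hρ hUm hKU hfin (b := b)
  have hGm := stronglyMeasurable_windowInt hψ hK hρ a b
  have hG := memLp_windowInt hψ hK hρ hk
  set G := windowInt ψ K ρ a b with hGdef
  set N := ∫⁻ x, ‖G x‖ₑ ^ 2 ∂(gauss n) with hN
  have hNfin : N < ∞ := lintegral_enorm_sq_lt_top hG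
  have hSt : ∀ t, MeasurableSet {x : E n | t < ρ x} := fun t => measurableSet_lt measurable_const hρ
  have hgt : ∀ t, MemLp ({x : E n | t < ρ x}.indicator G) 2 (gauss n) := fun t =>
    hG.indicator (hSt t)
  -- `Q(x, t)` is `L e^{-ct²L}(1_{t < ρ} G)(x)` in a jointly measurable version, against which `U`
  -- is paired.
  obtain ⟨Q, hQ, hQe⟩ := exists_stronglyMeasurable_ouL hc
    (U := fun p : E n × ℝ => {p : E n × ℝ | p.2 < ρ p.1}.indicator (fun p => G p.1) p)
    ((hGm.comp_measurable measurable_fst).indicator (measurableSet_cut hρ)) hgt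
  have hQe' : ∀ x t, 0 < t → Q (x, t)
      = ouL (ouSemigroup (c * t ^ 2) ({x : E n | t < ρ x}.indicator G)) x := hQe
  have hGprod : MemLp (fun p : E n × ℝ => (starRingEnd ℂ) (G p.1)) 2
      ((gauss n).prod (volume.restrict (Ioo a b))) := by
    exact (MemLp.comp_fst hG _).star
  have hint : Integrable (fun p : E n × ℝ => cutKernel ψ K ρ p * (starRingEnd ℂ) (G p.1))
      ((gauss n).prod (volume.restrict (Ioo a b))) := hk.integrable_mul hGprod
  have e1 : ∫ x, G x * (starRingEnd ℂ) (G x) ∂(gauss n)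
      = ∫ p, cutKernel ψ K ρ p * (starRingEnd ℂ) (G p.1)
        ∂((gauss n).prod (volume.restrict (Ioo a b))) := by
    rw [integral_prod _ hint]
    refine integral_congr_ae (Eventually.of_forall fun x => ?_)
    simp only
    rw [integral_mul_const]
    rfl
  -- For fixed `t` the cutoff is moved onto `G`, and then `L e^{-ct²L}` is moved across by symmetry.
  have e2 : ∫ p, cutKernel ψ K ρ p * (starRingEnd ℂ) (G p.1)
        ∂((gauss n).prod (volume.restrict (Ioo a b)))
      = ∫ t in Ioo a b, ψ t * t * ∫ x, U (x, t) * (starRingEnd ℂ) (Q (x, t)) ∂(gauss n) := by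
    rw [integral_prod_symm _ hint]
    refine setIntegral_congr_fun measurableSet_Ioo fun t ht => ?_
    have htp : 0 < t := ha.trans ht.1
    have hs : 0 < c * t ^ 2 := by positivity
    have h3 := integral_ouL_ouSemigroup_mul_conj hs (hUm t) (hgt t)
    simp only
    simp_rw [hQe' _ _ htp]
    rw [← h3, ← integral_const_mul]
    refine integral_congr_ae (Eventually.of_forall fun x => ?_)
    simp only [cutKernel]
    by_cases hx : t < ρ x
    · simp [hx, hKU x t htp, mul_assoc]
    · simp [hx]
  have e3 : N = ‖∫ x, G x * (starRingEnd ℂ) (G x) ∂(gauss n)‖ₑ := by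
    have h4 : ∀ x, G x * (starRingEnd ℂ) (G x) = ((‖G x‖ ^ 2 : ℝ) : ℂ) := fun x => by
      rw [Complex.mul_conj, Complex.normSq_eq_norm_sq]
    simp_rw [h4]
    rw [integral_complex_ofReal, ← ofReal_norm, Complex.norm_real,
      Real.norm_of_nonneg (integral_nonneg fun x => by positivity),
      ofReal_integral_eq_lintegral_ofReal hG.norm.integrable_sq
        (Eventually.of_forall fun x => by positivity)]
    refine lintegral_congr fun x => ?_
    rw [ENNReal.ofReal_pow (norm_nonneg _), ofReal_norm]
  set f₁ : E n × ℝ → ℝ≥0∞ := fun p => ENNReal.ofReal (√p.2⁻¹) * ‖U p‖ₑ with hf₁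
  set f₂ : E n × ℝ → ℝ≥0∞ := fun p => ENNReal.ofReal (A * √(p.2 ^ 3)) * ‖Q p‖ₑ with hf₂
  have hm1 : Measurable f₁ := by
    refine Measurable.mul ?_ hU.enorm
    fun_prop
  have hm2 : Measurable f₂ := by
    refine Measurable.mul ?_ hQ.enorm
    fun_prop
  have e4 : N ≤ ∫⁻ p, f₁ p * f₂ p ∂((gauss n).prod (volume.restrict (Ioo a b))) := by
    rw [e3, e1, e2, lintegral_prod_symm _ (hm1.fun_mul hm2).aemeasurable]
    refine (enorm_integral_le_lintegral_enorm _).trans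
      (setLIntegral_mono' measurableSet_Ioo fun t ht => ?_)
    have htp : 0 < t := ha.trans ht.1
    rw [enorm_mul]
    calc _ ≤ ENNReal.ofReal (A * t) * ∫⁻ x, ‖U (x, t)‖ₑ * ‖Q (x, t)‖ₑ ∂(gauss n) := by
          gcongr
          · rw [← ofReal_norm, norm_mul, Complex.norm_real, Real.norm_of_nonneg htp.le]
            exact ENNReal.ofReal_le_ofReal (mul_le_mul_of_nonneg_right (hψA t) htp.le)
          · refine (enorm_integral_le_lintegral_enorm _).trans (le_of_eq ?_)
            simp_rw [enorm_mul, RCLike.enorm_conj]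
      _ = _ := by
          rw [← lintegral_const_mul' _ _ ENNReal.ofReal_ne_top]
          refine lintegral_congr fun x => ?_
          -- The weight `t` is split so that the squares of the two factors are `t⁻¹`, the weight of
          -- the energy, and `t³`, the weight of the square function.
          have e5 : A * t = √t⁻¹ * (A * √(t ^ 3)) := by
            have : √t⁻¹ * √(t ^ 3) = t := by
              rw [← Real.sqrt_mul (by positivity), show t⁻¹ * t ^ 3 = t ^ 2 by field_simp,
                Real.sqrt_sq htp.le]
            linear_combination -A * this
          simp only [hf₁, hf₂]
          rw [e5, ENNReal.ofReal_mul (by positivity)]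
          ring
  have e6 : ∫⁻ p, f₁ p ^ 2 ∂((gauss n).prod (volume.restrict (Ioo a b))) = energy U (Ioo a b) := by
    rw [lintegral_prod_symm _ (hm1.pow_const 2).aemeasurable, energy]
    refine setLIntegral_congr_fun measurableSet_Ioo fun t ht => ?_
    have htp : 0 < t := ha.trans ht.1
    simp only [hf₁, mul_pow]
    rw [lintegral_const_mul' _ _ (by finiteness), ← ENNReal.ofReal_pow (by positivity),
      Real.sq_sqrt (by positivity)]
  have e7 : ∫⁻ p, f₂ p ^ 2 ∂((gauss n).prod (volume.restrict (Ioo a b)))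
      ≤ A ^ 2 * (ENNReal.ofReal (1056 / c ^ 2) * N) := by
    refine le_trans (le_of_eq ?_) (mul_le_mul_right
      (lintegral_square_function_le hc ha (b := b) hGm hG hρ) _)
    rw [lintegral_prod_symm _ (hm2.pow_const 2).aemeasurable,
      ← lintegral_const_mul' _ _ (by finiteness)]
    refine setLIntegral_congr_fun measurableSet_Ioo fun t ht => ?_
    have htp : 0 < t := ha.trans ht.1
    simp only [hf₂, mul_pow]
    rw [lintegral_const_mul' _ _ (by finiteness), ← ENNReal.ofReal_pow (by positivity),
      mul_pow, Real.sq_sqrt (by positivity), ENNReal.ofReal_mul (by positivity), mul_assoc]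
    simp_rw [hQe' _ _ htp]
    rw [ENNReal.ofReal_pow (by positivity), ENNReal.ofReal_coe_nnreal]
  have e8 : N ^ 2 ≤ energy U (Ioo a b) * (A ^ 2 * (ENNReal.ofReal (1056 / c ^ 2) * N)) := by
    refine (pow_le_pow_left₀ zero_le e4 2).trans
      ((lintegral_mul_sq_le hm1.aemeasurable hm2.aemeasurable).trans ?_)
    rw [e6]
    exact mul_le_mul_right e7 _
  -- The inequality is quadratic in `N` on the left and linear on the right; one factor `N` is
  -- cancelled, which needs `N` finite and nonzero.
  rcases eq_or_ne N 0 with h0 | h0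
  · rw [h0]; exact zero_le
  · have e9 : N * N ≤ (ENNReal.ofReal (1056 / c ^ 2) * A ^ 2 * energy U (Ioo a b)) * N := by
      rw [← sq]; exact e8.trans (le_of_eq (by ring))
    exact (ENNReal.mul_le_mul_iff_left h0 hNfin.ne).1 e9

end Window

end GaussianTent

namespace GaussianTent

/-! ### The tent norm controls the energy; representatives with good slices. -/

section TentNorm

variable {n : ℕ}

theorem measurable_adm : Measurable (adm : E n → ℝ) := by
  -- For `‖x‖ ≥ 1` the logarithm depends only on the natural number `⌊‖x‖⌋₊`, and every function on
  -- a discrete space is measurable.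
  have h : (adm : E n → ℝ) = fun x => if ‖x‖ < 1 then 1 else
      (2 : ℝ) ^ (-((Nat.log 2 ⌊‖x‖⌋₊ : ℤ) + 1)) := by
    funext x
    unfold adm
    split_ifs with hx
    · rfl
    · rw [Int.log_of_one_le_right _ (not_lt.1 hx)]
  rw [h]
  refine Measurable.ite (measurableSet_lt measurable_norm measurable_const) measurable_const ?_
  exact (Measurable.of_discrete (f := fun k : ℕ => (2 : ℝ) ^ (-((Nat.log 2 k : ℤ) + 1)))).comp
    (Nat.measurable_floor.comp measurable_norm)

theorem adm_pos (x : E n) : 0 < adm x := by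
  unfold adm
  split_ifs <;> positivity

theorem adm_le_one (x : E n) : adm x ≤ 1 := by
  unfold adm
  split_ifs with hx
  · exact le_rfl
  · rw [Int.log_of_one_le_right _ (not_lt.1 hx)]
    exact zpow_le_one_of_nonpos₀ (by norm_num) (by omega)

theorem measurableSet_region : MeasurableSet (region n) :=
  (measurableSet_lt measurable_const measurable_snd).inter
    (measurableSet_lt measurable_snd (measurable_adm.comp measurable_fst))

theorem gauss_ball_pos (x : E n) {r : ℝ} (hr : 0 < r) : 0 < gauss n (Metric.ball x r) := by
  have hac : (volume : Measure (E n)) ≪ gauss n := by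
    refine withDensity_absolutelyContinuous' ?_ ?_
    · fun_prop
    · refine Eventually.of_forall fun y => (ENNReal.ofReal_pos.2 ?_).ne'
      have := Real.pi_pos
      positivity
  exact pos_iff_ne_zero.2 fun h => (Metric.measure_ball_pos volume x hr).ne' (hac h)

theorem tentNorm_two_sq (u : E n × ℝ → ℂ) :
    tentNorm 2 u ^ 2 = ∫⁻ x, ∫⁻ z in cone x,
      ‖u z‖ₑ ^ 2 / (ENNReal.ofReal z.2 * gauss n (Metric.ball z.1 z.2))
        ∂((gauss n).prod volume) ∂(gauss n) := by
  rw [tentNorm, ← ENNReal.rpow_natCast, ← ENNReal.rpow_mul]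
  norm_num

theorem measurable_gauss_ball :
    Measurable fun z : E n × ℝ => gauss n (Metric.ball z.1 z.2) := by
  have h : MeasurableSet {p : (E n × ℝ) × E n | dist p.2 p.1.1 < p.1.2} :=
    measurableSet_lt (by fun_prop) (by fun_prop)
  exact measurable_measure_prodMk_left h

/-- Fubini: the Gaussian tent norm with exponent two controls the energy of any representative. -/
theorem energy_le_tentNorm_sq {u U : E n × ℝ → ℂ} (hU : StronglyMeasurable U)
    (huU : (region n).indicator u =ᵐ[(gauss n).prod volume] U) :
    energy U (Ioi 0) ≤ tentNorm 2 u ^ 2 := by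
  set w : E n × ℝ → ℝ≥0∞ := fun z =>
    ‖U z‖ₑ ^ 2 / (ENNReal.ofReal z.2 * gauss n (Metric.ball z.1 z.2)) with hw
  have hwm : Measurable w := by
    refine (hU.enorm.pow_const 2).div (Measurable.mul ?_ measurable_gauss_ball)
    fun_prop
  have hT : MeasurableSet {p : E n × (E n × ℝ) | ‖p.2.1 - p.1‖ < p.2.2} :=
    measurableSet_lt (by fun_prop) (by fun_prop)
  have h1 : tentNorm 2 u ^ 2 = ∫⁻ x, ∫⁻ z,
      {p : E n × (E n × ℝ) | ‖p.2.1 - p.1‖ < p.2.2}.indicator (fun p => w p.2) (x, z)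
        ∂((gauss n).prod volume) ∂(gauss n) := by
    rw [tentNorm_two_sq]
    refine lintegral_congr fun x => ?_
    have hc : MeasurableSet (cone x) := measurableSet_region.inter
      (measurableSet_lt (f := fun z : E n × ℝ => ‖z.1 - x‖) (by fun_prop) measurable_snd)
    rw [← lintegral_indicator hc]
    refine lintegral_congr_ae ?_
    filter_upwards [huU] with z hz
    by_cases hzx : ‖z.1 - x‖ < z.2
    · rw [indicator_of_mem (show (x, z) ∈ {p : E n × (E n × ℝ) | ‖p.2.1 - p.1‖ < p.2.2} from hzx)]
      simp only [hw, ← hz]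
      by_cases hr : z ∈ region n
      · rw [indicator_of_mem (show z ∈ cone x from ⟨hr, hzx⟩), indicator_of_mem hr]
      · rw [indicator_of_notMem (fun h : z ∈ cone x => hr h.1), indicator_of_notMem hr]
        simp
    · rw [indicator_of_notMem (fun h : z ∈ cone x => hzx h.2), indicator_of_notMem
        (show (x, z) ∉ {p : E n × (E n × ℝ) | ‖p.2.1 - p.1‖ < p.2.2} from hzx)]
  have h2 : Measurable ({p : E n × (E n × ℝ) | ‖p.2.1 - p.1‖ < p.2.2}.indicator
      (fun p => w p.2)) := (hwm.comp measurable_snd).indicator hT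
  have h3 : energy U (Ioi 0) = ∫⁻ z, {z : E n × ℝ | 0 < z.2}.indicator
      (fun z => ENNReal.ofReal z.2⁻¹ * ‖U z‖ₑ ^ 2) z ∂((gauss n).prod volume) := by
    have hm : Measurable ({z : E n × ℝ | 0 < z.2}.indicator
        (fun z => ENNReal.ofReal z.2⁻¹ * ‖U z‖ₑ ^ 2)) := by
      refine Measurable.indicator (Measurable.mul ?_ (hU.enorm.pow_const 2))
        (measurableSet_lt (by fun_prop) (by fun_prop))
      fun_prop
    rw [lintegral_prod_symm _ hm.aemeasurable, energy, ← lintegral_indicator measurableSet_Ioi]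
    refine lintegral_congr fun t => ?_
    by_cases ht : 0 < t
    · rw [indicator_of_mem (show t ∈ Ioi 0 from ht),
        ← lintegral_const_mul' _ _ ENNReal.ofReal_ne_top]
      refine lintegral_congr fun x => ?_
      rw [indicator_of_mem (show (x, t) ∈ {z : E n × ℝ | 0 < z.2} from ht)]
    · rw [indicator_of_notMem (show t ∉ Ioi 0 from ht)]
      simp [ht]
  -- After the swap, for fixed `z = (y, t)` the points `x` that contribute form the ball `B(y, t)`,
  -- whose Gaussian measure cancels the one in the denominator.
  rw [h1, h3, lintegral_lintegral_swap (f := fun x z =>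
    {p : E n × (E n × ℝ) | ‖p.2.1 - p.1‖ < p.2.2}.indicator (fun p => w p.2) (x, z))
    h2.aemeasurable]
  refine lintegral_mono fun z => ?_
  by_cases hz : 0 < z.2
  · rw [indicator_of_mem (show z ∈ {z : E n × ℝ | 0 < z.2} from hz)]
    have h4 : ∀ x : E n, {p : E n × (E n × ℝ) | ‖p.2.1 - p.1‖ < p.2.2}.indicator
        (fun p => w p.2) (x, z) = (Metric.ball z.1 z.2).indicator (fun _ => w z) x := by
      intro x
      simp only [indicator, mem_ofPred_eq, Metric.mem_ball, dist_eq_norm', hw]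
    simp_rw [h4]
    rw [lintegral_indicator_const Metric.isOpen_ball.measurableSet]
    have hb := (gauss_ball_pos z.1 hz).ne'
    have hb' : gauss n (Metric.ball z.1 z.2) ≠ ∞ := measure_ne_top _ _
    simp only [hw]
    rw [ENNReal.ofReal_inv_of_pos hz, div_eq_mul_inv, ENNReal.mul_inv (Or.inr hb') (Or.inr hb),
      mul_assoc, mul_assoc, ENNReal.inv_mul_cancel hb hb', mul_one, mul_comm]
  · rw [indicator_of_notMem (show z ∉ {z : E n × ℝ | 0 < z.2} from hz)]
    exact zero_le

theorem ae_prod_swap {P : E n × ℝ → Prop} (h : ∀ᵐ z ∂((gauss n).prod volume), P z) :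
    ∀ᵐ t : ℝ, ∀ᵐ x ∂(gauss n), P (x, t) := by
  have h1 : ∀ᵐ z ∂((volume : Measure ℝ).prod (gauss n)), P z.swap := by
    rw [← Measure.prod_swap] at h
    exact ae_of_ae_map measurable_swap.aemeasurable h
  exact Measure.ae_ae_of_ae_prod h1

/-- A function in the tent space has a strongly measurable representative all of whose slices
are square integrable. -/
theorem MemTent.exists_representative {u : E n × ℝ → ℂ} (hu : MemTent 2 u) :
    ∃ U : E n × ℝ → ℂ, StronglyMeasurable U ∧
      (∀ t, MemLp (fun y => U (y, t)) 2 (gauss n)) ∧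
      (∀ᵐ t : ℝ ∂(volume.restrict (Ioi 0)), slice u t =ᵐ[gauss n] fun y => U (y, t)) ∧
      energy U (Ioi 0) ≤ tentNorm 2 u ^ 2 := by
  have hi : AEStronglyMeasurable ((region n).indicator u) ((gauss n).prod volume) :=
    (aestronglyMeasurable_indicator_iff measurableSet_region).2 hu.1
  set V := hi.mk _ with hV
  have hVm : StronglyMeasurable V := hi.stronglyMeasurable_mk
  have hVe := energy_le_tentNorm_sq hVm hi.ae_eq_mk
  have hI : Measurable fun t => ∫⁻ x, ‖V (x, t)‖ₑ ^ 2 ∂(gauss n) :=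
    (hVm.enorm.pow_const 2).lintegral_prod_left'
  have hS : MeasurableSet {t | ∫⁻ x, ‖V (x, t)‖ₑ ^ 2 ∂(gauss n) < ∞} :=
    measurableSet_lt hI measurable_const
  set S := {t | ∫⁻ x, ‖V (x, t)‖ₑ ^ 2 ∂(gauss n) < ∞} with hSdef
  have hSae : ∀ᵐ t : ℝ ∂(volume.restrict (Ioi 0)), t ∈ S := by
    have hfin : ∫⁻ t in Ioi (0 : ℝ), ENNReal.ofReal t⁻¹ * ∫⁻ x, ‖V (x, t)‖ₑ ^ 2 ∂(gauss n) ≠ ∞ :=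
      (hVe.trans_lt (ENNReal.pow_lt_top hu.2)).ne
    have hm : Measurable fun t : ℝ => ENNReal.ofReal t⁻¹ * ∫⁻ x, ‖V (x, t)‖ₑ ^ 2 ∂(gauss n) := by
      refine Measurable.mul ?_ hI
      fun_prop
    filter_upwards [ae_lt_top hm hfin, ae_restrict_mem measurableSet_Ioi] with t h1 h2
    change ∫⁻ x, ‖V (x, t)‖ₑ ^ 2 ∂(gauss n) < ∞
    refine lt_top_iff_ne_top.2 fun h3 => ?_
    rw [h3, ENNReal.mul_top (ENNReal.ofReal_pos.2 (inv_pos.2 h2)).ne'] at h1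
    exact lt_irrefl _ h1
  -- The null set of times with a slice of infinite norm is set to zero, so that every slice, not
  -- only almost every one, is in `L²(γ)`.
  refine ⟨(Prod.snd ⁻¹' S).indicator V, hVm.indicator (measurable_snd hS), fun t => ?_, ?_, ?_⟩
  · by_cases ht : t ∈ S
    · have h1 : (fun y => (Prod.snd ⁻¹' S).indicator V (y, t)) = fun y : E n => V (y, t) := by
        funext y
        rw [indicator_of_mem (show (y, t) ∈ Prod.snd ⁻¹' S from ht)]
      rw [h1]
      refine ⟨(hVm.comp_measurable measurable_prodMk_right).aestronglyMeasurable, ?_⟩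
      exact eLpNorm_two_lt_top ht
    · have h1 : (fun y => (Prod.snd ⁻¹' S).indicator V (y, t)) = fun _ : E n => 0 := by
        funext y
        rw [indicator_of_notMem (show (y, t) ∉ Prod.snd ⁻¹' S from ht)]
      rw [h1]
      exact MemLp.zero'
  · filter_upwards [hSae, ae_restrict_of_ae (ae_prod_swap hi.ae_eq_mk)] with t ht h1
    filter_upwards [h1] with x hx
    rw [indicator_of_mem (show (x, t) ∈ Prod.snd ⁻¹' S from ht)]
    exact hx
  · refine le_trans ?_ hVe
    refine lintegral_mono fun t => mul_le_mul_right (lintegral_mono fun x => ?_) _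
    exact pow_le_pow_left₀ zero_le (enorm_indicator_le_enorm_self _ _) 2

end TentNorm

end GaussianTent

/-! ### Passage to the limit `ε → 0` and assembly of the proof. -/

namespace GaussianTent

/-- Completeness of `L²` along a continuous parameter tending to zero from the right. -/
theorem exists_tendsto_eLpNorm_nhdsGT {α : Type*} [MeasurableSpace α] {μ : Measure α}
    {G : ℝ → α → ℂ} {η : ℝ → ℝ≥0∞} (hG : ∀ ε, 0 < ε → MemLp (G ε) 2 μ)
    (hη : Tendsto η (𝓝[>] 0) (𝓝 0))
    (h : ∀ᶠ b in 𝓝[>] 0, ∀ a, 0 < a → a ≤ b → eLpNorm (G a - G b) 2 μ ≤ η b) :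
    ∃ F, MemLp F 2 μ ∧ Tendsto (fun ε => eLpNorm (G ε - F) 2 μ) (𝓝[>] 0) (𝓝 0) := by
  classical
  set f : ℝ → Lp ℂ 2 μ := fun ε => if hε : 0 < ε then (hG ε hε).toLp (G ε) else 0 with hf
  have hc : Cauchy (map f (𝓝[>] 0)) := by
    rw [EMetric.cauchy_iff]
    refine ⟨(inferInstance : (map f (𝓝[>] 0)).NeBot).ne, fun ε hε => ?_⟩
    have h1 : ∀ᶠ b in 𝓝[>] (0 : ℝ), η b < ε / 2 := hη.eventually_lt_const (ENNReal.half_pos hε.ne')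
    obtain ⟨b, ⟨hb, hb1⟩, hb0⟩ := ((h.and h1).and self_mem_nhdsWithin).exists
    have hb0' : 0 < b := hb0
    have key : ∀ a ∈ Ioc 0 b, edist (f a) (f b) < ε / 2 := by
      intro a ha
      simp only [hf, dif_pos ha.1, dif_pos hb0']
      rw [Lp.edist_toLp_toLp]
      exact (hb a ha.1 ha.2).trans_lt hb1
    refine ⟨f '' Ioc 0 b, image_mem_map (Ioc_mem_nhdsGT hb0'), ?_⟩
    rintro _ ⟨a, ha, rfl⟩ _ ⟨a', ha', rfl⟩
    calc edist (f a) (f a') ≤ edist (f a) (f b) + edist (f b) (f a') := edist_triangle _ _ _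
      _ < ε / 2 + ε / 2 := ENNReal.add_lt_add (key a ha) (by rw [edist_comm]; exact key a' ha')
      _ = ε := ENNReal.add_halves ε
  obtain ⟨F, hF⟩ := CompleteSpace.complete hc
  have hF' : Tendsto f (𝓝[>] 0) (𝓝 F) := hF
  refine ⟨F, Lp.memLp F, ?_⟩
  refine (tendsto_iff_edist_tendsto_0.1 hF').congr' ?_
  filter_upwards [self_mem_nhdsWithin] with ε hε
  have hε' : 0 < ε := hε
  simp only [hf, dif_pos hε']
  rw [Lp.edist_def]
  refine eLpNorm_congr_ae ?_
  filter_upwards [(hG ε hε').coeFn_toLp] with x hx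
  simp [hx]

theorem eLpNorm_le_of_tendsto {α : Type*} [MeasurableSpace α] {μ : Measure α}
    {G : ℝ → α → ℂ} {F : α → ℂ} {B : ℝ≥0∞} (hG : ∀ ε, 0 < ε → MemLp (G ε) 2 μ)
    (hF : MemLp F 2 μ) (hB : ∀ ε, 0 < ε → eLpNorm (G ε) 2 μ ≤ B)
    (h : Tendsto (fun ε => eLpNorm (G ε - F) 2 μ) (𝓝[>] 0) (𝓝 0)) : eLpNorm F 2 μ ≤ B := by
  have h1 : Tendsto (fun ε => B + eLpNorm (G ε - F) 2 μ) (𝓝[>] 0) (𝓝 (B + 0)) :=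
    h.const_add B
  rw [add_zero] at h1
  refine ge_of_tendsto h1 ?_
  filter_upwards [self_mem_nhdsWithin] with ε hε
  calc eLpNorm F 2 μ = eLpNorm (G ε - (G ε - F)) 2 μ := by rw [sub_sub_cancel]
    _ ≤ eLpNorm (G ε) 2 μ + eLpNorm (G ε - F) 2 μ :=
      eLpNorm_sub_le (hG ε hε).1 ((hG ε hε).sub hF).1 (by norm_num)
    _ ≤ B + eLpNorm (G ε - F) 2 μ := by gcongr; exact hB ε hε

section Assembly

variable {n : ℕ}

theorem energy_mono (U : E n × ℝ → ℂ) {s t : Set ℝ} (h : s ⊆ t) : energy U s ≤ energy U t :=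
  lintegral_mono_set h

theorem tendsto_energy_Ioo {U : E n × ℝ → ℂ} (h : energy U (Ioi 0) < ∞) :
    Tendsto (fun b => energy U (Ioo 0 b)) (𝓝[>] 0) (𝓝 0) := by
  have h1 : Tendsto ((volume.restrict (Ioi (0 : ℝ))) ∘ fun b => Ioo 0 b) (𝓝[>] 0) (𝓝 0) := by
    have h2 : ((volume.restrict (Ioi (0 : ℝ))) ∘ fun b => Ioo 0 b) = fun b => ENNReal.ofReal b := by
      funext b
      simp only [Function.comp]
      rw [Measure.restrict_apply measurableSet_Ioo,
        inter_eq_self_of_subset_left Ioo_subset_Ioi_self, Real.volume_Ioo, sub_zero]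
    rw [h2]
    have h3 : Tendsto ENNReal.ofReal (𝓝 0) (𝓝 (ENNReal.ofReal 0)) :=
      ENNReal.continuous_ofReal.tendsto 0
    rw [ENNReal.ofReal_zero] at h3
    exact h3.mono_left nhdsWithin_le_nhds
  refine (tendsto_setLIntegral_zero h.ne h1).congr fun b => ?_
  rw [Measure.restrict_restrict measurableSet_Ioo,
    inter_eq_self_of_subset_left Ioo_subset_Ioi_self]
  rfl

theorem integrableOn_cutKernel_iff {ψ : ℝ → ℂ} {K : E n × ℝ → ℂ} {ρ : E n → ℝ} {x : E n}
    (hx : ρ x ≤ 1) (ε : ℝ) :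
    IntegrableOn (fun t => cutKernel ψ K ρ (x, t)) (Ioo ε 1) ↔
      IntegrableOn (fun t => ψ t * t * K (x, t)) (Ioo ε (ρ x)) := by
  have h : (fun t => cutKernel ψ K ρ (x, t))
      = (Iio (ρ x)).indicator fun t => ψ t * t * K (x, t) := rfl
  rw [h, IntegrableOn, integrable_indicator_iff measurableSet_Iio, IntegrableOn,
    Measure.restrict_restrict measurableSet_Iio, inter_comm, Ioo_inter_Iio, min_eq_right hx,
    IntegrableOn]

theorem windowInt_eq {ψ : ℝ → ℂ} {K : E n × ℝ → ℂ} {ρ : E n → ℝ} {x : E n}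
    (hx : ρ x ≤ 1) (ε : ℝ) :
    windowInt ψ K ρ ε 1 x = ∫ t in Ioo ε (ρ x), ψ t * t * K (x, t) := by
  have h : (fun t => cutKernel ψ K ρ (x, t))
      = (Iio (ρ x)).indicator fun t => ψ t * t * K (x, t) := rfl
  rw [windowInt, h, integral_indicator measurableSet_Iio,
    Measure.restrict_restrict measurableSet_Iio, inter_comm, Ioo_inter_Iio, min_eq_right hx]

/-- All cutoffs are at most one, so the truncated integrals are window integrals over `(ε, 1)`. The
window bound gives the Cauchy property through the vanishing energy of `(0, b)`, and also the norm
of the limit. -/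
theorem exists_isPiOne {c δ : ℝ} (hc : 0 < c) (hδ : 0 < δ) {Φ : ℝ → ℂ}
    (hΦ : ContinuousOn Φ (Ioi 0)) {A : ℝ≥0} (hA : ∀ t, 0 < t → ‖Φ t‖ ≤ A)
    {u : E n × ℝ → ℂ} (hu : MemTent 2 u) {ρ : E n → ℝ} (hρ : AEMeasurable ρ (gauss n))
    (hρ1 : ∀ x, ρ x ≤ 1) :
    ∃ F : E n → ℂ, IsPiOne Φ δ c ρ u F ∧
      eLpNorm F 2 (gauss n) ≤ ENNReal.ofReal (33 / c) * A * tentNorm 2 u := by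
  obtain ⟨U, hU, hUm, hUs, hUe⟩ := hu.exists_representative
  have hUfin : energy U (Ioi 0) < ∞ := hUe.trans_lt (ENNReal.pow_lt_top hu.2)
  obtain ⟨K, hK, hKU⟩ := exists_stronglyMeasurable_ouL hc hU hUm
  set ψ : ℝ → ℂ := (Ioi 0).indicator fun t => Φ ((c + δ) * t ^ 2) with hψdef
  have hψ : StronglyMeasurable ψ := by
    classical
    rw [hψdef, ← piecewise_eq_indicator (M := ℂ)]
    refine (ContinuousOn.measurable_piecewise (g := (0 : ℝ → ℂ))
      (hΦ.comp (by fun_prop) fun t ht => ?_) continuousOn_const measurableSet_Ioi).stronglyMeasurable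
    have : 0 < t := ht
    exact mem_Ioi.2 (mul_pos (by positivity) (by positivity))
  have hψA : ∀ t, ‖ψ t‖ ≤ A := by
    intro t
    by_cases ht : 0 < t
    · rw [hψdef, indicator_of_mem (show t ∈ Ioi 0 from ht)]
      exact hA _ (mul_pos (by positivity) (by positivity))
    · rw [hψdef, indicator_of_notMem (show t ∉ Ioi 0 from ht), norm_zero]
      exact A.2
  have hker : ∀ᵐ t : ℝ ∂(volume.restrict (Ioi 0)), ∀ x,
      integrand Φ δ c u x t = ψ t * t * K (x, t) := by
    filter_upwards [hUs, ae_restrict_mem measurableSet_Ioi] with t h1 h2 x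
    have h2' : 0 < t := h2
    rw [integrand, ouSemigroup_congr_ae _ h1, hKU x t h2', hψdef, indicator_of_mem h2]
    have h3 : (t : ℂ) ≠ 0 := by exact_mod_cast h2'.ne'
    field_simp
  have hker' : ∀ ε : ℝ, 0 ≤ ε → ∀ x, integrand Φ δ c u x
      =ᵐ[volume.restrict (Ioo ε (ρ x))] fun t => ψ t * t * K (x, t) := by
    intro ε hε x
    filter_upwards [ae_restrict_of_ae_restrict_of_subset
      (show Ioo ε (ρ x) ⊆ Ioi 0 from fun t ht => hε.trans_lt ht.1) hker] with t ht
    exact ht x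
  -- A measurable version of `ρ`, capped so that it stays at most one everywhere.
  obtain ⟨ρ', hρ'm, hρρ', hρ'1⟩ : ∃ ρ' : E n → ℝ, Measurable ρ' ∧ ρ =ᵐ[gauss n] ρ' ∧
      ∀ x, ρ' x ≤ 1 := by
    refine ⟨fun x => min (hρ.mk ρ x) 1, hρ.measurable_mk.min measurable_const, ?_,
      fun x => min_le_right _ _⟩
    filter_upwards [hρ.ae_eq_mk] with x hx
    rw [← hx, min_eq_left (hρ1 x)]
  have htr : ∀ x, ρ x = ρ' x → ∀ ε : ℝ, 0 ≤ ε →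
      truncPi Φ δ c ρ u ε x = windowInt ψ K ρ' ε 1 x := by
    intro x hx ε hε
    rw [windowInt_eq (hρ'1 x), truncPi, ← hx]
    exact integral_congr_ae (hker' ε hε x)
  have hin : ∀ x, ρ x = ρ' x → ∀ ε : ℝ, 0 ≤ ε →
      (IntegrableOn (integrand Φ δ c u x) (Ioo ε (ρ x)) ↔
        IntegrableOn (fun t => cutKernel ψ K ρ' (x, t)) (Ioo ε 1)) := by
    intro x hx ε hε
    rw [integrableOn_cutKernel_iff (hρ'1 x), ← hx]
    exact integrable_congr (hker' ε hε x)
  have hE : ∀ a b : ℝ, 0 ≤ a → energy U (Ioo a b) < ∞ := fun a b ha =>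
    (energy_mono U fun t ht => ha.trans_lt ht.1).trans_lt hUfin
  have hk : ∀ a b, 0 < a →
      MemLp (cutKernel ψ K ρ') 2 ((gauss n).prod (volume.restrict (Ioo a b))) := fun a b ha =>
    memLp_cutKernel hc ha hψ hψA hK hρ'm hUm hKU (hE a b ha.le)
  have hki : ∀ᵐ x ∂(gauss n), ∀ ε : ℝ, 0 < ε →
      IntegrableOn (fun t => cutKernel ψ K ρ' (x, t)) (Ioo ε 1) := by
    -- The exceptional null set must not depend on `ε`; it is fixed along `1/(k + 1)`, and each
    -- smaller interval inherits integrability.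
    have h1 : ∀ᵐ x ∂(gauss n), ∀ k : ℕ,
        IntegrableOn (fun t => cutKernel ψ K ρ' (x, t)) (Ioo (1 / ((k : ℝ) + 1)) 1) := by
      rw [ae_all_iff]
      intro k
      exact ((hk _ 1 Nat.one_div_pos_of_nat).integrable (by norm_num)).prod_right_ae
    filter_upwards [h1] with x hx ε hε
    obtain ⟨k, hk⟩ := exists_nat_one_div_lt hε
    exact (hx k).mono_set (Ioo_subset_Ioo_left hk.le)
  have hW : ∀ a b, 0 < a → MemLp (windowInt ψ K ρ' a b) 2 (gauss n) := fun a b ha =>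
    memLp_windowInt hψ hK hρ'm (hk a b ha)
  set M : ℝ≥0∞ := ENNReal.ofReal (33 / c) * A with hM
  have hMfin : M ≠ ∞ := by finiteness
  have hWn : ∀ a b, 0 < a →
      eLpNorm (windowInt ψ K ρ' a b) 2 (gauss n) ^ 2 ≤ M ^ 2 * energy U (Ioo a b) := by
    intro a b ha
    rw [eLpNorm_two_sq]
    refine (lintegral_windowInt_sq_le hc ha hψ hψA hK hρ'm hU hUm hKU (hE a b ha.le)).trans ?_
    -- The constant `33` comes from `1056 ≤ 33²`.
    rw [hM, mul_pow, ← ENNReal.ofReal_pow (by positivity), div_pow]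
    gcongr
    norm_num
  have hdiff : ∀ a b, 0 < a → a ≤ b → b < 1 →
      windowInt ψ K ρ' a 1 - windowInt ψ K ρ' b 1 =ᵐ[gauss n] windowInt ψ K ρ' a b := by
    intro a b ha hab hb
    filter_upwards [hki] with x hx
    have h1 := hx a ha
    simp only [Pi.sub_apply, windowInt]
    rw [← Ioc_union_Ioo_eq_Ioo hab hb, setIntegral_union
      (disjoint_left.2 fun t h2 h3 => not_lt.2 h2.2 h3.1) measurableSet_Ioo
      (h1.mono_set fun t h2 => ⟨h2.1, h2.2.trans_lt hb⟩) (hx b (ha.trans_le hab)),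
      add_sub_cancel_right, integral_Ioc_eq_integral_Ioo]
  have hη : Tendsto (fun b => (M ^ 2 * energy U (Ioo 0 b)) ^ (2⁻¹ : ℝ)) (𝓝[>] 0) (𝓝 0) := by
    have h1 := (ENNReal.Tendsto.const_mul (tendsto_energy_Ioo hUfin)
      (Or.inr (ENNReal.pow_ne_top hMfin (n := 2)))).ennrpow_const (2⁻¹ : ℝ)
    simpa using h1
  obtain ⟨F, hF, hFt⟩ := exists_tendsto_eLpNorm_nhdsGT (G := fun ε => windowInt ψ K ρ' ε 1)
    (fun ε hε => hW ε 1 hε) hη (by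
      filter_upwards [self_mem_nhdsWithin, nhdsWithin_le_nhds (Iio_mem_nhds zero_lt_one)]
        with b hb hb1 a ha hab
      rw [eLpNorm_congr_ae (hdiff a b ha hab hb1), ENNReal.le_rpow_inv_iff (by norm_num)]
      norm_num
      exact (hWn a b ha).trans (mul_le_mul_right (energy_mono U (Ioo_subset_Ioo_left ha.le)) _))
  have htrae : ∀ ε : ℝ, 0 ≤ ε → truncPi Φ δ c ρ u ε =ᵐ[gauss n] windowInt ψ K ρ' ε 1 := by
    intro ε hε
    filter_upwards [hρρ'] with x hx
    exact htr x hx ε hε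
  refine ⟨F, ⟨?_, ?_, ?_, ?_, hF, ?_, ?_⟩, ?_⟩
  · filter_upwards [hUs] with t ht
    exact (memLp_congr_ae ht).2 (hUm t)
  · filter_upwards [hUs, ae_restrict_mem measurableSet_Ioi] with t ht h0
    have h0' : 0 < t := h0
    exact contDiff_ouSemigroup (by positivity) ((memLp_congr_ae ht).2 (hUm t))
  · filter_upwards [hρρ', hki] with x hx h1 ε hε
    exact (hin x hx ε hε.le).2 (h1 ε hε)
  · exact fun ε hε => (memLp_congr_ae (htrae ε hε.le)).2 (hW ε 1 hε)
  · refine hFt.congr' ?_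
    filter_upwards [self_mem_nhdsWithin] with ε hε
    have hε' : 0 < ε := hε
    exact eLpNorm_congr_ae ((htrae ε hε'.le).symm.sub EventuallyEq.rfl)
  -- A subsequence of the truncations converges almost everywhere to `F`; where the full integral
  -- converges absolutely, the same truncations converge to it, as their domains exhaust `(0, 1)`.
  · have hεt : Tendsto (fun k : ℕ => 1 / ((k : ℝ) + 1)) atTop (𝓝[>] 0) :=
      tendsto_nhdsWithin_iff.2 ⟨tendsto_one_div_add_atTop_nhds_zero_nat,
        Eventually.of_forall fun k => mem_Ioi.2 Nat.one_div_pos_of_nat⟩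
    obtain ⟨ns, hns, hae⟩ := (tendstoInMeasure_of_tendsto_eLpNorm (by norm_num)
      (fun k : ℕ => (hW (1 / ((k : ℝ) + 1)) 1 Nat.one_div_pos_of_nat).1) hF.1
      (hFt.comp hεt)).exists_seq_tendsto_ae
    filter_upwards [hρρ', hae] with x hx h1 h2
    rw [hin x hx 0 le_rfl] at h2
    rw [htr x hx 0 le_rfl]
    refine tendsto_nhds_unique h1 ?_
    have hun : ⋃ k : ℕ, Ioo (1 / ((k : ℝ) + 1)) 1 = Ioo (0 : ℝ) 1 := by
      ext t
      simp only [mem_iUnion, mem_Ioo]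
      constructor
      · rintro ⟨k, h3, h4⟩
        exact ⟨Nat.one_div_pos_of_nat.trans h3, h4⟩
      · rintro ⟨h3, h4⟩
        obtain ⟨k, hk⟩ := exists_nat_one_div_lt h3
        exact ⟨k, hk, h4⟩
    have h3 := tendsto_setIntegral_of_monotone (μ := volume)
      (f := fun t => cutKernel ψ K ρ' (x, t))
      (s := fun k : ℕ => Ioo (1 / ((k : ℝ) + 1)) 1) (fun k => measurableSet_Ioo)
      (fun k l hkl => Ioo_subset_Ioo_left (Nat.one_div_le_one_div hkl)) (by rw [hun]; exact h2)
    rw [hun] at h3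
    exact h3.comp hns.tendsto_atTop
  · refine eLpNorm_le_of_tendsto (fun ε hε => hW ε 1 hε) hF (fun ε hε => ?_) hFt
    rw [← ENNReal.pow_le_pow_left_iff two_ne_zero, mul_pow]
    refine (hWn ε 1 hε).trans (mul_le_mul_right ?_ _)
    exact (energy_mono U fun t ht => hε.trans ht.1).trans hUe

end Assembly

end GaussianTent

theorem proposition1 (n : ℕ) (δ' : ℝ) (hδ'_pos : 0 < δ') (hδ'_le : δ' ≤ 1) :
    ∃ C : ℝ≥0, ∀ Φ : ℝ → ℂ, IsMultiplierFunction Φ →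
      ∀ A : ℝ≥0, (∀ t : ℝ, 0 < t → ‖Φ t‖ ≤ A) →
      ∀ δ : ℝ, 0 < δ → ∀ u : E n × ℝ → ℂ, MemTent 2 u →
        (∀ κ : ℝ, 1 ≤ κ →
          ∃ F : E n → ℂ, IsPiOne Φ δ δ' (fun x => adm x / κ) u F ∧
            eLpNorm F 2 (gauss n) ≤ C * A * tentNorm 2 u) ∧
        (∀ ρ : E n → ℝ, AEMeasurable ρ (gauss n) → (∀ x, 0 < ρ x ∧ ρ x ≤ 1) →
          ∃ F : E n → ℂ, IsPiOne Φ δ δ' ρ u F ∧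
            eLpNorm F 2 (gauss n) ≤ C * A * tentNorm 2 u) := by
  -- The cutoff `adm / κ` is at most one for `κ ≥ 1`, so both claims are instances of
  -- `exists_isPiOne` with the same constant.
  refine ⟨(33 / δ').toNNReal, fun Φ hΦ A hA δ hδ u hu => ⟨fun κ hκ => ?_, fun ρ hρ hρ1 => ?_⟩⟩
  · exact exists_isPiOne hδ'_pos hδ hΦ.contDiffOn.continuousOn hA hu
      (measurable_adm.div_const κ).aemeasurable
      fun x => (div_le_self (adm_pos x).le hκ).trans (adm_le_one x)
  · exact exists_isPiOne hδ'_pos hδ hΦ.contDiffOn.continuousOn hA hu hρ fun x => (hρ1 x).2
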